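/- **Setting.** Let $n\ge 0$, let $S^{n-1}\subset\mathbb R^n$ be the unit sphere, $r=|x|$, $\theta=x/|x|$, and let $D\subset\mathbb R^n\setminus\{0\}$ be an open cone. For a smooth vector field $V_0$ on $D$, homogeneous of degree $d\in\mathbb R$ ($V_0(rx)=r^dV_0(x)$ for $r>0$), write for $\theta\in S^{n-1}\cap D$: $p_0(\theta)=\langle V_0(\theta),\theta\rangle$ and $v_0(\theta)=V_0(\theta)-p_0(\theta)\theta$. Assume that $V_0$ is *good*: if $p_0\not\equiv0$, then $\{\theta\in S^{n-1}\cap D: p_0(\theta)\ne0\}$ is dense in $S^{n-1}$ and $v_0/p_0$ extends smoothly to the set of all $\theta\in S^{n-1}$ at which $|v_0/p_0|$ does not tend to $+\infty$. (If $p_0\equiv 0$, then $Z$ below is empty.) Let $Z=\{\theta\in S^{n-1}:\lim_{\theta'\to\theta}v_0(\theta')/p_0(\theta')=0\}$; let $Z_+$ (respectively $Z_-$) be the set of $\theta\in Z$ near which $p_0\ge0$ (respectively $p_0\le 0$), $p_0$ not being identically $0$ near $\theta$; and $Z_0=Z\setminus(Z_+\cup Z_-)$. Assume $Z\subset D$ and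 $p_0\neq0$ on $Z$. $V_0$ is *non-degenerate* if $Z_0=\emptyset$, $Z_+$ and $Z_-$ are disjoint smooth submanifolds of $S^{n-1}$, and the bilinear form $\langle n_1,n_2\rangle=n_1\big(\tfrac{v_0}{p_0},n_2\big)$ on the normal bundles of $Z_\pm$ in $S^{n-1}$ is non-degenerate; it is *hyperbolic* if moreover all (complex) eigenvalues of this form with respect to the metric have strictly negative real part. For a vector field $W$ on an open set $O\subset\mathbb R^n\setminus\{0\}$, a solution curve of $W$ in $O$ *comes out of* (*into*) the origin in the direction $\theta_0$ if along it $(r,\theta)\to(0,\theta_0)$ at its initial (terminal) end, at finite or infinite time. For a set $U$ of directions, $S^+_W(O,U)$ ($S^-_W(O,U)$) denotes the union of all solution curves of $W$ in $O$ that come out of (into) the origin in a direction $\theta_0\in U$, together with their end point, the origin. The cone over a set $A\subset S^{n-1}$ is $\{r\theta: r\ge0,\ \theta\in A\}$. Let $S_0^\pm$ be the cone over $Z_\pm$. **Theorem 4.2.** Let $V_0$ be a hyperbolic homogeneous vector field of degree $d$ as above, and let $V=V_0+V_1$ on $D\cap\{|x|<R\}$, $R>0$, where $V_1(r\theta)=r^{d+1}F(r,\theta)$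 with $F$ smooth on $[0,R)\times (S^{n-1}\cap D)$ (including $r=0$) and $|V_1|\le C\,r\,|V_0|$ for a constant $C$. Then there is a neighbourhood of $Z_+$ such that for every open set $U\supset Z_+$ of $S^{n-1}$ contained in it the following holds. 1. $S^+_{V_0}(D,U)=S_0^+$. 2. There is $\rho_0>0$ such that for all $0<\rho\le\rho_0$, with $D_\rho=D\cap\{|x|<\rho\}$, the unstable variety $S^+=S^+_V(D_\rho,U)$ lies in the cone over $U$, and there is a homeomorphism $$\Phi:\ S_0^+\cap\{|x|<\rho\}\ \longrightarrow\ S^+,\qquad |\Phi(x)|=|x|,\qquad |\Phi(x)-x|=o(|x|)\ \text{ as } x\to0;$$ in particular $S^+$ is tangent to $S_0^+$ at the origin. Moreover $\gamma\mapsto\Phi(\gamma)$ is a bijection from the maximal solution curves of $V_0$ in $D_\rho$ that come out of the origin in a direction in $U$ to those of $V$, and $\Phi(\gamma)$ has the same limit direction at the origin as $\gamma$. The same holds with $Z_-$, $S_0^-$, $S^-$ and "into" in place of $Z_+$, $S_0^+$, $S^+$ and "out of". -/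

import Mathlib

open Set Filter Topology
open scoped ContDiff RealInnerProductSpace

noncomputable section

/-- Euclidean space `ℝⁿ`; its unit sphere `S^{n-1}` is `Metric.sphere (0 : Euc n) 1`. -/
abbrev Euc (n : ℕ) : Type := EuclideanSpace ℝ (Fin n)

namespace ConeField

variable {n : ℕ}

/-! ### Homogeneous vector fields and their polar components

A vector field is a function `Euc n → Euc n` that is only looked at on an open cone
`D ⊆ ℝⁿ \ {0}` (so that it may have poles outside `D`); values outside `D` play no role. -/

/-- `D` is an open cone in `ℝⁿ \ {0}`. -/
structure IsOpenCone (D : Set (Euc n)) : Prop where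
  isOpen : IsOpen D
  zero_notMem : (0 : Euc n) ∉ D
  smul_mem : ∀ r : ℝ, 0 < r → ∀ x ∈ D, r • x ∈ D

/-- `V₀` is a smooth vector field on the open cone `D`, homogeneous of degree `d`. -/
structure IsHomogeneousField (d : ℝ) (D : Set (Euc n)) (V₀ : Euc n → Euc n) : Prop where
  isOpenCone : IsOpenCone D
  contDiffOn : ContDiffOn ℝ ∞ V₀ D
  homogeneous : ∀ r : ℝ, 0 < r → ∀ x ∈ D, V₀ (r • x) = r ^ d • V₀ x

/-- The radial component `p₀(θ)` of `V₀` at a point `θ` of the unit sphere. -/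
def radial (V₀ : Euc n → Euc n) (θ : Euc n) : ℝ := ⟪V₀ θ, θ⟫

/-- The spherical component `v₀(θ)` of `V₀` at a point `θ` of the unit sphere. -/
def spherical (V₀ : Euc n → Euc n) (θ : Euc n) : Euc n := V₀ θ - radial V₀ θ • θ

/-- The quotient `v₀(θ) / p₀(θ)`; it is meaningful where `p₀(θ) ≠ 0`. -/
def slope (V₀ : Euc n → Euc n) (θ : Euc n) : Euc n := (radial V₀ θ)⁻¹ • spherical V₀ θ

/-- The domain of `v₀ / p₀` in the unit sphere. -/
def slopeDomain (D : Set (Euc n)) (V₀ : Euc n → Euc n) : Set (Euc n) :=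
  {θ | θ ∈ Metric.sphere (0 : Euc n) 1 ∧ θ ∈ D ∧ radial V₀ θ ≠ 0}

/-- "Good" homogeneous vector fields: when `p₀` is not identically zero, the domain of `v₀ / p₀` is
dense in the unit sphere (it is automatically open), and `v₀ / p₀` extends smoothly to the set of
those `θ` at which `|v₀ / p₀|` does not tend to infinity.  (By density the local extensions
agree.) -/
def IsGood (D : Set (Euc n)) (V₀ : Euc n → Euc n) : Prop :=
  (slopeDomain D V₀).Nonempty →
    Metric.sphere (0 : Euc n) 1 ⊆ closure (slopeDomain D V₀) ∧
    ∀ θ ∈ Metric.sphere (0 : Euc n) 1,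
      ¬ Tendsto (fun η => ‖slope V₀ η‖) (𝓝[slopeDomain D V₀] θ) atTop →
      ∃ q : Euc n → Euc n, ContDiffAt ℝ ∞ q θ ∧
        ∀ᶠ η in 𝓝[slopeDomain D V₀] θ, q η = slope V₀ η

/-! ### The sets `Z`, `Z₊`, `Z₋` -/

/-- `Z`: the directions `θ` at which `v₀ / p₀` has limit `0`. -/
def zeroSet (D : Set (Euc n)) (V₀ : Euc n → Euc n) : Set (Euc n) :=
  {θ | θ ∈ Metric.sphere (0 : Euc n) 1 ∧ θ ∈ closure (slopeDomain D V₀) ∧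
    Tendsto (slope V₀) (𝓝[slopeDomain D V₀] θ) (𝓝 0)}

/-- `Z₊`: the points of `Z` near which `p₀ ≥ 0`, and `p₀` is not identically `0`. -/
def zeroSetPos (D : Set (Euc n)) (V₀ : Euc n → Euc n) : Set (Euc n) :=
  {θ | θ ∈ zeroSet D V₀ ∧
    (∀ᶠ η in 𝓝[Metric.sphere (0 : Euc n) 1 ∩ D] θ, 0 ≤ radial V₀ η) ∧
    ∃ᶠ η in 𝓝[Metric.sphere (0 : Euc n) 1 ∩ D] θ, radial V₀ η ≠ 0}

/-- `Z₋`: the points of `Z` near which `p₀ ≤ 0`, and `p₀` is not identically `0`. -/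
def zeroSetNeg (D : Set (Euc n)) (V₀ : Euc n → Euc n) : Set (Euc n) :=
  {θ | θ ∈ zeroSet D V₀ ∧
    (∀ᶠ η in 𝓝[Metric.sphere (0 : Euc n) 1 ∩ D] θ, radial V₀ η ≤ 0) ∧
    ∃ᶠ η in 𝓝[Metric.sphere (0 : Euc n) 1 ∩ D] θ, radial V₀ η ≠ 0}

/-! ### Non-degeneracy and hyperbolicity -/

/-- `Z` is a smooth embedded submanifold of `ℝⁿ` (components may have different dimensions): near
each of its points some smooth chart of `ℝⁿ` maps `Z` to a linear subspace.  For subsets of the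
unit sphere this is the same as being a smooth embedded submanifold of the sphere. -/
def IsSmoothSubmanifold (Z : Set (Euc n)) : Prop :=
  ∀ z ∈ Z, ∃ (φ : OpenPartialHomeomorph (Euc n) (Euc n)) (K : Submodule ℝ (Euc n)),
    z ∈ φ.source ∧ ContDiffOn ℝ ∞ φ φ.source ∧ ContDiffOn ℝ ∞ φ.symm φ.target ∧
    ∀ x ∈ φ.source, x ∈ Z ↔ φ x ∈ K

/-- The fibre at `θ` of the normal bundle, in the unit sphere, of the submanifold `Z` of the sphere:
the vectors that are tangent to the sphere at `θ` and orthogonal to the tangent space of `Z`. -/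
def normalSpace (Z : Set (Euc n)) (θ : Euc n) : Submodule ℝ (Euc n) :=
  (Submodule.span ℝ (tangentConeAt ℝ Z θ))ᗮ ⊓ (Submodule.span ℝ {θ})ᗮ

/-- The bilinear form `⟨n₁, n₂⟩ = n₁ (v₀ / p₀, n₂)` on vectors tangent to the sphere at a point `θ`
where `v₀ / p₀` vanishes. -/
def slopeForm (V₀ : Euc n → Euc n) (θ n₁ n₂ : Euc n) : ℝ := ⟪fderiv ℝ (slope V₀) θ n₁, n₂⟫

/-- The endomorphism `A` of the normal space with `⟨n₁, n₂⟩ = (A n₁, n₂)`, which represents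
`slopeForm` with respect to the metric. -/
def slopeOperator (V₀ : Euc n → Euc n) (Z : Set (Euc n)) (θ : Euc n) :
    normalSpace Z θ →ₗ[ℝ] normalSpace Z θ :=
  ((normalSpace Z θ).orthogonalProjectionOnto ∘L fderiv ℝ (slope V₀) θ ∘L
    (normalSpace Z θ).subtypeL).toLinearMap

theorem inner_slopeOperator (V₀ : Euc n → Euc n) (Z : Set (Euc n)) (θ : Euc n)
    (n₁ n₂ : normalSpace Z θ) :
    ⟪(slopeOperator V₀ Z θ n₁ : Euc n), (n₂ : Euc n)⟫ = slopeForm V₀ θ n₁ n₂ := by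
  simp only [slopeOperator, slopeForm, ContinuousLinearMap.coe_coe,
    ContinuousLinearMap.comp_apply, Submodule.subtypeL_apply]
  rw [← Submodule.coe_inner, Submodule.inner_orthogonalProjectionOnto_eq_of_mem_right]

/-- Non-degenerate homogeneous vector fields: `Z₀ = Z \ (Z₊ ∪ Z₋)` is empty, `Z₊` and `Z₋` are
disjoint smooth submanifolds, and the bilinear form is non-degenerate on their normal bundles. -/
structure IsNondegenerate (D : Set (Euc n)) (V₀ : Euc n → Euc n) : Prop where
  zero_eq_empty : zeroSet D V₀ \ (zeroSetPos D V₀ ∪ zeroSetNeg D V₀) = ∅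
  disjoint : Disjoint (zeroSetPos D V₀) (zeroSetNeg D V₀)
  submanifold_pos : IsSmoothSubmanifold (zeroSetPos D V₀)
  submanifold_neg : IsSmoothSubmanifold (zeroSetNeg D V₀)
  nondegenerate : ∀ Z, (Z = zeroSetPos D V₀ ∨ Z = zeroSetNeg D V₀) → ∀ θ ∈ Z,
    (∀ n₁ ∈ normalSpace Z θ, (∀ n₂ ∈ normalSpace Z θ, slopeForm V₀ θ n₁ n₂ = 0) → n₁ = 0) ∧
    (∀ n₂ ∈ normalSpace Z θ, (∀ n₁ ∈ normalSpace Z θ, slopeForm V₀ θ n₁ n₂ = 0) → n₂ = 0)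

/-- Hyperbolic homogeneous vector fields: non-degenerate, and all the (complex) eigenvalues of the
bilinear form with respect to the metric have strictly negative real part. -/
structure IsHyperbolic (D : Set (Euc n)) (V₀ : Euc n → Euc n) : Prop extends
    IsNondegenerate D V₀ where
  re_neg : ∀ Z, (Z = zeroSetPos D V₀ ∨ Z = zeroSetNeg D V₀) → ∀ θ ∈ Z, ∀ μ : ℂ,
    Module.End.HasEigenvalue ((slopeOperator V₀ Z θ).baseChange ℂ) μ → μ.re < 0

/-- `V₁` is a smooth term of order higher than `d` on `D ∩ {|x| < R}`, that is,
`V₁ = r ^ d v₁(r, θ) ∂_θ + r ^ (d + 1) p₁(r, θ) ∂_r` with `v₁, p₁` smooth up to `r = 0`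
(here `F = v₁ ∂_θ + p₁ ∂_r` at the point `θ` of the sphere; `∂_θ` has length `r` at distance `r`
from the origin). -/
def IsHigherOrder (d R : ℝ) (D : Set (Euc n)) (V₁ : Euc n → Euc n) : Prop :=
  ∃ F : ℝ × Euc n → Euc n, ContDiffOn ℝ ∞ F (Ico 0 R ×ˢ D) ∧
    ∀ θ ∈ D, ‖θ‖ = 1 → ∀ r : ℝ, 0 < r → r < R → V₁ (r • θ) = r ^ (d + 1) • F (r, θ)

/-! ### Solution curves and unstable / stable varieties -/

/-- `x` is a solution of `x' = W(x)` on the nonempty, possibly unbounded interval `(a, b)`, and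
stays in `O`. -/
def IsSolution (W : Euc n → Euc n) (O : Set (Euc n)) (x : ℝ → Euc n) (a b : EReal) : Prop :=
  a < b ∧ ∀ t : ℝ, a < t → t < b → x t ∈ O ∧ HasDerivAt x (W (x t)) t

/-- Along the filter `l`, the curve `x` tends to the origin with limit direction `θ₀`, that is, in
polar coordinates it tends to `(0, θ₀)`. -/
def TendsToOrigin (x : ℝ → Euc n) (l : Filter ℝ) (θ₀ : Euc n) : Prop :=
  Tendsto (fun t => ‖x t‖) l (𝓝 0) ∧ Tendsto (fun t => ‖x t‖⁻¹ • x t) l (𝓝 θ₀)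

/-- `γ` is (the set of points of) a solution curve of `W` in `O` that comes out of the origin in the
direction `θ₀`: it tends to `(0, θ₀)` at its initial end. -/
def IsOutgoing (W : Euc n → Euc n) (O : Set (Euc n)) (θ₀ : Euc n) (γ : Set (Euc n)) : Prop :=
  ∃ (x : ℝ → Euc n) (a b : EReal), IsSolution W O x a b ∧
    TendsToOrigin x (comap Real.toEReal (𝓝[>] a)) θ₀ ∧ γ = x '' {t : ℝ | a < t ∧ t < b}

/-- `γ` is (the set of points of) a solution curve of `W` in `O` that comes into the origin from the
direction `θ₀`: it tends to `(0, θ₀)` at its terminal end. -/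
def IsIncoming (W : Euc n → Euc n) (O : Set (Euc n)) (θ₀ : Euc n) (γ : Set (Euc n)) : Prop :=
  ∃ (x : ℝ → Euc n) (a b : EReal), IsSolution W O x a b ∧
    TendsToOrigin x (comap Real.toEReal (𝓝[<] b)) θ₀ ∧ γ = x '' {t : ℝ | a < t ∧ t < b}

/-- The union of the curves of a given kind (`IsOutgoing` or `IsIncoming`) of `W` in `O` with limit
direction in `U`, together with their end point, the origin.  For `IsOutgoing` (`IsIncoming`) it is
the unstable (stable) variety, in the directions `U`, of the restriction of `W` to `O`. -/
def variety (kind : (Euc n → Euc n) → Set (Euc n) → Euc n → Set (Euc n) → Prop)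
    (W : Euc n → Euc n) (O U : Set (Euc n)) : Set (Euc n) :=
  {x | ∃ θ₀ ∈ U, ∃ γ, kind W O θ₀ γ ∧ (x = 0 ∨ x ∈ γ)}

/-- The cone over the unit vectors in `A`. -/
def coneOver (A : Set (Euc n)) : Set (Euc n) :=
  {x | ∃ θ ∈ A, ‖θ‖ = 1 ∧ ∃ r : ℝ, 0 ≤ r ∧ x = r • θ}

/-- The part of the open cone `D` at distance less than `ρ` from the origin. -/
def truncated (D : Set (Euc n)) (ρ : ℝ) : Set (Euc n) := D ∩ Metric.ball 0 ρ

/-- The conclusion for one of the two kinds of curves and the corresponding set `Z` of directions,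
where `S₀ = coneOver Z`.  For all sufficiently small open neighbourhoods `U` of `Z`, with cone
neighbourhood `coneOver U` of `S₀`, and all sufficiently small `ρ`:

* the unstable (stable) cone of `V₀` in the directions `U` is `S₀`;
* the unstable (stable) variety `S` of `V` near the origin, in the directions `U`, lies in
  `coneOver U`;
* there is a homeomorphism `Φ` from `S₀` to `S` (both near the origin), which preserves the distance
  to the origin, and which makes `S` tangent to `S₀` at the origin;
* `Φ` maps the (maximal) solution curves of `V₀` bijectively to those of `V`, and corresponding
  curves have the same limit direction. -/
def ConeStable (kind : (Euc n → Euc n) → Set (Euc n) → Euc n → Set (Euc n) → Prop)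
    (D : Set (Euc n)) (V₀ V : Euc n → Euc n) (Z : Set (Euc n)) : Prop :=
  ∃ U₀ : Set (Euc n), IsOpen U₀ ∧ Z ⊆ U₀ ∧
  ∀ U : Set (Euc n), IsOpen U → Z ⊆ U → U ⊆ U₀ →
    variety kind V₀ D U = coneOver Z ∧
    ∃ ρ₀ : ℝ, 0 < ρ₀ ∧ ∀ ρ : ℝ, 0 < ρ → ρ ≤ ρ₀ →
      variety kind V (truncated D ρ) U ⊆ coneOver U ∧
      ∃ Φ : ↥(coneOver Z ∩ Metric.ball 0 ρ) ≃ₜ ↥(variety kind V (truncated D ρ) U),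
        (∀ y, ‖(Φ y : Euc n)‖ = ‖(y : Euc n)‖) ∧
        (fun y => (Φ y : Euc n) - (y : Euc n))
          =o[comap Subtype.val (𝓝 0)] (fun y => (y : Euc n)) ∧
        BijOn (fun γ : Set (Euc n) => Subtype.val '' (Φ '' (Subtype.val ⁻¹' γ)))
          {γ | ∃ θ₀ ∈ U, Maximal (kind V₀ (truncated D ρ) θ₀) γ}
          {γ | ∃ θ₀ ∈ U, Maximal (kind V (truncated D ρ) θ₀) γ} ∧
        ∀ θ₀ ∈ U, ∀ γ : Set (Euc n), Maximal (kind V₀ (truncated D ρ) θ₀) γ →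
          Maximal (kind V (truncated D ρ) θ₀) (Subtype.val '' (Φ '' (Subtype.val ⁻¹' γ)))

end ConeField

end

/-! Write r = |x|, u = x/|x| and take s = log r as the time. Where the radial component is positive,
x' = V(x) becomes du/ds = q(u) + O(e^s), where q = v₀/p₀ is the slope; the factor r^d drops out. A
solution that comes out of the origin starts at s = -∞, and its limit direction must be a zero of q
(`IsPolarArc.slope_eq_zero`), hence a point of Z₊. It remains to see that each z in Z₊ emits exactly
one maximal solution curve, and that this curve depends continuously on z.

Instead of working on the sphere, q(x) = V₀(x)/⟨V₀(x), x⟩ - x is used on an open subset of ℝⁿ. At a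
point of Z₊ its derivative B kills the tangent space T of Z₊, is -2 in the radial direction, and
compresses to an operator with eigenvalues of negative real part on the normal space. Lyapunov's
construction (`exists_lyapunov`) turns this into two quadratic forms: one that lives on the
complement of T and decreases under B (`IsTransverseForm`), and a definite one that grows at most
slowly (`IsAdaptedForm`).

Existence: put u = z + e^s v. Then v' = (B - 1) v + m(s, v) with m bounded and of small Lipschitz
constant in v. Although B has a kernel, B - 1 is exponentially stable, so Duhamel's formula and the
contraction principle give a bounded solution on the line (`exists_bounded_solution`,
`IsPolarBall.exists_family`). One B serves for all z near a given point, which makes the solution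
continuous in z.

Uniqueness: of an arbitrary outgoing solution only u → θ is known. The decreasing form, applied to
q(u) from s = -∞ on, forces q(u) = O(r) (`IsPolarArc.exists_slope_le`). Integration gives u - θ =
O(r). For two such solutions the definite form of the difference, divided by r, is nonincreasing and
tends to 0 at the initial end, so it vanishes (`IsPolarArc.eventually_eq`). Uniqueness for ordinary
differential equations carries the equality along the whole curve (`eq_of_isLogCurve`).

Goodness makes Z₊ compact, so the local families glue to one family X z s with a common range of s
(`exists_global_family`). The map e^s z ↦ X z s preserves norms, moves x by O(|x|²), and is
continuous and injective on compact pieces of the cone, hence a homeomorphism onto its image. The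
field V₀ is the case V₁ = 0, in which the curves are rays. Replacing V by -V fixes q and exchanges
Z₊ with Z₋, which gives the incoming case. -/

noncomputable section

namespace ConeField

/-! ### Lyapunov forms of stable operators -/

section Lyapunov

-- By Gelfand's formula ‖a ^ k‖ is eventually at most ρ ^ k for any ρ between the spectral radius
-- and 1.
open scoped NNReal ENNReal in
theorem summable_norm_pow_sq {A : Type*} [NormedRing A] [NormedAlgebra ℂ A] [CompleteSpace A]
    (a : A) (ha : ∀ z ∈ spectrum ℂ a, ‖z‖ < 1) : Summable fun k : ℕ => ‖a ^ k‖ ^ 2 := by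
  have hlt : spectralRadius ℂ a < ((1 : ℝ≥0) : ℝ≥0∞) := by
    rcases (spectrum ℂ a).eq_empty_or_nonempty with h | h
    · simp [spectralRadius, h]
    · exact spectrum.spectralRadius_lt_of_forall_lt_of_nonempty h fun z hz => by
        exact_mod_cast ha z hz
  obtain ⟨ρ, hρ, hρ1⟩ := ENNReal.lt_iff_exists_nnreal_btwn.1 hlt
  have hρ1 : (ρ : ℝ) < 1 := by exact_mod_cast hρ1
  have hev := (spectrum.pow_nnnorm_pow_one_div_tendsto_nhds_spectralRadius a).eventually_lt_const hρ
  have hsq : (ρ : ℝ) ^ 2 < 1 := by nlinarith [ρ.coe_nonneg]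
  refine Summable.of_norm_bounded_eventually_nat
    (summable_geometric_of_lt_one (sq_nonneg (ρ : ℝ)) hsq) ?_
  filter_upwards [hev, eventually_gt_atTop 0] with k hk hk0
  have hk' : (‖a ^ k‖₊ : ℝ≥0∞) ≤ (ρ : ℝ≥0∞) ^ k := by
    have h1 := ENNReal.rpow_le_rpow hk.le (Nat.cast_nonneg k : (0 : ℝ) ≤ k)
    rwa [← ENNReal.rpow_mul, one_div, inv_mul_cancel₀ (by positivity), ENNReal.rpow_one,
      ENNReal.rpow_natCast] at h1
  have hk'' : ‖a ^ k‖ ≤ (ρ : ℝ) ^ k := by exact_mod_cast hk'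
  rw [Real.norm_of_nonneg (by positivity), ← pow_mul, mul_comm, pow_mul]
  gcongr

variable {N : Type*} [NormedAddCommGroup N] [InnerProductSpace ℝ N] [FiniteDimensional ℝ N]

/-- An Euler step 1 + hA sends an eigenvalue μ to 1 + hμ, which lies in the open unit disc for small
h. Gelfand's formula needs a complex algebra, so operators are sent to complex matrices; this
injective linear map from a finite-dimensional space is antilipschitz, and norm bounds can be pulled
back. -/
theorem exists_step_summable (A : N →L[ℝ] N)
    (hA : ∀ μ : ℂ, Module.End.HasEigenvalue ((A : N →ₗ[ℝ] N).baseChange ℂ) μ → μ.re < 0) :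
    ∃ h : ℝ, 0 < h ∧ Summable fun k : ℕ => ‖(1 + h • A) ^ k‖ ^ 2 := by
  classical
  let := Matrix.linftyOpNormedRing (n := Fin (Module.finrank ℝ N)) (α := ℂ)
  let := Matrix.linftyOpNormedAlgebra (n := Fin (Module.finrank ℝ N)) (R := ℂ) (α := ℂ)
  let b := Module.finBasis ℝ N
  let Ψ : (N →L[ℝ] N) → Matrix (Fin (Module.finrank ℝ N)) (Fin (Module.finrank ℝ N)) ℂ := fun T =>
    (LinearMap.toMatrix b b (T : N →ₗ[ℝ] N)).map (algebraMap ℝ ℂ)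
  have hΨadd : ∀ S T, Ψ (S + T) = Ψ S + Ψ T := fun S T => by
    ext i j; simp [Ψ]
  have hΨsmul : ∀ (c : ℝ) T, Ψ (c • T) = c • Ψ T := fun c T => by
    ext i j; simp [Ψ]
  have hΨone : Ψ 1 = 1 := by
    simp [Ψ]
  have hΨmul : ∀ S T, Ψ (S * T) = Ψ S * Ψ T := fun S T => by
    have : ((S * T : N →L[ℝ] N) : N →ₗ[ℝ] N) = (S : N →ₗ[ℝ] N) * (T : N →ₗ[ℝ] N) := rfl
    simp only [Ψ, this, LinearMap.toMatrix_mul, Matrix.map_mul]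
  have hΨpow : ∀ T (k : ℕ), Ψ (T ^ k) = Ψ T ^ k := fun T k => by
    induction k with
    | zero => simpa using hΨone
    | succ k ih => rw [pow_succ, hΨmul, ih, pow_succ]
  let Ψl : (N →L[ℝ] N) →ₗ[ℝ] Matrix (Fin (Module.finrank ℝ N)) (Fin (Module.finrank ℝ N)) ℂ :=
    { toFun := Ψ, map_add' := hΨadd, map_smul' := hΨsmul }
  have hker : LinearMap.ker Ψl = ⊥ := by
    rw [LinearMap.ker_eq_bot]
    intro S T hST
    have h1 : (LinearMap.toMatrix b b (S : N →ₗ[ℝ] N)) = LinearMap.toMatrix b b (T : N →ₗ[ℝ] N) :=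
      Matrix.map_injective (algebraMap ℝ ℂ).injective hST
    have h2 := (LinearMap.toMatrix b b).injective h1
    ext x
    exact LinearMap.congr_fun h2 x
  obtain ⟨K, hK0, hK⟩ := Ψl.exists_antilipschitzWith hker
  have hspec : ∀ μ ∈ spectrum ℂ (Ψ A), μ.re < 0 := by
    intro μ hμ
    apply hA
    rw [Module.End.hasEigenvalue_iff_isRoot_charpoly, LinearMap.charpoly_baseChange,
      ← LinearMap.charpoly_toMatrix (A : N →ₗ[ℝ] N) b, ← Matrix.charpoly_map]
    exact Matrix.mem_spectrum_iff_isRoot_charpoly.1 hμ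
  have hfin : (spectrum ℂ (Ψ A)).Finite := Matrix.finite_spectrum _
  -- Here |1 + hμ|² = 1 + h (2 Re μ + h |μ|²), and finitely many μ have to be served at once.
  have hev : ∀ᶠ h : ℝ in 𝓝[>] 0, ∀ μ ∈ spectrum ℂ (Ψ A), ‖1 + (h : ℂ) * μ‖ < 1 := by
    rw [hfin.eventually_all]
    intro μ hμ
    have hre := hspec μ hμ
    have h1 : ∀ᶠ h : ℝ in 𝓝[>] 0, 2 * μ.re + h * ‖μ‖ ^ 2 < 0 := by
      have : Tendsto (fun h : ℝ => 2 * μ.re + h * ‖μ‖ ^ 2) (𝓝[>] 0) (𝓝 (2 * μ.re + 0 * ‖μ‖ ^ 2)) :=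
        (Continuous.tendsto (by fun_prop) 0).mono_left nhdsWithin_le_nhds
      exact this.eventually_lt_const (by linarith)
    filter_upwards [h1, self_mem_nhdsWithin] with h hh (h0 : 0 < h)
    rw [← sq_lt_one_iff₀ (norm_nonneg _), Complex.sq_norm, Complex.normSq_apply]
    rw [Complex.sq_norm, Complex.normSq_apply] at hh
    simp
    nlinarith
  obtain ⟨h, hh, h0⟩ := (hev.and self_mem_nhdsWithin).exists
  refine ⟨h, h0, ?_⟩
  have hsum := summable_norm_pow_sq (Ψ (1 + h • A)) (by
    intro z hz
    rw [hΨadd, hΨone, hΨsmul] at hz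
    have : (1 : Matrix (Fin (Module.finrank ℝ N)) (Fin (Module.finrank ℝ N)) ℂ) + h • Ψ A
        = Polynomial.aeval (Ψ A) (1 + Polynomial.C (h : ℂ) * Polynomial.X) := by
      simp [Algebra.algebraMap_eq_smul_one]
    rw [this] at hz
    have hne : (spectrum ℂ (Polynomial.aeval (Ψ A) (1 + Polynomial.C (h : ℂ) * Polynomial.X))).Nonempty :=
      ⟨z, hz⟩
    -- In dimension 0 every matrix is a unit, so the spectrum has no element z.
    have hnt : Nontrivial (Matrix (Fin (Module.finrank ℝ N)) (Fin (Module.finrank ℝ N)) ℂ) := by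
      by_contra hcon
      rw [not_nontrivial_iff_subsingleton] at hcon
      exact hz (isUnit_of_subsingleton _)
    rw [spectrum.map_polynomial_aeval] at hz
    obtain ⟨μ, hμ, rfl⟩ := hz
    simpa using hh μ hμ)
  refine Summable.of_nonneg_of_le (fun _ => by positivity) (fun k => ?_)
    (hsum.mul_left ((K : ℝ) ^ 2))
  have h1 := hK.le_mul_dist ((1 + h • A) ^ k) 0
  rw [map_zero, dist_zero_right, dist_zero_right] at h1
  have h2 : Ψl ((1 + h • A) ^ k) = Ψ (1 + h • A) ^ k := hΨpow _ _
  rw [h2] at h1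
  rw [← mul_pow]
  gcongr

open ContinuousLinearMap in
/-- A Lyapunov form of an operator whose eigenvalues have negative real parts. -/
theorem exists_lyapunov (A : N →L[ℝ] N)
    (hA : ∀ μ : ℂ, Module.End.HasEigenvalue ((A : N →ₗ[ℝ] N).baseChange ℂ) μ → μ.re < 0) :
    ∃ H : N →L[ℝ] N, (∀ x y, ⟪H x, y⟫ = ⟪x, H y⟫) ∧ ∃ c > 0, (∀ x, c * ‖x‖ ^ 2 ≤ ⟪H x, x⟫) ∧
      ∀ x, ⟪H x, A x⟫ ≤ -(c * ‖x‖ ^ 2) := by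
  obtain ⟨h, h0, hs⟩ := exists_step_summable A hA
  set C : N →L[ℝ] N := 1 + h • A with hC
  -- The form is the discrete Lyapunov sum H = ∑ (C ^ k)* C ^ k for the Euler step C = 1 + hA.
  let f : ℕ → (N →L[ℝ] N) := fun k => adjoint (C ^ k) ∘L (C ^ k)
  have hf : Summable f := by
    refine Summable.of_norm_bounded hs fun k => ?_
    calc ‖f k‖ ≤ ‖adjoint (C ^ k)‖ * ‖C ^ k‖ := opNorm_comp_le _ _
      _ = ‖C ^ k‖ ^ 2 := by rw [LinearIsometryEquiv.norm_map, sq]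
  have happ : ∀ x y, HasSum (fun k => ⟪(C ^ k) x, (C ^ k) y⟫) ⟪(∑' k, f k) x, y⟫ := by
    intro x y
    have h1 : HasSum (fun k => f k x) ((∑' k, f k) x) :=
      hf.hasSum.map (ContinuousLinearMap.apply ℝ N x) (ContinuousLinearMap.apply ℝ N x).continuous
    have h2 := h1.map (innerSL ℝ y) (innerSL ℝ y).continuous
    have h3 : ∀ k, innerSL ℝ y (f k x) = ⟪(C ^ k) x, (C ^ k) y⟫ := fun k => by
      rw [innerSL_apply_apply, coe_comp, Function.comp_apply, adjoint_inner_right,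
        real_inner_comm]
    rw [real_inner_comm, ← innerSL_apply_apply]
    convert h2 using 1
    funext k
    exact (h3 k).symm
  set H := ∑' k, f k with hH
  have hsymm : ∀ x y, ⟪H x, y⟫ = ⟪x, H y⟫ := fun x y => by
    rw [real_inner_comm (H y) x]
    refine (happ x y).unique ?_
    simpa only [real_inner_comm] using happ y x
  have hpos : ∀ x, 0 ≤ ⟪H x, x⟫ := fun x => (happ x x).nonneg fun k => real_inner_self_nonneg
  -- Stein's equation, from a shift of the summation index. Expanding C = 1 + hA in it gives 2h⟪H x,
  -- A x⟫ = -‖x‖² - h²⟪H (A x), A x⟫, whence the constant 1 / (2h) below.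
  have hstein : ∀ x, ⟪H x, x⟫ = ‖x‖ ^ 2 + ⟪H (C x), C x⟫ := fun x => by
    have h1 := (happ (C x) (C x))
    have h2 : (fun k => ⟪(C ^ k) (C x), (C ^ k) (C x)⟫) =
        fun k => ⟪(C ^ (k + 1)) x, (C ^ (k + 1)) x⟫ := by
      funext k; simp [pow_succ]
    rw [h2] at h1
    rw [hasSum_nat_add_iff (f := fun k => ⟪(C ^ k) x, (C ^ k) x⟫) 1] at h1
    have := (happ x x).unique h1
    simpa [add_comm] using this
  refine ⟨H, hsymm, min 1 (1 / (2 * h)), by positivity, fun x => ?_, fun x => ?_⟩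
  · rw [hstein]
    have : min 1 (1 / (2 * h)) * ‖x‖ ^ 2 ≤ 1 * ‖x‖ ^ 2 := by gcongr; exact min_le_left _ _
    linarith [hpos (C x)]
  · have h1 := hstein x
    have hCx : C x = x + h • A x := by simp [hC]
    rw [hCx, map_add, map_smul, inner_add_left, inner_add_right, inner_add_right,
      inner_smul_left, inner_smul_left, inner_smul_right, inner_smul_right, hsymm (A x) x,
      real_inner_comm (H x) (A x)] at h1
    simp only [conj_trivial] at h1
    have h2 : min 1 (1 / (2 * h)) * ‖x‖ ^ 2 ≤ 1 / (2 * h) * ‖x‖ ^ 2 := by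
      gcongr; exact min_le_right _ _
    have h3 : ⟪H x, A x⟫ ≤ -(1 / (2 * h) * ‖x‖ ^ 2) := by
      have h4 : 0 ≤ h * (h * ⟪H (A x), A x⟫) := by have := hpos (A x); positivity
      have h5 : 2 * h * ⟪H x, A x⟫ ≤ -‖x‖ ^ 2 := by linarith
      rw [← mul_le_mul_iff_right₀ (show 0 < 2 * h by positivity)]
      calc 2 * h * ⟪H x, A x⟫ ≤ -‖x‖ ^ 2 := h5
        _ = _ := by field_simp
    linarith

end Lyapunov

/-! ### Quadratic forms adapted to the linearization -/

section LinearForms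

variable {E : Type*} [NormedAddCommGroup E] [InnerProductSpace ℝ E]

/-- A symmetric form `H` that vanishes on `T`, is positive definite on the orthogonal complement of
`T` (onto which `P` projects), and decreases along the linear flow of `B`. -/
structure IsTransverseForm (B : E →L[ℝ] E) (T : Submodule ℝ E) (P H : E →L[ℝ] E) (c : ℝ) :
    Prop where
  pos : 0 < c
  sub_mem : ∀ x, x - P x ∈ T
  norm_le : ∀ x, ‖P x‖ ≤ ‖x‖
  inner_self : ∀ x, ⟪P x, x⟫ = ‖P x‖ ^ 2
  symm_proj : ∀ x y, ⟪P x, y⟫ = ⟪x, P y⟫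
  symm : ∀ x y, ⟪H x, y⟫ = ⟪x, H y⟫
  apply_proj : ∀ x, H (P x) = H x
  map_proj : ∀ x, B (P x) = B x
  le : ∀ x, c * ‖P x‖ ^ 2 ≤ ⟪H x, x⟫
  decr : ∀ x, ⟪H x, B x⟫ ≤ -(c * ‖P x‖ ^ 2)

/-- The complement of T splits orthogonally as N ⊕ ℝθ. On N the compression of B has a Lyapunov form
by `exists_lyapunov`; on ℝθ the operator is -2, so the square of the θ-component decreases by
itself. Their sum is the required form. -/
theorem exists_isTransverseForm [FiniteDimensional ℝ E] (B : E →L[ℝ] E) (T : Submodule ℝ E) (θ : E) (hθ : ‖θ‖ = 1)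
    (hBT : ∀ t ∈ T, B t = 0) (hBθ : B θ = (-2 : ℝ) • θ) (hB : ∀ x, ⟪B x, θ⟫ = -2 * ⟪x, θ⟫)
    (hA : ∀ μ : ℂ, Module.End.HasEigenvalue
      ((((Tᗮ ⊓ (Submodule.span ℝ {θ})ᗮ).orthogonalProjectionOnto ∘L B ∘L
        (Tᗮ ⊓ (Submodule.span ℝ {θ})ᗮ).subtypeL).toLinearMap).baseChange ℂ) μ → μ.re < 0) :
    ∃ (P H : E →L[ℝ] E) (c : ℝ), IsTransverseForm B T P H c := by
  set N := Tᗮ ⊓ (Submodule.span ℝ {θ})ᗮ with hN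
  obtain ⟨H₀, hsymm, c, hc, hle, hdec⟩ := exists_lyapunov _ hA
  -- For t in T, B t = 0, while B multiplies the θ-component by -2; so that component is 0.
  have hθT : θ ∈ Tᗮ := by
    rw [Submodule.mem_orthogonal]
    intro t ht
    have h1 := hB t
    rw [hBT t ht, inner_zero_left] at h1
    linarith
  have hθθ : ⟪θ, θ⟫ = 1 := by rw [real_inner_self_eq_norm_sq, hθ]; norm_num
  have hQθ : N.orthogonalProjectionOnto θ = 0 := by
    rw [Submodule.orthogonalProjectionOnto_eq_zero_iff, Submodule.mem_orthogonal]
    intro u hu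
    rw [real_inner_comm]
    exact (Submodule.mem_orthogonal _ _).1 hu.2 θ (Submodule.mem_span_singleton_self θ)
  have hQT : ∀ t ∈ T, N.orthogonalProjectionOnto t = 0 := fun t ht => by
    rw [Submodule.orthogonalProjectionOnto_eq_zero_iff, Submodule.mem_orthogonal]
    intro u hu
    rw [real_inner_comm]
    exact (Submodule.mem_orthogonal _ _).1 hu.1 t ht
  set Q : E →L[ℝ] N := N.orthogonalProjectionOnto with hQ
  set P : E →L[ℝ] E := Tᗮ.starProjection with hP
  have hPT : ∀ x, x - P x ∈ T := fun x => by
    have := Tᗮ.sub_starProjection_mem_orthogonal x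
    rwa [Submodule.orthogonal_orthogonal] at this
  have hQinner : ∀ (u : N) (x : E), ⟪(u : E), x⟫ = ⟪u, Q x⟫ := fun u x => by
    rw [Submodule.coe_inner, real_inner_comm, real_inner_comm _ (u : E)]
    exact (Submodule.inner_orthogonalProjectionOnto_eq_of_mem_right u x).symm
  have hPx : ∀ x, P x = (Q x : E) + ⟪x, θ⟫ • θ := fun x => by
    refine Submodule.eq_starProjection_of_mem_of_inner_eq_zero
      (add_mem (Q x).2.1 (Submodule.smul_mem _ _ hθT)) fun w hw => ?_
    have hw2 : w - ⟪w, θ⟫ • θ ∈ N := by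
      refine ⟨sub_mem hw (Submodule.smul_mem _ _ hθT), ?_⟩
      rw [SetLike.mem_coe, Submodule.mem_orthogonal_singleton_iff_inner_right, inner_sub_right, inner_smul_right,
        hθθ, real_inner_comm]
      ring
    have h1 : ⟪x - Q x, w - ⟪w, θ⟫ • θ⟫ = 0 := by
      have := N.starProjection_inner_eq_zero x _ hw2
      exact this
    have h2 : ⟪(Q x : E), θ⟫ = 0 := by rw [hQinner, hQθ, inner_zero_right]
    rw [inner_sub_right, inner_smul_right, inner_sub_left, inner_sub_left, h2] at h1
    rw [inner_sub_left, inner_add_left, inner_smul_left, real_inner_comm w θ]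
    simp only [conj_trivial]
    linarith
  have hQP : ∀ x, Q (P x) = Q x := fun x => by
    have := hQT _ (hPT x)
    rw [map_sub, sub_eq_zero] at this
    exact this.symm
  have hPθ : ∀ x, ⟪P x, θ⟫ = ⟪x, θ⟫ := fun x => by
    have := (Submodule.mem_orthogonal _ _).1 hθT _ (hPT x)
    rw [inner_sub_left] at this
    linarith
  have hPnorm : ∀ x, ‖P x‖ ^ 2 = ‖Q x‖ ^ 2 + ⟪x, θ⟫ ^ 2 := fun x => by
    have h2 : ⟪(Q x : E), θ⟫ = 0 := by rw [hQinner, hQθ, inner_zero_right]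
    rw [hPx, norm_add_sq_real, inner_smul_right, h2, norm_smul, hθ, Submodule.coe_norm]
    simp
  let H : E →L[ℝ] E := N.subtypeL ∘L H₀ ∘L Q + (innerSL ℝ θ).smulRight θ
  have hHx : ∀ x y, ⟪H x, y⟫ = ⟪H₀ (Q x), Q y⟫ + ⟪x, θ⟫ * ⟪y, θ⟫ := fun x y => by
    simp only [H, _root_.add_apply, ContinuousLinearMap.comp_apply,
      Submodule.subtypeL_apply, ContinuousLinearMap.smulRight_apply, innerSL_apply_apply]
    rw [inner_add_left, inner_smul_left, hQinner, real_inner_comm θ x, real_inner_comm θ y]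
    simp
  have hBP : ∀ x, B (P x) = B x := fun x => by
    have := hBT _ (hPT x)
    rw [map_sub, sub_eq_zero] at this
    exact this.symm
  -- Neither the T-part of x, killed by B, nor its θ-part, killed by Q after B, contributes: the
  -- N-component of B x depends on that of x alone.
  have hQB : ∀ x, Q (B x) = (Q ∘L B ∘L N.subtypeL) (Q x) := fun x => by
    rw [← hBP, hPx]
    simp [hBθ, hQθ]
  refine ⟨P, H, min c 1, by positivity, hPT, fun x => ?_, fun x => ?_, fun x y => ?_,
    fun x y => ?_, fun x => ?_, hBP, fun x => ?_, fun x => ?_⟩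
  · exact Tᗮ.norm_starProjection_apply_le x
  · have h1 : ⟪P x, x - P x⟫ = 0 := by
      rw [real_inner_comm]
      exact Tᗮ.starProjection_inner_eq_zero x _ (Tᗮ.starProjection_apply_mem x)
    rw [inner_sub_right, real_inner_self_eq_norm_sq] at h1
    linarith
  · exact Submodule.inner_starProjection_left_eq_right _ x y
  · rw [real_inner_comm (H y) x, hHx, hHx, hsymm (Q x) (Q y), real_inner_comm (H₀ (Q y)) (Q x)]
    ring
  · refine ext_inner_right ℝ fun y => ?_
    rw [hHx, hHx, hQP, hPθ]
  · rw [hHx, hPnorm, mul_add]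
    have h1 : min c 1 * ‖Q x‖ ^ 2 ≤ c * ‖Q x‖ ^ 2 := by gcongr; exact min_le_left _ _
    have h2 : min c 1 * ⟪x, θ⟫ ^ 2 ≤ 1 * ⟪x, θ⟫ ^ 2 := by gcongr; exact min_le_right _ _
    nlinarith [hle (Q x)]
  · rw [hHx, hPnorm, mul_add, hB, hQB]
    have h1 : min c 1 * ‖Q x‖ ^ 2 ≤ c * ‖Q x‖ ^ 2 := by gcongr; exact min_le_left _ _
    have h2 : min c 1 * ⟪x, θ⟫ ^ 2 ≤ 1 * ⟪x, θ⟫ ^ 2 := by gcongr; exact min_le_right _ _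
    nlinarith [hdec (Q x)]

/-- A symmetric positive definite form that grows slowly along the linear flow of `B`. -/
structure IsAdaptedForm (B H : E →L[ℝ] E) (c : ℝ) : Prop where
  pos : 0 < c
  symm : ∀ x y, ⟪H x, y⟫ = ⟪x, H y⟫
  le : ∀ x, c * ‖x‖ ^ 2 ≤ ⟪H x, x⟫
  growth : ∀ x, ⟪H x, B x⟫ ≤ 1 / 4 * ⟪H x, x⟫

/-- A small multiple ε of the squared T-component is added to make the form definite. B may feed the
normal component into T, but the cross term is at most (ε/4) of the squared T-component plus ε‖B‖²‖P
x‖², and the decrease of H absorbs the latter. -/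
theorem IsTransverseForm.exists_isAdaptedForm {B : E →L[ℝ] E} {T : Submodule ℝ E}
    {P H : E →L[ℝ] E} {c : ℝ} (h : IsTransverseForm B T P H c) :
    ∃ (H₁ : E →L[ℝ] E) (c₁ : ℝ), IsAdaptedForm B H₁ c₁ := by
  have hc := h.pos
  -- Chosen so that ε‖B‖² ≤ c and ε ≤ c.
  set ε := c / (‖B‖ ^ 2 + 1) with hε
  have hε0 : 0 < ε := by positivity
  have hεc : ε * (‖B‖ ^ 2 + 1) = c := by rw [hε]; field_simp
  have hεle : ε ≤ c := by nlinarith [sq_nonneg ‖B‖]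
  have hort : ∀ x, ⟪P x, x - P x⟫ = 0 := fun x => by
    rw [inner_sub_right, h.inner_self, real_inner_self_eq_norm_sq, sub_self]
  have hpyth : ∀ x, ‖x‖ ^ 2 = ‖P x‖ ^ 2 + ‖x - P x‖ ^ 2 := fun x => by
    have := norm_add_sq_real (P x) (x - P x)
    rw [hort] at this
    simpa using this
  have hself : ∀ x, ⟪x - P x, x⟫ = ‖x - P x‖ ^ 2 := fun x => by
    rw [inner_sub_left, h.inner_self, real_inner_self_eq_norm_sq, hpyth x]; ring
  refine ⟨H + ε • (1 - P), ε, hε0, fun x y => ?_, fun x => ?_, fun x => ?_⟩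
  · simp only [_root_.add_apply, _root_.smul_apply,
      _root_.sub_apply, one_apply_eq_self, inner_add_left,
      inner_add_right, inner_smul_left, inner_smul_right, inner_sub_left, inner_sub_right, h.symm,
      h.symm_proj, conj_trivial]
  · simp only [_root_.add_apply, _root_.smul_apply,
      _root_.sub_apply, one_apply_eq_self, inner_add_left,
      inner_smul_left, conj_trivial]
    rw [hself, hpyth x]
    nlinarith [h.le x, sq_nonneg ‖P x‖]
  · simp only [_root_.add_apply, _root_.smul_apply,
      _root_.sub_apply, one_apply_eq_self, inner_add_left,
      inner_smul_left, conj_trivial]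
    rw [hself]
    have h1 : ⟪x - P x, B x⟫ ≤ ‖x - P x‖ * (‖B‖ * ‖P x‖) := by
      refine (real_inner_le_norm _ _).trans ?_
      gcongr
      rw [← h.map_proj]
      exact B.le_opNorm _
    have h2 := h.decr x
    have h3 := h.le x
    have h4 : ε * ⟪x - P x, B x⟫ ≤ ε * (‖x - P x‖ * (‖B‖ * ‖P x‖)) := by gcongr
    have h5 : ε * (‖x - P x‖ * (‖B‖ * ‖P x‖)) ≤
        ε * (1 / 4 * ‖x - P x‖ ^ 2 + ‖B‖ ^ 2 * ‖P x‖ ^ 2) := by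
      gcongr
      nlinarith [sq_nonneg (1 / 2 * ‖x - P x‖ - ‖B‖ * ‖P x‖)]
    have h6 : ε * (‖B‖ ^ 2 * ‖P x‖ ^ 2) ≤ c * ‖P x‖ ^ 2 := by
      rw [← mul_assoc]; gcongr; nlinarith
    nlinarith [sq_nonneg ‖P x‖]

-- Along y' = (B - 1) y the form ⟪H y, y⟫ has logarithmic derivative at most 2(1/4 - 1) = -3/2, so
-- e^t⟪H y, y⟫ decreases. Comparison with ‖y‖² gives the rate 1/2 for the norm.
open NormedSpace in
theorem IsAdaptedForm.exists_exp_bound [CompleteSpace E] {B H : E →L[ℝ] E} {c : ℝ} (h : IsAdaptedForm B H c) :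
    ∃ M > 0, ∀ t : ℝ, 0 ≤ t → ‖exp (t • (B - 1))‖ ≤ M * Real.exp (-(t / 2)) := by
  have hc := h.pos
  refine ⟨√(‖H‖ / c) + 1, by positivity, fun t ht => ?_⟩
  refine ContinuousLinearMap.opNorm_le_bound _ (by positivity) fun x => ?_
  set y : ℝ → E := fun t => exp (t • (B - 1)) x with hy
  have hder : ∀ t, HasDerivAt y ((B - 1) (y t)) t := fun t => by
    have := (hasDerivAt_exp_smul_const' (B - 1) t).clm_apply (hasDerivAt_const t x)
    simpa [y] using this
  have hder2 : ∀ t, HasDerivAt (fun t => Real.exp t * ⟪H (y t), y t⟫)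
      (Real.exp t * ⟪H (y t), y t⟫ +
        Real.exp t * (⟪H (y t), (B - 1) (y t)⟫ + ⟪H ((B - 1) (y t)), y t⟫)) t := fun t => by
    exact (Real.hasDerivAt_exp t).mul ((H.hasFDerivAt.comp_hasDerivAt t (hder t)).inner ℝ (hder t))
  have hanti : Antitone fun t => Real.exp t * ⟪H (y t), y t⟫ := by
    refine antitone_of_deriv_nonpos (fun t => (hder2 t).differentiableAt) fun t => ?_
    rw [(hder2 t).deriv, h.symm ((B - 1) (y t)), real_inner_comm (H (y t)) ((B - 1) (y t)),
      ← mul_add]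
    refine mul_nonpos_of_nonneg_of_nonpos (Real.exp_pos t).le ?_
    simp only [_root_.sub_apply, one_apply_eq_self, inner_sub_right]
    nlinarith [h.growth (y t), h.le (y t), sq_nonneg ‖y t‖]
  have h1 := hanti ht
  simp only [y, Real.exp_zero, one_mul, zero_smul, exp_zero, one_apply_eq_self] at h1
  have h2 : ⟪H x, x⟫ ≤ ‖H‖ * ‖x‖ ^ 2 := by
    refine (real_inner_le_norm _ _).trans ?_
    rw [sq, ← mul_assoc]; gcongr; exact H.le_opNorm x
  have h3 := h.le (y t)
  have h4 : ‖y t‖ ^ 2 ≤ (√(‖H‖ / c) * Real.exp (-(t / 2)) * ‖x‖) ^ 2 := by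
    rw [mul_pow, mul_pow, Real.sq_sqrt (by positivity), ← Real.exp_nat_mul]
    have h5 : Real.exp t * (c * ‖y t‖ ^ 2) ≤ ‖H‖ * ‖x‖ ^ 2 :=
      (mul_le_mul_of_nonneg_left h3 (Real.exp_pos t).le).trans (h1.trans h2)
    have h6 : ((2 : ℕ) : ℝ) * -(t / 2) = -t := by push_cast; ring
    rw [h6, Real.exp_neg, div_mul_eq_mul_div, div_mul_eq_mul_div, le_div_iff₀ hc,
      ← div_eq_mul_inv, div_mul_eq_mul_div, le_div_iff₀ (Real.exp_pos t)]
    linarith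
  have h7 := abs_le_of_sq_le_sq' h4 (by positivity)
  refine h7.2.trans ?_
  gcongr
  linarith

end LinearForms

/-! ### Bounded solutions of perturbed stable linear equations -/

section BoundedSolutions

open MeasureTheory NormedSpace

variable {E : Type*} [NormedAddCommGroup E] [NormedSpace ℝ E]

/-- The bounded solution of `v' = Λ v + u`, for a bounded function `u` on the line, when the flow of
`Λ` decays exponentially. -/
def duhamel (Λ : E →L[ℝ] E) (u : ℝ → E) (s : ℝ) : E :=
  ∫ t in Ioi (0 : ℝ), exp (t • Λ) (u (s - t))

variable {Λ : E →L[ℝ] E} {M : ℝ}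

theorem norm_exp_apply_le (hΛ : ∀ t : ℝ, 0 ≤ t → ‖exp (t • Λ)‖ ≤ M * Real.exp (-(t / 2)))
    {t C : ℝ} (ht : 0 ≤ t) {x : E} (hx : ‖x‖ ≤ C) :
    ‖exp (t • Λ) x‖ ≤ M * C * Real.exp ((-1 / 2) * t) := by
  have h0 := (norm_nonneg _).trans (hΛ t ht)
  calc ‖exp (t • Λ) x‖ ≤ ‖exp (t • Λ)‖ * ‖x‖ := ContinuousLinearMap.le_opNorm _ _
    _ ≤ (M * Real.exp (-(t / 2))) * C := mul_le_mul (hΛ t ht) hx (norm_nonneg _) h0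
    _ = M * C * Real.exp ((-1 / 2) * t) := by
      rw [show -(t / 2) = (-1 / 2) * t by ring]; ring

theorem integrable_exp_half (c : ℝ) :
    IntegrableOn (fun t : ℝ => c * Real.exp ((-1 / 2) * t)) (Ioi 0) :=
  (integrableOn_exp_mul_Ioi (by norm_num) 0).const_mul _

theorem norm_duhamel_le (hΛ : ∀ t : ℝ, 0 ≤ t → ‖exp (t • Λ)‖ ≤ M * Real.exp (-(t / 2)))
    {u : ℝ → E} {C : ℝ} (hC : ∀ t, ‖u t‖ ≤ C) (s : ℝ) :
    ‖duhamel Λ u s‖ ≤ 2 * M * C := by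
  calc ‖duhamel Λ u s‖ ≤ ∫ t in Ioi (0 : ℝ), M * C * Real.exp ((-1 / 2) * t) :=
        norm_integral_le_of_norm_le (integrable_exp_half (M * C))
          ((ae_restrict_mem measurableSet_Ioi).mono fun t ht =>
            norm_exp_apply_le hΛ (mem_Ioi.1 ht).le (hC _))
    _ = 2 * M * C := by
      rw [integral_const_mul, integral_exp_mul_Ioi (by norm_num)]
      simp; ring

variable [CompleteSpace E]

theorem continuous_exp_smul (Λ : E →L[ℝ] E) : Continuous fun t : ℝ => exp (t • Λ) :=
  continuous_iff_continuousAt.2 fun t => (hasDerivAt_exp_smul_const Λ t).continuousAt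

theorem integrableOn_duhamel (hΛ : ∀ t : ℝ, 0 ≤ t → ‖exp (t • Λ)‖ ≤ M * Real.exp (-(t / 2)))
    {u : ℝ → E} (hu : Continuous u) {C : ℝ} (hC : ∀ t, ‖u t‖ ≤ C) (s : ℝ) :
    IntegrableOn (fun t : ℝ => exp (t • Λ) (u (s - t))) (Ioi 0) := by
  refine (integrable_exp_half (M * C)).mono' ?_ ?_
  · exact ((continuous_exp_smul Λ).clm_apply
      (hu.comp (continuous_const.sub continuous_id))).aestronglyMeasurable
  · exact (ae_restrict_mem measurableSet_Ioi).mono fun t ht =>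
      norm_exp_apply_le hΛ (mem_Ioi.1 ht).le (hC _)

theorem duhamel_sub (hΛ : ∀ t : ℝ, 0 ≤ t → ‖exp (t • Λ)‖ ≤ M * Real.exp (-(t / 2)))
    {u w : ℝ → E} (hu : Continuous u) (hw : Continuous w) {C : ℝ} (huC : ∀ t, ‖u t‖ ≤ C)
    (hwC : ∀ t, ‖w t‖ ≤ C) (s : ℝ) :
    duhamel Λ u s - duhamel Λ w s = duhamel Λ (u - w) s := by
  rw [duhamel, duhamel, duhamel, ← integral_sub (integrableOn_duhamel hΛ hu huC s)
    (integrableOn_duhamel hΛ hw hwC s)]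
  simp

/-- Dominated convergence, with the exponential majorant common to all parameters. -/
theorem continuous_duhamel {X : Type*} [TopologicalSpace X] [FirstCountableTopology X]
    (hΛ : ∀ t : ℝ, 0 ≤ t → ‖exp (t • Λ)‖ ≤ M * Real.exp (-(t / 2)))
    {u : ℝ × X → E} (hu : Continuous u) {C : ℝ} (hC : ∀ p, ‖u p‖ ≤ C) :
    Continuous fun p : ℝ × X => duhamel Λ (fun s => u (s, p.2)) p.1 := by
  refine continuous_of_dominated (bound := fun t => M * C * Real.exp ((-1 / 2) * t))
    (fun p => ?_) (fun p => ?_) (integrable_exp_half (M * C)) (ae_of_all _ fun t => ?_)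
  · exact ((continuous_exp_smul Λ).clm_apply (hu.comp (by fun_prop))).aestronglyMeasurable
  · exact (ae_restrict_mem measurableSet_Ioi).mono fun t ht =>
      norm_exp_apply_le hΛ (mem_Ioi.1 ht).le (hC _)
  · exact (exp (t • Λ)).continuous.comp (hu.comp (by fun_prop))

theorem exp_add_smul (Λ : E →L[ℝ] E) (s t : ℝ) :
    exp ((s + t) • Λ) = exp (s • Λ) * exp (t • Λ) := by
  let := NormedAlgebra.restrictScalars ℚ ℝ (E →L[ℝ] E)
  rw [add_smul]
  exact exp_add_of_commute (((Commute.refl Λ).smul_left s).smul_right t)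

/-- After the substitution τ = s - t the integral is exp(sΛ) applied to the integral of exp(-τΛ)
u(τ) over (-∞, s], to which the product rule applies. This form needs no derivative of u. -/
theorem hasDerivAt_duhamel (hΛ : ∀ t : ℝ, 0 ≤ t → ‖exp (t • Λ)‖ ≤ M * Real.exp (-(t / 2)))
    {u : ℝ → E} (hu : Continuous u) {C : ℝ} (hC : ∀ t, ‖u t‖ ≤ C) (s : ℝ) :
    HasDerivAt (duhamel Λ u) (Λ (duhamel Λ u s) + u s) s := by
  set w : ℝ → E := fun τ => exp ((-τ) • Λ) (u τ) with hw
  have hwc : Continuous w := ((continuous_exp_smul Λ).comp continuous_neg).clm_apply hu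
  have hinv : ∀ s : ℝ, exp ((-s) • Λ) * exp (s • Λ) = 1 := fun s => by
    rw [← exp_add_smul]; simp
  have hinv' : ∀ s : ℝ, exp (s • Λ) * exp ((-s) • Λ) = 1 := fun s => by
    rw [← exp_add_smul]; simp
  have hwexp : ∀ s t, w (s - t) = exp ((-s) • Λ) (exp (t • Λ) (u (s - t))) := fun s t => by
    simp only [hw]
    rw [show -(s - t) = -s + t by ring, exp_add_smul]
    rfl
  have hpre : ∀ s : ℝ, (fun t : ℝ => s - t) ⁻¹' (Iio s) = Ioi 0 := fun s => by
    ext t; simp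
  have hmp := fun s : ℝ => Measure.measurePreserving_sub_left (volume : Measure ℝ) s
  have hemb : ∀ s : ℝ, MeasurableEmbedding fun t : ℝ => s - t := fun s =>
    (Homeomorph.subLeft s).measurableEmbedding
  have hint : ∀ s, IntegrableOn w (Iic s) := fun s => by
    rw [integrableOn_Iic_iff_integrableOn_Iio, ← (hmp s).integrableOn_comp_preimage (hemb s), hpre]
    have : (w ∘ fun t => s - t) = fun t => exp ((-s) • Λ) (exp (t • Λ) (u (s - t))) :=
      funext fun t => hwexp s t
    rw [this]
    exact (exp ((-s) • Λ)).integrable_comp (integrableOn_duhamel hΛ hu hC s)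
  have hform : ∀ s, duhamel Λ u s = exp (s • Λ) (∫ τ in Iic s, w τ) := fun s => by
    rw [integral_Iic_eq_integral_Iio, ← (hmp s).setIntegral_preimage_emb (hemb s), hpre]
    simp only [hwexp]
    rw [ContinuousLinearMap.integral_comp_comm _ (integrableOn_duhamel hΛ hu hC s)]
    rw [← mul_apply_eq_comp, hinv']
    rfl
  have hF : HasDerivAt (fun s => ∫ τ in Iic s, w τ) (w s) s := by
    have h1 : (fun s' => ∫ τ in Iic s', w τ) = fun s' => (∫ τ in Iic s, w τ) + ∫ τ in s..s', w τ := by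
      funext s'
      rw [← intervalIntegral.integral_Iic_sub_Iic (hint s) (hint s')]
      abel
    rw [h1]
    exact (hwc.integral_hasStrictDerivAt s s).hasDerivAt.const_add _
  have h2 := (hasDerivAt_exp_smul_const' Λ s).clm_apply hF
  rw [funext hform]
  convert h2 using 1
  have h3 : exp (s • Λ) (w s) = u s := by
    simp only [hw]
    rw [← mul_apply_eq_comp, hinv']
    rfl
  rw [h3]
  rfl

/-- A perturbation of an exponentially stable linear equation by a bounded term with small Lipschitz
constant has a bounded solution on the line, which depends continuously on parameters. -/
theorem exists_bounded_solution {X : Type*} [TopologicalSpace X] [FirstCountableTopology X]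
    (hΛ : ∀ t : ℝ, 0 ≤ t → ‖exp (t • Λ)‖ ≤ M * Real.exp (-(t / 2)))
    (m : ℝ × X → E → E) {b η K : ℝ} (hb : 0 ≤ b) (hη : 0 ≤ η)
    (hcont : ContinuousOn (fun p : (ℝ × X) × E => m p.1 p.2) {p | ‖p.2‖ ≤ b})
    (hlip : ∀ p v w, ‖v‖ ≤ b → ‖w‖ ≤ b → ‖m p v - m p w‖ ≤ η * ‖v - w‖)
    (hm : ∀ p, ‖m p 0‖ ≤ K) (hself : 2 * M * (K + η * b) ≤ b) (hcontr : 2 * M * η ≤ 1 / 2) :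
    ∃ v : ℝ × X → E, Continuous v ∧ (∀ p, ‖v p‖ ≤ b) ∧
      ∀ s x, HasDerivAt (fun s => v (s, x)) (Λ (v (s, x)) + m (s, x) (v (s, x))) s := by
  -- The parameter is part of the domain of the unknown function, so the fixed point is jointly
  -- continuous without a further argument.
  let 𝓑 := Metric.closedBall (0 : BoundedContinuousFunction (ℝ × X) E) b
  have h𝓑 : ∀ v : 𝓑, ∀ p, ‖v.1 p‖ ≤ b := fun v p =>
    (v.1.norm_coe_le_norm p).trans (mem_closedBall_zero_iff.1 v.2)
  have hmb : ∀ p x, ‖x‖ ≤ b → ‖m p x‖ ≤ K + η * b := fun p x hx => by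
    have h1 := hlip p x 0 hx (by simpa using hb)
    rw [sub_zero] at h1
    calc ‖m p x‖ = ‖m p 0 + (m p x - m p 0)‖ := by congr 1; abel
      _ ≤ ‖m p 0‖ + ‖m p x - m p 0‖ := norm_add_le _ _
      _ ≤ K + η * b := by
        refine add_le_add (hm p) (h1.trans ?_)
        gcongr
  have hu : ∀ v : 𝓑, Continuous fun p => m p (v.1 p) := fun v =>
    hcont.comp_continuous (continuous_id.prodMk v.1.continuous) (fun p => h𝓑 v p)
  have huC : ∀ v : 𝓑, ∀ p, ‖m p (v.1 p)‖ ≤ K + η * b := fun v p => hmb p _ (h𝓑 v p)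
  have hu1 : ∀ (v : 𝓑) (x : X), Continuous fun s => m (s, x) (v.1 (s, x)) := fun v x =>
    (hu v).comp (by fun_prop : Continuous fun s : ℝ => (s, x))
  have hT : ∀ (v : 𝓑) (p : ℝ × X), ‖duhamel Λ (fun s => m (s, p.2) (v.1 (s, p.2))) p.1‖ ≤ b :=
    fun v p => (norm_duhamel_le hΛ (fun s => huC v _) _).trans hself
  let T : 𝓑 → 𝓑 := fun v =>
    ⟨BoundedContinuousFunction.ofNormedAddCommGroup
      (fun p : ℝ × X => duhamel Λ (fun s => m (s, p.2) (v.1 (s, p.2))) p.1)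
      (continuous_duhamel hΛ (hu v) (huC v)) b (hT v),
      mem_closedBall_zero_iff.2 ((BoundedContinuousFunction.norm_le hb).2 (hT v))⟩
  have hTv : ∀ v p, (T v).1 p = duhamel Λ (fun s => m (s, p.2) (v.1 (s, p.2))) p.1 :=
    fun _ _ => rfl
  have hTc : ContractingWith (1 / 2) T := by
    refine ⟨by norm_num, LipschitzWith.of_dist_le_mul fun v w => ?_⟩
    rw [Subtype.dist_eq, Subtype.dist_eq, BoundedContinuousFunction.dist_le (by positivity)]
    intro p
    rw [hTv, hTv, dist_eq_norm, duhamel_sub hΛ (hu1 v p.2) (hu1 w p.2) (fun s => huC v _) (fun s => huC w _)]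
    refine (norm_duhamel_le hΛ (C := η * dist v.1 w.1) (fun s => ?_) _).trans ?_
    · refine (hlip _ _ _ (h𝓑 v _) (h𝓑 w _)).trans ?_
      rw [← dist_eq_norm]
      gcongr
      exact BoundedContinuousFunction.dist_coe_le_dist _
    · rw [← mul_assoc]
      have : ((1 / 2 : NNReal) : ℝ) = 1 / 2 := by norm_num
      rw [this]
      gcongr
  have : Nonempty 𝓑 := ⟨⟨0, by simpa [𝓑] using hb⟩⟩
  have : CompleteSpace 𝓑 := Metric.isClosed_closedBall.completeSpace_coe
  set v := ContractingWith.fixedPoint T hTc with hv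
  have hfix : T v = v := hTc.fixedPoint_isFixedPt
  have hfix' : ∀ s x, v.1 (s, x) = duhamel Λ (fun s => m (s, x) (v.1 (s, x))) s := fun s x => by
    conv_lhs => rw [← hfix]
    rfl
  refine ⟨v.1, v.1.continuous, h𝓑 v, fun s x => ?_⟩
  have h1 := hasDerivAt_duhamel hΛ (hu1 v x) (fun s => huC v _) s
  rw [← hfix' s x] at h1
  exact h1.congr_of_eventuallyEq (Eventually.of_forall fun s => hfix' s x)

end BoundedSolutions

/-! ### Distance to a submanifold of zeros -/

section Submanifold

variable {n : ℕ}

/-- Both f' and 0 are derivatives of f within Z, and two such derivatives agree on the tangent cone.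
-/
theorem apply_eq_zero_of_mem_span_tangentCone {F : Type*} [NormedAddCommGroup F] [NormedSpace ℝ F]
    {f : Euc n → F} {f' : Euc n →L[ℝ] F} {Z : Set (Euc n)} {z t : Euc n} (hz : z ∈ Z)
    (hf : HasFDerivAt f f' z) (h0 : ∀ᶠ x in 𝓝[Z] z, f x = 0)
    (ht : t ∈ Submodule.span ℝ (tangentConeAt ℝ Z z)) : f' t = 0 := by
  have h1 : HasFDerivWithinAt f (0 : Euc n →L[ℝ] F) Z z :=
    (hasFDerivWithinAt_const (0 : F) z Z).congr_of_eventuallyEq h0 (h0.self_of_nhdsWithin hz)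
  have h2 := hf.hasFDerivWithinAt.unique_on h1
  have h3 : Submodule.span ℝ (tangentConeAt ℝ Z z) ≤ LinearMap.ker (f' : Euc n →ₗ[ℝ] F) :=
    Submodule.span_le.2 fun y hy => h2 hy
  exact h3 ht

/-- A submanifold is approximated by translates of its tangent space, uniformly near a point. -/
theorem IsSmoothSubmanifold.exists_near {Z : Set (Euc n)} (hZ : IsSmoothSubmanifold Z)
    {z₀ : Euc n} (hz₀ : z₀ ∈ Z) {ε : ℝ} (hε : 0 < ε) :
    ∃ δ > 0, ∀ z ∈ Z, ‖z - z₀‖ < δ → ∀ t ∈ Submodule.span ℝ (tangentConeAt ℝ Z z₀), ‖t‖ < δ →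
      ∃ z' ∈ Z, ‖z' - z - t‖ ≤ ε * ‖t‖ := by
  obtain ⟨φ, K, hsrc, hφ, hφs, hK⟩ := hZ z₀ hz₀
  have hφ' : ContDiffAt ℝ ∞ φ z₀ := hφ.contDiffAt (φ.open_source.mem_nhds hsrc)
  have htgt : φ z₀ ∈ φ.target := φ.map_source hsrc
  have hφs' : ContDiffAt ℝ ∞ φ.symm (φ z₀) := hφs.contDiffAt (φ.open_target.mem_nhds htgt)
  have hL := (hφ'.hasStrictFDerivAt (by simp)).hasFDerivAt
  have hM := hφs'.hasStrictFDerivAt (by simp)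
  set L := fderiv ℝ φ z₀ with hLdef
  set M := fderiv ℝ φ.symm (φ z₀) with hMdef
  have hML : ∀ t, M (L t) = t := fun t => by
    have h1 : HasFDerivAt (φ.symm ∘ φ) (M ∘L L) z₀ := hM.hasFDerivAt.comp z₀ hL
    have h2 : HasFDerivAt (φ.symm ∘ φ) (ContinuousLinearMap.id ℝ (Euc n)) z₀ :=
      (hasFDerivAt_id z₀).congr_of_eventuallyEq
        (Filter.mem_of_superset (φ.open_source.mem_nhds hsrc) fun x hx => φ.left_inv hx)
    exact DFunLike.congr_fun (h1.unique h2) t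
  have hLK : ∀ t ∈ Submodule.span ℝ (tangentConeAt ℝ Z z₀), L t ∈ K := fun t ht => by
    have h1 : HasFDerivAt (fun x => Kᗮ.starProjection (φ x)) (Kᗮ.starProjection ∘L L) z₀ :=
      Kᗮ.starProjection.hasFDerivAt.comp z₀ hL
    have h2 : ∀ᶠ x in 𝓝[Z] z₀, Kᗮ.starProjection (φ x) = 0 := by
      filter_upwards [self_mem_nhdsWithin,
        nhdsWithin_le_nhds (φ.open_source.mem_nhds hsrc)] with x hx hxs
      rw [Submodule.starProjection_apply_eq_zero_iff, Submodule.orthogonal_orthogonal]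
      exact (hK x hxs).1 hx
    have h3 := apply_eq_zero_of_mem_span_tangentCone hz₀ h1 h2 ht
    rw [ContinuousLinearMap.comp_apply, Submodule.starProjection_apply_eq_zero_iff,
      Submodule.orthogonal_orthogonal] at h3
    exact h3
  have hlo := hM.isLittleO.def (show 0 < ε / (‖L‖ + 1) by positivity)
  have htgt2 : ∀ᶠ p : Euc n × Euc n in 𝓝 (φ z₀, φ z₀), p.1 ∈ φ.target :=
    continuous_fst.continuousAt (φ.open_target.mem_nhds htgt)
  have hpair : Tendsto (fun p : Euc n × Euc n => (φ p.1 + L p.2, φ p.1)) (𝓝 (z₀, 0))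
      (𝓝 (φ z₀, φ z₀)) := by
    have h1 : Tendsto (fun p : Euc n × Euc n => φ p.1) (𝓝 (z₀, 0)) (𝓝 (φ z₀)) :=
      hφ'.continuousAt.tendsto.comp (continuous_fst.tendsto (z₀, (0 : Euc n)))
    have h2 : Tendsto (fun p : Euc n × Euc n => L p.2) (𝓝 (z₀, 0)) (𝓝 0) := by
      have := (L.continuous.comp continuous_snd).tendsto (z₀, (0 : Euc n))
      simpa [Function.comp_def] using this
    have h3 := h1.add h2
    rw [add_zero] at h3
    exact h3.prodMk_nhds h1
  have hsrc2 : ∀ᶠ p : Euc n × Euc n in 𝓝 (z₀, 0), p.1 ∈ φ.source :=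
    continuous_fst.continuousAt (φ.open_source.mem_nhds hsrc)
  have hall := (hpair.eventually (hlo.and htgt2)).and hsrc2
  obtain ⟨δ, hδ, hball⟩ := Metric.eventually_nhds_iff_ball.1 hall
  refine ⟨δ, hδ, fun z hz hzδ t ht htδ => ?_⟩
  obtain ⟨⟨h1, h2⟩, h3⟩ := hball (z, t) (by
    rw [← ball_prod_same]; exact ⟨by simpa [dist_eq_norm] using hzδ, by simpa using htδ⟩)
  -- Move by L t in the flattening chart: L t lies in K, so the point stays on Z, and the strict
  -- derivative of the inverse chart shows that it is z + t up to ε‖t‖, uniformly in z.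
  refine ⟨φ.symm (φ z + L t), ?_, ?_⟩
  · rw [hK _ (φ.map_target h2), φ.right_inv h2]
    exact K.add_mem ((hK z h3).1 hz) (hLK t ht)
  · simp only [add_sub_cancel_left, hML, φ.left_inv h3] at h1
    refine h1.trans ?_
    calc ε / (‖L‖ + 1) * ‖L t‖ ≤ ε / (‖L‖ + 1) * ((‖L‖ + 1) * ‖t‖) := by
          gcongr
          exact (L.le_opNorm t).trans (by gcongr; linarith)
      _ = ε * ‖t‖ := by field_simp

/-- Near a transversally non-degenerate compact manifold `Z` of zeros of `q`, the vector `q x` is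
controlled by its component normal to `Z`. -/
theorem IsTransverseForm.norm_le_mul_norm_proj {q : Euc n → Euc n} {Z : Set (Euc n)}
    (hZ : IsSmoothSubmanifold Z) (hcomp : IsCompact Z) {z₀ : Euc n} (hz₀ : z₀ ∈ Z)
    (hq0 : ∀ z ∈ Z, q z = 0) {B P H : Euc n →L[ℝ] Euc n} {c : ℝ} (hq : HasStrictFDerivAt q B z₀)
    (h : IsTransverseForm B (Submodule.span ℝ (tangentConeAt ℝ Z z₀)) P H c) :
    ∃ C > 0, ∀ᶠ x in 𝓝 z₀, ‖q x‖ ≤ C * ‖P (q x)‖ := by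
  have hc := h.pos
  set k := ‖H‖ + 1 with hk
  have hk0 : 0 < k := by positivity
  -- The decrease of H makes B invertible from below transversally to T: c‖P w‖² ≤ -⟪H w, B w⟫, and
  -- the right side only sees P w and P (B w).
  have hPB : ∀ w, c * ‖P w‖ ≤ k * ‖P (B w)‖ := fun w => by
    rcases eq_or_ne (P w) 0 with h0 | h0
    · rw [h0]; simp; positivity
    have h1 : ⟪H w, B w⟫ = ⟪P w, H (P (B w))⟫ := by
      rw [← h.apply_proj w, h.symm, h.apply_proj]
    have h2 : -⟪P w, H (P (B w))⟫ ≤ ‖P w‖ * (‖H‖ * ‖P (B w)‖) :=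
      (neg_le_abs _).trans ((abs_real_inner_le_norm _ _).trans
        (by gcongr; exact H.le_opNorm _))
    have h3 := h.decr w
    have h4 : 0 < ‖P w‖ := norm_pos_iff.2 h0
    refine le_of_mul_le_mul_left ?_ h4
    nlinarith [norm_nonneg (P (B w))]
  obtain ⟨δ, hδ, hnear⟩ := hZ.exists_near hz₀ (show (0 : ℝ) < 1 / 2 by norm_num)
  set η := c / (4 * k) with hη
  have hη0 : 0 < η := by positivity
  obtain ⟨δ', hδ', hlip⟩ := Metric.eventually_nhds_iff_ball.1 (hq.isLittleO.def hη0)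
  refine ⟨(‖B‖ + η) * (4 * k / c), by positivity, ?_⟩
  have hmin : 0 < min δ δ' / 2 := by positivity
  filter_upwards [Metric.ball_mem_nhds z₀ hmin] with x hx
  -- With z nearest to x and w = x - z, q x is B w up to η‖w‖. It remains to bound w by P w.
  obtain ⟨z, hz, hzmin⟩ := hcomp.exists_infDist_eq_dist ⟨z₀, hz₀⟩ x
  have hmin' : ∀ z' ∈ Z, ‖x - z‖ ≤ ‖x - z'‖ := fun z' hz' => by
    rw [← dist_eq_norm, ← dist_eq_norm, ← hzmin]
    exact Metric.infDist_le_dist_of_mem hz'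
  have hx' : ‖x - z₀‖ < min δ δ' / 2 := by rwa [← dist_eq_norm]
  set w := x - z with hw
  have hwx : ‖w‖ ≤ ‖x - z₀‖ := hmin' z₀ hz₀
  have hzz : ‖z - z₀‖ < min δ δ' := by
    calc ‖z - z₀‖ = ‖(x - z₀) - w‖ := by rw [hw]; congr 1; abel
      _ ≤ ‖x - z₀‖ + ‖w‖ := norm_sub_le _ _
      _ < min δ δ' := by linarith
  have hwT : ‖w - P w‖ ≤ ‖w‖ := by
    have h1 := h.inner_self w
    have h2 : ‖w - P w‖ ^ 2 = ‖w‖ ^ 2 - ‖P w‖ ^ 2 := by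
      rw [norm_sub_sq_real, real_inner_comm, h1]; ring
    exact le_of_sq_le_sq (by nlinarith [sq_nonneg ‖P w‖]) (norm_nonneg _)
  -- If w were mainly tangential, moving z along Z by about w - P w would bring it closer to x.
  have hPw : ‖w‖ ≤ 2 * ‖P w‖ := by
    obtain ⟨z', hz', hz'2⟩ := hnear z hz (hzz.trans_le (min_le_left _ _)) (w - P w) (h.sub_mem w)
      (lt_of_le_of_lt (hwT.trans hwx) (hx'.trans_le (by linarith [min_le_left δ δ'])))
    have h1 := hmin' z' hz'
    have h2 : x - z' = P w - (z' - z - (w - P w)) := by rw [hw]; abel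
    rw [h2] at h1
    have h3 := norm_sub_le (P w) (z' - z - (w - P w))
    nlinarith
  have hqx : ‖q x - B w‖ ≤ η * ‖w‖ := by
    have := hlip (x, z) (by
      rw [← ball_prod_same]
      refine ⟨?_, ?_⟩
      · rw [Metric.mem_ball, dist_eq_norm]; linarith [min_le_right δ δ']
      · rw [Metric.mem_ball, dist_eq_norm]; linarith [min_le_right δ δ'])
    simpa only [hq0 z hz, sub_zero] using this
  have h1 : ‖q x‖ ≤ (‖B‖ + η) * ‖w‖ := by
    calc ‖q x‖ = ‖B w + (q x - B w)‖ := by congr 1; abel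
      _ ≤ ‖B w‖ + ‖q x - B w‖ := norm_add_le _ _
      _ ≤ ‖B‖ * ‖w‖ + η * ‖w‖ := add_le_add (B.le_opNorm _) hqx
      _ = _ := by ring
  have h2 : ‖P (B w)‖ ≤ ‖P (q x)‖ + η * ‖w‖ := by
    calc ‖P (B w)‖ = ‖P (q x) - P (q x - B w)‖ := by rw [← map_sub]; congr 2; abel
      _ ≤ ‖P (q x)‖ + ‖P (q x - B w)‖ := norm_sub_le _ _
      _ ≤ _ := by gcongr; exact (h.norm_le _).trans hqx
  have h3 : ‖w‖ ≤ 4 * k / c * ‖P (q x)‖ := by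
    have h4 : k * (η * ‖w‖) = c / 4 * ‖w‖ := by rw [hη]; field_simp
    have h5 := hPB w
    have h6 : k * ‖P (B w)‖ ≤ k * ‖P (q x)‖ + c / 4 * ‖w‖ := by
      rw [← h4, ← mul_add]; gcongr
    rw [div_mul_eq_mul_div, le_div_iff₀ hc]
    nlinarith
  calc ‖q x‖ ≤ (‖B‖ + η) * ‖w‖ := h1
    _ ≤ (‖B‖ + η) * (4 * k / c * ‖P (q x)‖) := by gcongr
    _ = _ := by ring

end Submanifold

/-! ### The slope near its zeros, and compactness of Z₊ -/

section Slope

variable {n : ℕ} {d : ℝ} {D : Set (Euc n)} {V₀ : Euc n → Euc n}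

theorem slope_eq {x : Euc n} (hx : radial V₀ x ≠ 0) : slope V₀ x = (radial V₀ x)⁻¹ • V₀ x - x := by
  rw [slope, spherical, smul_sub, inv_smul_smul₀ hx]

theorem inner_slope {x : Euc n} (hx : radial V₀ x ≠ 0) : ⟪slope V₀ x, x⟫ = 1 - ‖x‖ ^ 2 := by
  rw [slope_eq hx, inner_sub_left, inner_smul_left, real_inner_self_eq_norm_sq]
  simp only [conj_trivial]
  rw [← radial, inv_mul_cancel₀ hx]

theorem IsHomogeneousField.contDiffAt (h : IsHomogeneousField d D V₀) {x : Euc n} (hx : x ∈ D) :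
    ContDiffAt ℝ ∞ V₀ x :=
  h.contDiffOn.contDiffAt (h.isOpenCone.isOpen.mem_nhds hx)

theorem IsHomogeneousField.contDiffAt_radial (h : IsHomogeneousField d D V₀) {x : Euc n}
    (hx : x ∈ D) : ContDiffAt ℝ ∞ (radial V₀) x :=
  (h.contDiffAt hx).inner ℝ contDiffAt_id

theorem IsHomogeneousField.contDiffAt_slope (h : IsHomogeneousField d D V₀) {x : Euc n}
    (hx : x ∈ D) (hx0 : radial V₀ x ≠ 0) : ContDiffAt ℝ ∞ (slope V₀) x :=
  ((h.contDiffAt_radial hx).inv hx0).smul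
    ((h.contDiffAt hx).sub ((h.contDiffAt_radial hx).smul contDiffAt_id))

theorem IsHomogeneousField.eventually_radial_ne (h : IsHomogeneousField d D V₀) {x : Euc n}
    (hx : x ∈ D) (hx0 : radial V₀ x ≠ 0) : ∀ᶠ y in 𝓝 x, radial V₀ y ≠ 0 :=
  (h.contDiffAt_radial hx).continuousAt.eventually_ne hx0

/-- Since p₀ ≠ 0 on Z, the slope is continuous there and the limits that define Z₊ become values. -/
theorem mem_zeroSetPos_iff (h : IsHomogeneousField d D V₀)
    (hZ : ∀ θ ∈ zeroSet D V₀, θ ∈ D ∧ radial V₀ θ ≠ 0) {θ : Euc n} :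
    θ ∈ zeroSetPos D V₀ ↔ ‖θ‖ = 1 ∧ θ ∈ D ∧ 0 < radial V₀ θ ∧ slope V₀ θ = 0 := by
  constructor
  · rintro ⟨hθZ, hpos, -⟩
    obtain ⟨hθD, hθ0⟩ := hZ θ hθZ
    obtain ⟨hθS, -, hlim⟩ := hθZ
    have hdom : θ ∈ slopeDomain D V₀ := ⟨hθS, hθD, hθ0⟩
    refine ⟨by simpa using hθS, hθD,
      lt_of_le_of_ne (hpos.self_of_nhdsWithin ⟨hθS, hθD⟩) hθ0.symm, ?_⟩
    have : (𝓝[slopeDomain D V₀] θ).NeBot := mem_closure_iff_nhdsWithin_neBot.1 (subset_closure hdom)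
    exact tendsto_nhds_unique
      ((h.contDiffAt_slope hθD hθ0).continuousAt.tendsto.mono_left nhdsWithin_le_nhds) hlim
  · rintro ⟨hθ1, hθD, hpos, hs⟩
    have hθS : θ ∈ Metric.sphere (0 : Euc n) 1 := by simpa using hθ1
    have hdom : θ ∈ slopeDomain D V₀ := ⟨hθS, hθD, hpos.ne'⟩
    refine ⟨⟨hθS, subset_closure hdom, ?_⟩, ?_, ?_⟩
    · rw [← hs]
      exact (h.contDiffAt_slope hθD hpos.ne').continuousAt.tendsto.mono_left nhdsWithin_le_nhds
    · exact nhdsWithin_le_nhds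
        (((h.contDiffAt_radial hθD).continuousAt.eventually_const_lt hpos).mono fun _ h => h.le)
    · intro hev
      exact hev.self_of_nhdsWithin ⟨hθS, hθD⟩ hpos.ne'

/-- Only closedness is at issue, since a limit point could a priori leave D. Goodness gives a smooth
extension of the slope there; it vanishes by continuity, so the point lies in Z and therefore in D
with p₀ ≠ 0. -/
theorem isCompact_zeroSetPos (h : IsHomogeneousField d D V₀) (hgood : IsGood D V₀)
    (hZ : ∀ θ ∈ zeroSet D V₀, θ ∈ D ∧ radial V₀ θ ≠ 0) : IsCompact (zeroSetPos D V₀) := by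
  have hsub : zeroSetPos D V₀ ⊆ Metric.sphere (0 : Euc n) 1 := fun θ hθ => hθ.1.1
  have hdomsub : zeroSetPos D V₀ ⊆ slopeDomain D V₀ := fun θ hθ => by
    obtain ⟨h1, h2, h3, -⟩ := (mem_zeroSetPos_iff h hZ).1 hθ
    exact ⟨hsub hθ, h2, h3.ne'⟩
  refine (isCompact_sphere (0 : Euc n) 1).of_isClosed_subset ?_ hsub
  refine isClosed_of_closure_subset fun θ hθ => ?_
  have hθS : θ ∈ Metric.sphere (0 : Euc n) 1 :=
    closure_minimal hsub Metric.isClosed_sphere hθ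
  have hθdom : θ ∈ closure (slopeDomain D V₀) := closure_mono hdomsub hθ
  have hne : (𝓝[zeroSetPos D V₀] θ).NeBot := mem_closure_iff_nhdsWithin_neBot.1 hθ
  have hle : 𝓝[zeroSetPos D V₀] θ ≤ 𝓝[slopeDomain D V₀] θ := nhdsWithin_mono _ hdomsub
  have hzero : ∀ᶠ η in 𝓝[zeroSetPos D V₀] θ, slope V₀ η = 0 := by
    filter_upwards [self_mem_nhdsWithin] with η hη
    exact ((mem_zeroSetPos_iff h hZ).1 hη).2.2.2
  obtain ⟨-, hext⟩ := hgood (closure_nonempty_iff.1 ⟨θ, hθdom⟩)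
  -- The slope is 0 on Z₊, which accumulates at θ, so its norm cannot tend to infinity there.
  obtain ⟨q, hq, hqs⟩ := hext θ hθS fun htop => by
    obtain ⟨η, hη1, hη2⟩ := (((htop.mono_left hle).eventually_gt_atTop 0).and hzero).exists
    rw [hη2, norm_zero] at hη1
    exact lt_irrefl _ hη1
  have hq0 : q θ = 0 := by
    have h1 : Tendsto q (𝓝[zeroSetPos D V₀] θ) (𝓝 (q θ)) :=
      hq.continuousAt.tendsto.mono_left nhdsWithin_le_nhds
    have h2 : Tendsto q (𝓝[zeroSetPos D V₀] θ) (𝓝 0) := by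
      refine tendsto_const_nhds.congr' ?_
      filter_upwards [hzero, hqs.filter_mono hle] with η h1 h2
      rw [h2, h1]
    exact tendsto_nhds_unique h1 h2
  have hθZ : θ ∈ zeroSet D V₀ := by
    refine ⟨hθS, hθdom, ?_⟩
    rw [← hq0]
    exact (hq.continuousAt.tendsto.mono_left nhdsWithin_le_nhds).congr' hqs
  obtain ⟨hθD, hθ0⟩ := hZ θ hθZ
  have hs : slope V₀ θ = 0 := by
    have h1 : Tendsto (slope V₀) (𝓝[zeroSetPos D V₀] θ) (𝓝 (slope V₀ θ)) :=
      (h.contDiffAt_slope hθD hθ0).continuousAt.tendsto.mono_left nhdsWithin_le_nhds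
    exact tendsto_nhds_unique h1 (tendsto_const_nhds.congr' (hzero.mono fun _ h => h.symm))
  have hr : 0 ≤ radial V₀ θ := by
    refine ge_of_tendsto ((h.contDiffAt_radial hθD).continuousAt.tendsto.mono_left
      (nhdsWithin_le_nhds (s := zeroSetPos D V₀))) ?_
    filter_upwards [self_mem_nhdsWithin] with η hη
    exact ((mem_zeroSetPos_iff h hZ).1 hη).2.2.1.le
  exact (mem_zeroSetPos_iff h hZ).2
    ⟨by simpa using hθS, hθD, lt_of_le_of_ne hr hθ0.symm, hs⟩

/-- Differentiate ⟪slope, x⟫ = 1 - ‖x‖² at a zero of the slope. -/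
theorem inner_fderiv_slope (h : IsHomogeneousField d D V₀) {θ : Euc n} (hθ : θ ∈ D)
    (hr : radial V₀ θ ≠ 0) (hs : slope V₀ θ = 0) (x : Euc n) :
    ⟪fderiv ℝ (slope V₀) θ x, θ⟫ = -2 * ⟪x, θ⟫ := by
  have h1 := ((h.contDiffAt_slope hθ hr).differentiableAt (by simp)).hasFDerivAt.inner ℝ
    (hasFDerivAt_id θ)
  have h2 : HasFDerivAt (fun x : Euc n => 1 - ‖x‖ ^ 2) (-(2 • innerSL ℝ θ)) θ :=
    (hasStrictFDerivAt_norm_sq θ).hasFDerivAt.const_sub 1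
  have h3 : (fun x => ⟪slope V₀ x, id x⟫) =ᶠ[𝓝 θ] fun x => 1 - ‖x‖ ^ 2 := by
    filter_upwards [h.eventually_radial_ne hθ hr] with y hy
    exact inner_slope hy
  have h4 := DFunLike.congr_fun (h1.unique (h2.congr_of_eventuallyEq h3)) x
  simp [hs] at h4
  rw [h4, real_inner_comm]
  ring

/-- By homogeneity the slope at rθ is (1/r - r)θ, whatever the degree d; its derivative at r = 1 is
-2θ. -/
theorem fderiv_slope_self (h : IsHomogeneousField d D V₀) {θ : Euc n} (hθ : θ ∈ D)
    (hr : radial V₀ θ ≠ 0) (hs : slope V₀ θ = 0) :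
    fderiv ℝ (slope V₀) θ θ = (-2 : ℝ) • θ := by
  have hV : (radial V₀ θ)⁻¹ • V₀ θ = θ := by
    rw [slope_eq hr, sub_eq_zero] at hs
    exact hs
  have hray : ∀ r : ℝ, 0 < r → slope V₀ (r • θ) = (r⁻¹ - r) • θ := fun r hr0 => by
    have hrad : radial V₀ (r • θ) = r ^ d * r * radial V₀ θ := by
      rw [radial, h.homogeneous r hr0 θ hθ, inner_smul_left, inner_smul_right, radial]
      simp only [conj_trivial]; ring
    have hrd : r ^ d ≠ 0 := (Real.rpow_pos_of_pos hr0 d).ne'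
    have hne : radial V₀ (r • θ) ≠ 0 := by
      rw [hrad]; positivity
    rw [slope_eq hne, hrad, h.homogeneous r hr0 θ hθ, smul_smul, sub_smul]
    congr 1
    rw [show (r ^ d * r * radial V₀ θ)⁻¹ * r ^ d = r⁻¹ * (radial V₀ θ)⁻¹ by field_simp, mul_smul, hV]
  have h1 : HasDerivAt (fun r : ℝ => slope V₀ (r • θ)) (fderiv ℝ (slope V₀) θ θ) 1 := by
    have h2 : HasDerivAt (fun r : ℝ => r • θ) ((1 : ℝ) • θ) 1 := (hasDerivAt_id 1).smul_const θ
    have h3 : HasFDerivAt (slope V₀) (fderiv ℝ (slope V₀) θ) ((1 : ℝ) • θ) := by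
      rw [one_smul]
      exact ((h.contDiffAt_slope hθ hr).differentiableAt (by simp)).hasFDerivAt
    have h4 := h3.comp_hasDerivAt 1 h2
    rw [one_smul] at h4
    exact h4
  have h2 : HasDerivAt (fun r : ℝ => (r⁻¹ - r) • θ) ((-2 : ℝ) • θ) 1 := by
    have := ((hasDerivAt_inv (one_ne_zero (α := ℝ))).sub (hasDerivAt_id 1)).smul_const θ
    have e : (-((1 : ℝ) ^ 2)⁻¹ - 1) = -2 := by norm_num
    rw [e] at this
    exact this
  refine h1.unique (h2.congr_of_eventuallyEq ?_)
  filter_upwards [lt_mem_nhds (show (0 : ℝ) < 1 by norm_num)] with r hr0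
  exact hray r hr0

theorem exists_isTransverseForm_slope (h : IsHomogeneousField d D V₀)
    (hZ : ∀ θ ∈ zeroSet D V₀, θ ∈ D ∧ radial V₀ θ ≠ 0) (hhyp : IsHyperbolic D V₀) {θ : Euc n}
    (hθ : θ ∈ zeroSetPos D V₀) :
    ∃ (P H : Euc n →L[ℝ] Euc n) (c : ℝ), IsTransverseForm (fderiv ℝ (slope V₀) θ)
      (Submodule.span ℝ (tangentConeAt ℝ (zeroSetPos D V₀) θ)) P H c := by
  obtain ⟨h1, h2, h3, h4⟩ := (mem_zeroSetPos_iff h hZ).1 hθ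
  refine exists_isTransverseForm _ _ θ h1 (fun t ht => ?_) (fderiv_slope_self h h2 h3.ne' h4)
    (inner_fderiv_slope h h2 h3.ne' h4) (hhyp.re_neg _ (Or.inl rfl) θ hθ)
  refine apply_eq_zero_of_mem_span_tangentCone hθ
    ((h.contDiffAt_slope h2 h3.ne').differentiableAt (by simp)).hasFDerivAt ?_ ht
  filter_upwards [self_mem_nhdsWithin] with x hx
  exact ((mem_zeroSetPos_iff h hZ).1 hx).2.2.2

end Slope

/-! ### Monotone quantities at the initial end of a time interval -/

section InitialEnd

/-- The filter of times near the initial end `a` of an interval. -/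
abbrev initialEnd (a : EReal) : Filter ℝ := comap Real.toEReal (𝓝[>] a)

/-- Finite and infinite initial times are treated alike: near the initial end means on some (a, t₁).
-/
theorem eventually_initialEnd_iff {a : EReal} (ha : a < ⊤) {p : ℝ → Prop} :
    (∀ᶠ t in initialEnd a, p t) ↔ ∃ t₁ : ℝ, a < t₁ ∧ ∀ t : ℝ, a < t → t < t₁ → p t := by
  rw [initialEnd, eventually_comap, eventually_iff, mem_nhdsGT_iff_exists_Ioo_subset' ha]
  constructor
  · rintro ⟨u, hu, hsub⟩
    obtain ⟨t₁, h1, h2⟩ := EReal.lt_iff_exists_real_btwn.1 hu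
    exact ⟨t₁, h1, fun t ht1 ht2 => hsub ⟨ht1, (EReal.coe_lt_coe_iff.2 ht2).trans h2⟩ t rfl⟩
  · rintro ⟨t₁, h1, h2⟩
    refine ⟨t₁, h1, ?_⟩
    rintro _ ⟨hb1, hb2⟩ t rfl
    exact h2 t hb1 (EReal.coe_lt_coe_iff.1 hb2)

theorem initialEnd_neBot {a : EReal} (ha : a < ⊤) : (initialEnd a).NeBot := by
  refine ⟨fun hbot => ?_⟩
  have : ∀ᶠ _ in initialEnd a, False := by rw [hbot]; exact eventually_bot
  obtain ⟨t₁, h1, h2⟩ := (eventually_initialEnd_iff ha).1 this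
  obtain ⟨t, h3, h4⟩ := EReal.lt_iff_exists_real_btwn.1 h1
  exact h2 t h3 (EReal.coe_lt_coe_iff.1 h4)

theorem le_of_hasDerivAt_nonpos {a : EReal} {t₁ : ℝ} {f f' : ℝ → ℝ}
    (hf : ∀ t : ℝ, a < t → t < t₁ → HasDerivAt f (f' t) t)
    (hf' : ∀ t : ℝ, a < t → t < t₁ → f' t ≤ 0) {s t : ℝ} (has : a < s) (hst : s ≤ t) (ht : t < t₁) :
    f t ≤ f s := by
  have hin : ∀ u ∈ Icc s t, a < u ∧ u < t₁ := fun u hu =>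
    ⟨has.trans_le (EReal.coe_le_coe_iff.2 hu.1), hu.2.trans_lt ht⟩
  have : AntitoneOn f (Icc s t) := by
    refine antitoneOn_of_deriv_nonpos (convex_Icc s t)
      (fun u hu => (hf u (hin u hu).1 (hin u hu).2).continuousAt.continuousWithinAt)
      (fun u hu => ?_) (fun u hu => ?_)
    · have hu := hin u (interior_subset hu)
      exact (hf u hu.1 hu.2).differentiableAt.differentiableWithinAt
    · have hu := hin u (interior_subset hu)
      rw [(hf u hu.1 hu.2).deriv]
      exact hf' u hu.1 hu.2
  exact this (left_mem_Icc.2 hst) (right_mem_Icc.2 hst) hst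

/-- A function with nonpositive derivative is bounded by its limit at the initial end. -/
theorem le_of_tendsto_initialEnd {a : EReal} {t₁ : ℝ} {f f' : ℝ → ℝ} {c : ℝ}
    (hf : ∀ t : ℝ, a < t → t < t₁ → HasDerivAt f (f' t) t)
    (hf' : ∀ t : ℝ, a < t → t < t₁ → f' t ≤ 0) (hlim : Tendsto f (initialEnd a) (𝓝 c))
    {t : ℝ} (hat : a < t) (ht : t < t₁) : f t ≤ c := by
  have ha : a < ⊤ := hat.trans (EReal.coe_lt_top t)
  have := initialEnd_neBot ha
  refine ge_of_tendsto hlim ((eventually_initialEnd_iff ha).2 ⟨t, hat, fun s h1 h2 => ?_⟩)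
  exact le_of_hasDerivAt_nonpos hf hf' h1 h2.le ht

end InitialEnd

/-! ### Polar coordinates with log r as the time -/

section Polar

variable {n : ℕ} {d R : ℝ} {D : Set (Euc n)} {V₀ V₁ : Euc n → Euc n} {F : ℝ × Euc n → Euc n}

/-- The field `V₀ + V₁` at the point with polar coordinates `(r, x)`, divided by `r ^ d`. -/
def profile (V₀ : Euc n → Euc n) (F : ℝ × Euc n → Euc n) (r : ℝ) (x : Euc n) : Euc n :=
  V₀ x + r • F (r, x)

/-- The derivative of the direction with respect to the logarithm of the radius, along solutions. -/
def polarField (V₀ : Euc n → Euc n) (F : ℝ × Euc n → Euc n) (r : ℝ) (x : Euc n) : Euc n :=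
  ⟪profile V₀ F r x, x⟫⁻¹ • profile V₀ F r x - x

/-- The derivative of the logarithm of the radius along solutions. -/
def rate (V : Euc n → Euc n) (x : Euc n) : ℝ := ⟪V x, x⟫ / ‖x‖ ^ 2

theorem IsOpenCone.ne_zero (h : IsOpenCone D) {x : Euc n} (hx : x ∈ D) : x ≠ 0 := fun h0 =>
  h.zero_notMem (h0 ▸ hx)

theorem norm_direction {x : Euc n} (hx : x ≠ 0) : ‖‖x‖⁻¹ • x‖ = 1 := by
  rw [norm_smul, norm_inv, norm_norm, inv_mul_cancel₀ (norm_ne_zero_iff.2 hx)]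

theorem IsOpenCone.direction_mem (h : IsOpenCone D) {x : Euc n} (hx : x ∈ D) : ‖x‖⁻¹ • x ∈ D :=
  h.smul_mem _ (inv_pos.2 (norm_pos_iff.2 (h.ne_zero hx))) x hx

/-- The representation of the higher order term in polar coordinates. -/
structure IsPolarTerm (d R : ℝ) (D : Set (Euc n)) (V₁ : Euc n → Euc n)
    (F : ℝ × Euc n → Euc n) : Prop where
  contDiffOn : ContDiffOn ℝ ∞ F (Ico 0 R ×ˢ D)
  eq : ∀ θ ∈ D, ‖θ‖ = 1 → ∀ r : ℝ, 0 < r → r < R → V₁ (r • θ) = r ^ (d + 1) • F (r, θ)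

theorem field_eq (h : IsHomogeneousField d D V₀) (hF : IsPolarTerm d R D V₁ F) {x : Euc n}
    (hx : x ∈ D) (hxR : ‖x‖ < R) :
    (V₀ + V₁) x = ‖x‖ ^ d • profile V₀ F ‖x‖ (‖x‖⁻¹ • x) := by
  have hx0 := h.isOpenCone.ne_zero hx
  have hr : 0 < ‖x‖ := norm_pos_iff.2 hx0
  have hθ := h.isOpenCone.direction_mem hx
  have hx' : x = ‖x‖ • (‖x‖⁻¹ • x) := by rw [smul_inv_smul₀ hr.ne']
  have h1 := h.homogeneous _ hr _ hθ
  have h2 := hF.eq _ hθ (norm_direction hx0) _ hr hxR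
  rw [← hx'] at h1 h2
  rw [Pi.add_apply, h1, h2, profile, smul_add, smul_smul, Real.rpow_add_one hr.ne']

theorem rate_eq (h : IsHomogeneousField d D V₀) (hF : IsPolarTerm d R D V₁ F) {x : Euc n}
    (hx : x ∈ D) (hxR : ‖x‖ < R) :
    rate (V₀ + V₁) x =
      ‖x‖ ^ d / ‖x‖ * ⟪profile V₀ F ‖x‖ (‖x‖⁻¹ • x), ‖x‖⁻¹ • x⟫ := by
  have hr : 0 < ‖x‖ := norm_pos_iff.2 (h.isOpenCone.ne_zero hx)
  rw [rate, field_eq h hF hx hxR, inner_smul_left, inner_smul_right]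
  simp only [conj_trivial]
  field_simp

theorem rate_pos (h : IsHomogeneousField d D V₀) (hF : IsPolarTerm d R D V₁ F) {x : Euc n}
    (hx : x ∈ D) (hxR : ‖x‖ < R) (hpos : 0 < ⟪profile V₀ F ‖x‖ (‖x‖⁻¹ • x), ‖x‖⁻¹ • x⟫) :
    0 < rate (V₀ + V₁) x := by
  have hr : 0 < ‖x‖ := norm_pos_iff.2 (h.isOpenCone.ne_zero hx)
  rw [rate_eq h hF hx hxR]
  have := Real.rpow_pos_of_pos hr d
  positivity

/-- This is dx/d(log r). The powers of r cancel in the quotient, so the result depends only on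
`profile` and extends to r = 0. -/
theorem inv_rate_smul (h : IsHomogeneousField d D V₀) (hF : IsPolarTerm d R D V₁ F) {x : Euc n}
    (hx : x ∈ D) (hxR : ‖x‖ < R) :
    (rate (V₀ + V₁) x)⁻¹ • (V₀ + V₁) x =
      x + ‖x‖ • polarField V₀ F ‖x‖ (‖x‖⁻¹ • x) := by
  have hr : 0 < ‖x‖ := norm_pos_iff.2 (h.isOpenCone.ne_zero hx)
  have hrd := Real.rpow_pos_of_pos hr d
  rw [rate_eq h hF hx hxR, field_eq h hF hx hxR, polarField, smul_sub, smul_inv_smul₀ hr.ne',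
    add_sub_cancel, smul_smul, smul_smul]
  congr 1
  rw [mul_inv, inv_div]
  field_simp

theorem hasDerivAt_norm {V : Euc n → Euc n} {x : ℝ → Euc n} {t : ℝ}
    (hx : HasDerivAt x (V (x t)) t) (hx0 : x t ≠ 0) :
    HasDerivAt (fun t => ‖x t‖) (rate V (x t) * ‖x t‖) t := by
  have hr : 0 < ‖x t‖ := norm_pos_iff.2 hx0
  have h1 := hx.norm_sq.sqrt (by positivity)
  simp only [Real.sqrt_sq (norm_nonneg _)] at h1
  convert h1 using 1
  rw [rate, real_inner_comm]
  field_simp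

theorem hasDerivAt_direction (h : IsHomogeneousField d D V₀) (hF : IsPolarTerm d R D V₁ F)
    {x : ℝ → Euc n} {t : ℝ} (hx : HasDerivAt x ((V₀ + V₁) (x t)) t) (hxD : x t ∈ D)
    (hxR : ‖x t‖ < R) (hpos : rate (V₀ + V₁) (x t) ≠ 0) :
    HasDerivAt (fun t => ‖x t‖⁻¹ • x t)
      (rate (V₀ + V₁) (x t) • polarField V₀ F ‖x t‖ (‖x t‖⁻¹ • x t)) t := by
  have hx0 := h.isOpenCone.ne_zero hxD
  have hr : 0 < ‖x t‖ := norm_pos_iff.2 hx0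
  have h1 := ((hasDerivAt_norm hx hx0).inv hr.ne').smul hx
  have h2 := inv_rate_smul h hF hxD hxR
  rw [inv_smul_eq_iff₀ hpos] at h2
  refine HasDerivAt.congr_deriv h1 ?_
  rw [h2, Pi.inv_apply, smul_smul, smul_add, smul_smul _ ‖x t‖, add_right_comm, ← add_smul]
  have e1 : ‖x t‖⁻¹ * rate (V₀ + V₁) (x t) +
      -(rate (V₀ + V₁) (x t) * ‖x t‖) / ‖x t‖ ^ 2 = 0 := by field_simp; ring
  have e2 : ‖x t‖⁻¹ * rate (V₀ + V₁) (x t) * ‖x t‖ = rate (V₀ + V₁) (x t) := by field_simp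
  rw [e1, e2, zero_smul, zero_add]

/-- The local structure of the polar field near a direction with positive radial component. -/
structure IsPolarBall (D : Set (Euc n)) (V₀ : Euc n → Euc n) (F : ℝ × Euc n → Euc n) (R : ℝ)
    (θ : Euc n) (K ρ δ : ℝ) : Prop where
  K_nonneg : 0 ≤ K
  ρ_pos : 0 < ρ
  ρ_lt : ρ < R
  δ_pos : 0 < δ
  subset : Metric.ball θ δ ⊆ D
  radial_pos : ∀ x ∈ Metric.ball θ δ, 0 < radial V₀ x
  inner_pos : ∀ r ∈ Icc 0 ρ, ∀ x ∈ Metric.ball θ δ, 0 < ⟪profile V₀ F r x, x⟫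
  norm_sub_slope_le : ∀ r ∈ Icc 0 ρ, ∀ x ∈ Metric.ball θ δ,
    ‖polarField V₀ F r x - slope V₀ x‖ ≤ K * r
  lip : ∀ r ∈ Icc 0 ρ, ∀ x ∈ Metric.ball θ δ, ∀ y ∈ Metric.ball θ δ,
    ‖(polarField V₀ F r x - slope V₀ x) - (polarField V₀ F r y - slope V₀ y)‖ ≤ K * r * ‖x - y‖
  continuousOn : ContinuousOn (fun p : ℝ × Euc n => polarField V₀ F p.1 p.2)
    (Icc 0 ρ ×ˢ Metric.ball θ δ)

/-- The polar field is the slope plus r g(r, x) with g of class C¹ up to r = 0. So K can be taken as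
a common bound and Lipschitz constant of g near (0, θ). -/
theorem exists_isPolarBall (h : IsHomogeneousField d D V₀) (hF : IsPolarTerm d R D V₁ F)
    (hR : 0 < R) {θ : Euc n} (hθ : θ ∈ D) (hr : 0 < radial V₀ θ) :
    ∃ K ρ δ : ℝ, IsPolarBall D V₀ F R θ K ρ δ := by
  obtain ⟨δ₀, hδ₀, hδD⟩ := Metric.isOpen_iff.1 h.isOpenCone.isOpen θ hθ
  set S : Set (ℝ × Euc n) := Ico 0 R ×ˢ Metric.ball θ δ₀ with hS
  have hSsub : S ⊆ Ico 0 R ×ˢ D := prod_mono_right hδD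
  have hSconv : Convex ℝ S := (convex_Ico 0 R).prod (convex_ball θ δ₀)
  have hmem : ((0 : ℝ), θ) ∈ S := ⟨⟨le_rfl, hR⟩, Metric.mem_ball_self hδ₀⟩
  have hFd : ContDiffWithinAt ℝ 1 F S (0, θ) :=
    ((hF.contDiffOn.mono hSsub) _ hmem).of_le (by simp)
  have hsnd : ContDiffWithinAt ℝ 1 (fun p : ℝ × Euc n => p.2) S (0, θ) := contDiffWithinAt_snd
  have hfst : ContDiffWithinAt ℝ 1 (fun p : ℝ × Euc n => p.1) S (0, θ) := contDiffWithinAt_fst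
  have hVd : ContDiffWithinAt ℝ 1 (fun p : ℝ × Euc n => V₀ p.2) S (0, θ) :=
    ((h.contDiffAt hθ).of_le (by simp)).comp_contDiffWithinAt (0, θ) hsnd
  have hrd : ContDiffWithinAt ℝ 1 (fun p : ℝ × Euc n => radial V₀ p.2) S (0, θ) :=
    hVd.inner ℝ hsnd
  have hWd : ContDiffWithinAt ℝ 1 (fun p : ℝ × Euc n => ⟪profile V₀ F p.1 p.2, p.2⟫) S (0, θ) :=
    (hVd.add (hfst.smul hFd)).inner ℝ hsnd
  have hW0 : ⟪profile V₀ F 0 θ, θ⟫ = radial V₀ θ := by simp [profile, radial]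
  -- With p = ⟪V₀, x⟫ and w = p + r⟪F, x⟫, this is the difference (V₀ + rF)/w - V₀/p divided by r.
  let g : ℝ × Euc n → Euc n := fun p => (radial V₀ p.2 * ⟪profile V₀ F p.1 p.2, p.2⟫)⁻¹ •
    (radial V₀ p.2 • F p - ⟪F p, p.2⟫ • V₀ p.2)
  have hgd : ContDiffWithinAt ℝ 1 g S (0, θ) := by
    refine ((hrd.mul hWd).inv ?_).smul ((hrd.smul hFd).sub ((hFd.inner ℝ hsnd).smul hVd))
    rw [hW0]
    positivity
  obtain ⟨L, t, ht, hL⟩ := hgd.exists_lipschitzOnWith hSconv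
  have hbdd : ∀ᶠ p in 𝓝[S] ((0 : ℝ), θ), ‖g p‖ < ‖g (0, θ)‖ + 1 :=
    hgd.continuousWithinAt.norm.eventually_lt_const (lt_add_one _)
  have hWpos : ∀ᶠ p in 𝓝[S] ((0 : ℝ), θ), 0 < ⟪profile V₀ F p.1 p.2, p.2⟫ :=
    hWd.continuousWithinAt.eventually_const_lt (by simpa only [hW0] using hr)
  have hrpos : ∀ᶠ p in 𝓝[S] ((0 : ℝ), θ), 0 < radial V₀ p.2 :=
    hrd.continuousWithinAt.eventually_const_lt hr
  obtain ⟨ε, hε, hball⟩ := Metric.mem_nhdsWithin_iff.1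
    (((show ∀ᶠ p in 𝓝[S] ((0 : ℝ), θ), p ∈ t from ht).and hbdd).and (hWpos.and hrpos))
  set ρ := min (ε / 2) (R / 2) with hρ
  set δ := min ε δ₀ with hδ
  have hρ0 : 0 < ρ := by positivity
  have hρε : ρ < ε := (min_le_left _ _).trans_lt (by linarith)
  have hρR : ρ < R := (min_le_right _ _).trans_lt (by linarith)
  have hδ0 : 0 < δ := by positivity
  have hsub : Metric.ball θ δ ⊆ D :=
    (Metric.ball_subset_ball (min_le_right _ _)).trans hδD
  have hin : ∀ r ∈ Icc 0 ρ, ∀ x ∈ Metric.ball θ δ, (r, x) ∈ S := fun r hr x hx =>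
    ⟨⟨hr.1, hr.2.trans_lt hρR⟩, Metric.ball_subset_ball (min_le_right _ _) hx⟩
  have hmain : ∀ r ∈ Icc 0 ρ, ∀ x ∈ Metric.ball θ δ, ((r, x) ∈ t ∧ ‖g (r, x)‖ < ‖g (0, θ)‖ + 1) ∧
      0 < ⟪profile V₀ F r x, x⟫ ∧ 0 < radial V₀ x := fun r hr x hx => by
    refine hball ⟨?_, hin r hr x hx⟩
    rw [← ball_prod_same]
    refine ⟨?_, Metric.ball_subset_ball (min_le_left _ _) hx⟩
    rw [Real.ball_eq_Ioo]
    constructor <;> linarith [hr.1, hr.2]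
  have hG : ∀ r ∈ Icc 0 ρ, ∀ x ∈ Metric.ball θ δ,
      polarField V₀ F r x - slope V₀ x = r • g (r, x) := fun r hr x hx => by
    obtain ⟨-, h1, h2⟩ := hmain r hr x hx
    have h3 : ⟪profile V₀ F r x, x⟫ = radial V₀ x + r * ⟪F (r, x), x⟫ := by
      rw [profile, inner_add_left, inner_smul_left, radial]
      rfl
    rw [slope_eq h2.ne', polarField, sub_sub_sub_cancel_right]
    simp only [g]
    set w := ⟪profile V₀ F r x, x⟫ with hw
    set p := radial V₀ x with hp
    rw [profile, smul_add, smul_smul, smul_smul, smul_sub, smul_smul, smul_smul]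
    have e1 : p⁻¹ = w⁻¹ + r * (p * w)⁻¹ * ⟪F (r, x), x⟫ := by
      field_simp
      linarith
    have e2 : w⁻¹ * r = r * (p * w)⁻¹ * p := by field_simp
    rw [e2, e1, add_smul]
    abel
  refine ⟨max (‖g (0, θ)‖ + 1) L, ρ, δ, ⟨(NNReal.coe_nonneg L).trans (le_max_right _ _), hρ0, hρR,
    hδ0, hsub, fun x hx => (hmain 0 ⟨le_rfl, hρ0.le⟩ x hx).2.2,
    fun r hr x hx => (hmain r hr x hx).2.1, fun r hr x hx => ?_, fun r hr x hx y hy => ?_, ?_⟩⟩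
  · rw [hG r hr x hx, norm_smul, Real.norm_of_nonneg hr.1, mul_comm]
    exact mul_le_mul_of_nonneg_right ((hmain r hr x hx).1.2.le.trans (le_max_left _ _)) hr.1
  · rw [hG r hr x hx, hG r hr y hy, ← smul_sub, norm_smul, Real.norm_of_nonneg hr.1, mul_comm _ r,
      mul_assoc]
    refine mul_le_mul_of_nonneg_left ?_ hr.1
    have h1 := hL.norm_sub_le (hmain r hr x hx).1.1 (hmain r hr y hy).1.1
    refine h1.trans (mul_le_mul (le_max_right _ _) (le_of_eq ?_) (norm_nonneg _)
      ((NNReal.coe_nonneg L).trans (le_max_right _ _)))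
    rw [Prod.mk_sub_mk, sub_self, Prod.norm_mk, norm_zero, max_eq_right (norm_nonneg _)]
  · have hc : ContinuousOn (fun p : ℝ × Euc n => profile V₀ F p.1 p.2)
        (Icc 0 ρ ×ˢ Metric.ball θ δ) := by
      refine ContinuousOn.add ?_ (continuousOn_fst.smul ?_)
      · exact h.contDiffOn.continuousOn.comp continuousOn_snd fun p hp => hsub hp.2
      · exact hF.contDiffOn.continuousOn.mono fun p hp => hSsub (hin p.1 hp.1 p.2 hp.2)
    exact (((hc.inner continuousOn_snd).inv₀ fun p hp =>
      (hmain p.1 hp.1 p.2 hp.2).2.1.ne').smul hc).sub continuousOn_snd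

/-- Strict differentiability of the polar field in the direction, uniformly for small radii. -/
theorem IsPolarBall.exists_strict (h : IsHomogeneousField d D V₀) {θ : Euc n} {K ρ δ : ℝ}
    (hb : IsPolarBall D V₀ F R θ K ρ δ) {η : ℝ} (hη : 0 < η) :
    ∃ ρ' > 0, ∃ δ' > 0, ρ' ≤ ρ ∧ δ' ≤ δ ∧ ∀ r ∈ Icc 0 ρ', ∀ x ∈ Metric.ball θ δ',
      ∀ y ∈ Metric.ball θ δ', ‖polarField V₀ F r x - polarField V₀ F r y -
        fderiv ℝ (slope V₀) θ (x - y)‖ ≤ η * ‖x - y‖ := by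
  have hθ := Metric.mem_ball_self hb.δ_pos (x := θ)
  have hst := (h.contDiffAt_slope (hb.subset hθ) (hb.radial_pos θ hθ).ne').hasStrictFDerivAt
    (by simp)
  obtain ⟨δ', hδ', hlip⟩ := Metric.eventually_nhds_iff_ball.1
    (hst.isLittleO.def (show 0 < η / 2 by positivity))
  have hK := hb.K_nonneg
  refine ⟨min ρ (η / (2 * (K + 1))), lt_min hb.ρ_pos (by positivity), min δ δ',
    lt_min hb.δ_pos hδ', min_le_left _ _, min_le_left _ _, fun r hr x hx y hy => ?_⟩
  have hbδ : Metric.ball θ (min δ δ') ⊆ Metric.ball θ δ := Metric.ball_subset_ball (min_le_left _ _)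
  have hbδ' : Metric.ball θ (min δ δ') ⊆ Metric.ball θ δ' :=
    Metric.ball_subset_ball (min_le_right _ _)
  have h1 := hb.lip r ⟨hr.1, hr.2.trans (min_le_left _ _)⟩ x (hbδ hx) y (hbδ hy)
  have h2 := hlip (x, y) (by rw [← ball_prod_same]; exact ⟨hbδ' hx, hbδ' hy⟩)
  have h3 : K * r ≤ η / 2 := by
    have h4 : r ≤ η / (2 * (K + 1)) := hr.2.trans (min_le_right _ _)
    rw [le_div_iff₀ (by positivity)] at h4
    nlinarith [hr.1]
  calc ‖polarField V₀ F r x - polarField V₀ F r y - fderiv ℝ (slope V₀) θ (x - y)‖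
      = ‖(polarField V₀ F r x - slope V₀ x - (polarField V₀ F r y - slope V₀ y)) +
          (slope V₀ x - slope V₀ y - fderiv ℝ (slope V₀) θ (x - y))‖ := by congr 1; abel
    _ ≤ K * r * ‖x - y‖ + η / 2 * ‖x - y‖ := (norm_add_le _ _).trans (add_le_add h1 h2)
    _ ≤ η / 2 * ‖x - y‖ + η / 2 * ‖x - y‖ := by gcongr
    _ = η * ‖x - y‖ := by ring

end Polar

/-! ### Uniqueness of outgoing solutions near the origin -/

section InitialUniqueness

variable {n : ℕ} {d R : ℝ} {D : Set (Euc n)} {V₀ V₁ : Euc n → Euc n} {F : ℝ × Euc n → Euc n}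

/-- The polar coordinates `(r, u)` of the initial arc of a solution that comes out of the origin in
the direction `θ`; `σ` is the speed of `log r`. -/
structure IsPolarArc (V₀ : Euc n → Euc n) (F : ℝ × Euc n → Euc n) (a : EReal) (t₁ : ℝ) (θ : Euc n)
    (ρ δ : ℝ) (r : ℝ → ℝ) (u : ℝ → Euc n) (σ : ℝ → ℝ) : Prop where
  lt : a < t₁
  r_mem : ∀ t : ℝ, a < t → t < t₁ → r t ∈ Ioc 0 ρ
  u_mem : ∀ t : ℝ, a < t → t < t₁ → u t ∈ Metric.ball θ δ
  σ_pos : ∀ t : ℝ, a < t → t < t₁ → 0 < σ t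
  deriv_r : ∀ t : ℝ, a < t → t < t₁ → HasDerivAt r (σ t * r t) t
  deriv_u : ∀ t : ℝ, a < t → t < t₁ → HasDerivAt u (σ t • polarField V₀ F (r t) (u t)) t
  lim_r : Tendsto r (initialEnd a) (𝓝 0)
  lim_u : Tendsto u (initialEnd a) (𝓝 θ)

/-- Near its initial end the solution stays in the polar ball, where the rate is positive and log r
can serve as the time. -/
theorem IsPolarBall.exists_isPolarArc (h : IsHomogeneousField d D V₀)
    (hF : IsPolarTerm d R D V₁ F) {θ : Euc n} {K ρ δ : ℝ} (hb : IsPolarBall D V₀ F R θ K ρ δ)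
    {O : Set (Euc n)} (hO : O ⊆ D) {x : ℝ → Euc n} {a b : EReal}
    (hx : IsSolution (V₀ + V₁) O x a b) (hlim : TendsToOrigin x (initialEnd a) θ) :
    ∃ t₁ : ℝ, (t₁ : EReal) ≤ b ∧ IsPolarArc V₀ F a t₁ θ ρ δ (fun t => ‖x t‖)
      (fun t => ‖x t‖⁻¹ • x t) (fun t => rate (V₀ + V₁) (x t)) := by
  have ha : a < ⊤ := hx.1.trans_le le_top
  obtain ⟨t₁, h1, h2⟩ := (eventually_initialEnd_iff ha).1
    ((hlim.1.eventually_lt_const hb.ρ_pos).and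
      (hlim.2.eventually (Metric.ball_mem_nhds θ hb.δ_pos)))
  obtain ⟨t₂, h3, h4⟩ := EReal.lt_iff_exists_real_btwn.1 (lt_min h1 hx.1)
  have h5 : t₂ < t₁ := EReal.coe_lt_coe_iff.1 (h4.trans_le (min_le_left _ _))
  have h6 : (t₂ : EReal) < b := h4.trans_le (min_le_right _ _)
  have hD : ∀ t : ℝ, a < t → t < t₂ → x t ∈ D := fun t ht1 ht2 =>
    hO (hx.2 t ht1 ((EReal.coe_lt_coe_iff.2 ht2).trans h6)).1
  have hder : ∀ t : ℝ, a < t → t < t₂ → HasDerivAt x ((V₀ + V₁) (x t)) t := fun t ht1 ht2 =>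
    (hx.2 t ht1 ((EReal.coe_lt_coe_iff.2 ht2).trans h6)).2
  have hr : ∀ t : ℝ, a < t → t < t₂ → ‖x t‖ ∈ Ioc 0 ρ := fun t ht1 ht2 =>
    ⟨norm_pos_iff.2 (h.isOpenCone.ne_zero (hD t ht1 ht2)), (h2 t ht1 (ht2.trans h5)).1.le⟩
  have hR : ∀ t : ℝ, a < t → t < t₂ → ‖x t‖ < R := fun t ht1 ht2 =>
    (hr t ht1 ht2).2.trans_lt hb.ρ_lt
  have hσ : ∀ t : ℝ, a < t → t < t₂ → 0 < rate (V₀ + V₁) (x t) := fun t ht1 ht2 =>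
    rate_pos h hF (hD t ht1 ht2) (hR t ht1 ht2) (hb.inner_pos _ (Ioc_subset_Icc_self (hr t ht1 ht2)) _
      (h2 t ht1 (ht2.trans h5)).2)
  exact ⟨t₂, h6.le, h3, hr, fun t ht1 ht2 => (h2 t ht1 (ht2.trans h5)).2, hσ,
    fun t ht1 ht2 => hasDerivAt_norm (hder t ht1 ht2) (h.isOpenCone.ne_zero (hD t ht1 ht2)),
    fun t ht1 ht2 => hasDerivAt_direction h hF (hder t ht1 ht2) (hD t ht1 ht2) (hR t ht1 ht2)
      (hσ t ht1 ht2).ne', hlim.1, hlim.2⟩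

variable {a : EReal} {t₁ : ℝ} {θ : Euc n} {K ρ δ : ℝ} {r : ℝ → ℝ} {u : ℝ → Euc n} {σ : ℝ → ℝ}

theorem IsPolarArc.lt_top (ha : IsPolarArc V₀ F a t₁ θ ρ δ r u σ) : a < ⊤ :=
  ha.lt.trans (EReal.coe_lt_top t₁)

theorem IsPolarArc.eventually (ha : IsPolarArc V₀ F a t₁ θ ρ δ r u σ) :
    ∀ᶠ t : ℝ in initialEnd a, a < (t : EReal) ∧ t < t₁ :=
  (eventually_initialEnd_iff ha.lt_top).2 ⟨t₁, ha.lt, fun _ h1 h2 => ⟨h1, h2⟩⟩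

theorem IsPolarArc.deriv_log (ha : IsPolarArc V₀ F a t₁ θ ρ δ r u σ) {t : ℝ} (h1 : a < t)
    (h2 : t < t₁) : HasDerivAt (fun t => Real.log (r t)) (σ t) t := by
  have h3 := (ha.r_mem t h1 h2).1.ne'
  have h4 := (ha.deriv_r t h1 h2).log h3
  rwa [mul_div_cancel_right₀ _ h3] at h4

theorem IsPolarArc.tendsto_log (ha : IsPolarArc V₀ F a t₁ θ ρ δ r u σ) :
    Tendsto (fun t => Real.log (r t)) (initialEnd a) atBot :=
  Real.tendsto_log_nhdsGT_zero.comp (tendsto_nhdsWithin_iff.2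
    ⟨ha.lim_r, ha.eventually.mono fun t ht => (ha.r_mem t ht.1 ht.2).1⟩)

/-- Solutions come out of the origin only in directions at which the slope vanishes. -/
theorem IsPolarArc.slope_eq_zero (h : IsHomogeneousField d D V₀)
    (hb : IsPolarBall D V₀ F R θ K ρ δ) (ha : IsPolarArc V₀ F a t₁ θ ρ δ r u σ) :
    slope V₀ θ = 0 := by
  by_contra hne
  set e := slope V₀ θ with he
  have he0 : 0 < ‖e‖ := norm_pos_iff.2 hne
  have hK := hb.K_nonneg
  have hθ := Metric.mem_ball_self hb.δ_pos (x := θ)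
  have hcont : ContinuousAt (fun x => ⟪slope V₀ x, e⟫) θ :=
    (h.contDiffAt_slope (hb.subset hθ) (hb.radial_pos θ hθ).ne').continuousAt.inner
      continuousAt_const
  have h1 : ∀ᶠ t in initialEnd a, ‖e‖ ^ 2 / 2 < ⟪slope V₀ (u t), e⟫ :=
    ha.lim_u.eventually (hcont.eventually_const_lt (by
      change _ < ⟪slope V₀ θ, e⟫
      rw [← he, real_inner_self_eq_norm_sq]
      linarith [sq_pos_of_pos he0]))
  have h2 : ∀ᶠ t in initialEnd a, r t < ‖e‖ / (4 * (K + 1)) :=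
    ha.lim_r.eventually_lt_const (by positivity)
  obtain ⟨t₂, h3, h4⟩ := (eventually_initialEnd_iff ha.lt_top).1 ((h1.and h2).and ha.eventually)
  set c := ‖e‖ ^ 2 / 4 with hc
  have hc0 : 0 < c := by positivity
  -- If e ≠ 0, then ⟪u, e⟫ grows at least at speed c in log r, so this function is nonincreasing. It
  -- also tends to -∞ at the initial end, since u converges and log r → -∞: a contradiction.
  have hder : ∀ t : ℝ, a < t → t < t₂ → HasDerivAt (fun t => c * Real.log (r t) - ⟪u t, e⟫)
      (c * σ t - ⟪σ t • polarField V₀ F (r t) (u t), e⟫) t := fun t ht1 ht2 => by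
    have h5 := (h4 t ht1 ht2).2.2
    have h6 := (ha.deriv_u t ht1 h5).inner ℝ (hasDerivAt_const t e)
    rw [inner_zero_right, zero_add] at h6
    exact ((ha.deriv_log ht1 h5).const_mul c).sub h6
  have hneg : ∀ t : ℝ, a < t → t < t₂ →
      c * σ t - ⟪σ t • polarField V₀ F (r t) (u t), e⟫ ≤ 0 := fun t ht1 ht2 => by
    obtain ⟨⟨h5, h6⟩, h7⟩ := h4 t ht1 ht2
    have h8 := ha.r_mem t ht1 h7.2
    have h9 := hb.norm_sub_slope_le _ (Ioc_subset_Icc_self h8) _ (ha.u_mem t ht1 h7.2)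
    have h10 : -⟪polarField V₀ F (r t) (u t) - slope V₀ (u t), e⟫ ≤ K * r t * ‖e‖ :=
      (neg_le_abs _).trans ((abs_real_inner_le_norm _ _).trans (by gcongr))
    have h11 : K * r t * ‖e‖ ≤ ‖e‖ ^ 2 / 4 := by
      rw [lt_div_iff₀ (by positivity)] at h6
      have : K * r t ≤ ‖e‖ / 4 := by nlinarith [h8.1]
      nlinarith
    rw [inner_sub_left] at h10
    rw [inner_smul_left, conj_trivial, mul_comm c, ← mul_sub]
    refine mul_nonpos_of_nonneg_of_nonpos (ha.σ_pos t ht1 h7.2).le ?_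
    linarith
  have hbot : Tendsto (fun t => c * Real.log (r t) - ⟪u t, e⟫) (initialEnd a) atBot := by
    have h5 := ha.tendsto_log.const_mul_atBot hc0
    have h6 : Tendsto (fun t => -⟪u t, e⟫) (initialEnd a) (𝓝 (-⟪θ, e⟫)) :=
      (ha.lim_u.inner tendsto_const_nhds).neg
    simpa only [sub_eq_add_neg] using h5.atBot_add h6
  obtain ⟨t, h5, h6⟩ := EReal.lt_iff_exists_real_btwn.1 h3
  have := initialEnd_neBot ha.lt_top
  obtain ⟨s, hs1, hs2, hs3⟩ := ((hbot.eventually_lt_atBot (c * Real.log (r t) - ⟪u t, e⟫)).and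
    (show ∀ᶠ s : ℝ in initialEnd a, a < (s : EReal) ∧ s < t from
      (eventually_initialEnd_iff ha.lt_top).2 ⟨t, h5, fun _ h1 h2 => ⟨h1, h2⟩⟩)).exists
  exact absurd (le_of_hasDerivAt_nonpos hder hneg hs2 (le_of_lt hs3) (EReal.coe_lt_coe_iff.1 h6))
    (not_le.2 hs1)

/-- The decrease c p² is split in two: one half absorbs the variation of the derivative of the
slope, the other the forcing term of size r by Young's inequality. -/
theorem slope_decay {h C c b k K r y p e : ℝ} (hc : 0 < c) (hh : 0 ≤ h) (hC : 0 ≤ C)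
    (hb : 0 ≤ b) (hk : h * (k * C ^ 2) ≤ c / 2) (hy0 : 0 ≤ y) (hr : 0 ≤ r) (hK : 0 ≤ K)
    (hyp : y ≤ C * p) (hk0 : 0 ≤ k) (he : e ≤ -(c * p ^ 2) + h * y * (k * y) + h * y * (b * (K * r)))
    (hp : 0 ≤ p) : e ≤ (h * C * b * K) ^ 2 / (2 * c) * r ^ 2 := by
  have h1 : h * y * (k * y) ≤ c / 2 * p ^ 2 := by
    calc h * y * (k * y) ≤ h * (C * p) * (k * (C * p)) := by gcongr
      _ = h * (k * C ^ 2) * p ^ 2 := by ring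
      _ ≤ _ := by gcongr
  have h2 : h * y * (b * (K * r)) ≤ h * (C * p) * (b * (K * r)) := by gcongr
  have h3 : h * (C * p) * (b * (K * r)) ≤ c / 2 * p ^ 2 + (h * C * b * K) ^ 2 / (2 * c) * r ^ 2 := by
    have h4 : (h * C * b * K) ^ 2 / (2 * c) * r ^ 2 = (h * C * b * K * r) ^ 2 / (2 * c) := by ring
    have h5 : h * (C * p) * (b * (K * r)) = h * C * b * K * r * p := by ring
    rw [h4, h5, ← sub_le_iff_le_add', le_div_iff₀ (by positivity)]
    nlinarith [sq_nonneg (h * C * b * K * r - c * p)]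
  linarith

/-- Along a solution that comes out of the origin in a direction of `Z₊`, the slope is at most
proportional to the radius. -/
theorem IsPolarArc.exists_slope_le (h : IsHomogeneousField d D V₀)
    (hb : IsPolarBall D V₀ F R θ K ρ δ) {T : Submodule ℝ (Euc n)} {P H : Euc n →L[ℝ] Euc n} {c C : ℝ}
    (hP : IsTransverseForm (fderiv ℝ (slope V₀) θ) T P H c) (hC : 0 < C)
    (hPC : ∀ᶠ x in 𝓝 θ, ‖slope V₀ x‖ ≤ C * ‖P (slope V₀ x)‖)
    (ha : IsPolarArc V₀ F a t₁ θ ρ δ r u σ) :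
    ∃ K' > 0, ∀ᶠ t in initialEnd a, ‖slope V₀ (u t)‖ ≤ K' * r t := by
  have hc := hP.pos
  have hK := hb.K_nonneg
  have hθ := Metric.mem_ball_self hb.δ_pos (x := θ)
  have hs0 := ha.slope_eq_zero h hb
  have hsm := h.contDiffAt_slope (hb.subset hθ) (hb.radial_pos θ hθ).ne'
  set B := fderiv ℝ (slope V₀) θ with hB
  -- The allowed variation of the derivative near θ: ‖H‖ k C² ≤ c/2.
  set k := c / (2 * (‖H‖ + 1) * C ^ 2) with hk
  have hk0 : 0 < k := by positivity
  have hkc : ‖H‖ * (k * C ^ 2) ≤ c / 2 := by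
    have : (‖H‖ + 1) * (k * C ^ 2) = c / 2 := by rw [hk]; field_simp
    nlinarith [sq_nonneg C]
  have hfd : ∀ᶠ x in 𝓝 θ, ‖fderiv ℝ (slope V₀) x - B‖ < k := by
    have h1 : ContinuousAt (fderiv ℝ (slope V₀)) θ :=
      (hsm.fderiv_right (m := 0) (by simp)).continuousAt
    exact (h1.sub continuousAt_const).norm.eventually_lt_const (by simpa [hB] using hk0)
  obtain ⟨t₂, h3, h4⟩ := (eventually_initialEnd_iff ha.lt_top).1
    ((ha.lim_u.eventually (hPC.and hfd)).and ha.eventually)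
  set b := ‖B‖ + k with hbdef
  set K₂ := (‖H‖ * C * b * K) ^ 2 / (2 * c) with hK₂
  have hK₂0 : 0 ≤ K₂ := by positivity
  set y : ℝ → Euc n := fun t => slope V₀ (u t) with hy
  set y' : ℝ → Euc n := fun t =>
    fderiv ℝ (slope V₀) (u t) (σ t • polarField V₀ F (r t) (u t)) with hy'
  have hyd : ∀ t : ℝ, a < t → t < t₂ → HasDerivAt y (y' t) t := fun t ht1 ht2 => by
    have h5 := (h4 t ht1 ht2).2.2
    have h6 := ha.u_mem t ht1 h5
    exact ((h.contDiffAt_slope (hb.subset h6) (hb.radial_pos _ h6).ne').differentiableAt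
      (by simp)).hasFDerivAt.comp_hasDerivAt t (ha.deriv_u t ht1 h5)
  -- With respect to log r, ⟪H y, y⟫ grows at most at speed 2 K₂ r², which is the derivative of K₂
  -- r². The difference is nonincreasing with limit 0 at the initial end, hence nonpositive.
  have hder : ∀ t : ℝ, a < t → t < t₂ → HasDerivAt (fun t => ⟪H (y t), y t⟫ - K₂ * r t ^ 2)
      (⟪H (y t), y' t⟫ + ⟪H (y' t), y t⟫ - K₂ * (2 * r t * (σ t * r t))) t := fun t ht1 ht2 => by
    have h5 := (h4 t ht1 ht2).2.2
    have h6 := (H.hasFDerivAt.comp_hasDerivAt t (hyd t ht1 ht2)).inner ℝ (hyd t ht1 ht2)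
    have h7 := ((ha.deriv_r t ht1 h5).pow 2).const_mul K₂
    refine HasDerivAt.congr_deriv (h6.sub h7) ?_
    simp [y]
  have hneg : ∀ t : ℝ, a < t → t < t₂ →
      ⟪H (y t), y' t⟫ + ⟪H (y' t), y t⟫ - K₂ * (2 * r t * (σ t * r t)) ≤ 0 := fun t ht1 ht2 => by
    obtain ⟨⟨h5, h6⟩, h7⟩ := h4 t ht1 ht2
    have h8 := ha.r_mem t ht1 h7.2
    have h9 := hb.norm_sub_slope_le _ (Ioc_subset_Icc_self h8) _ (ha.u_mem t ht1 h7.2)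
    have hσ := ha.σ_pos t ht1 h7.2
    set A := fderiv ℝ (slope V₀) (u t) with hA
    set g := polarField V₀ F (r t) (u t) - y t with hg
    have hAb : ‖A‖ ≤ b := by
      calc ‖A‖ = ‖B + (A - B)‖ := by congr 1; abel
        _ ≤ ‖B‖ + ‖A - B‖ := norm_add_le _ _
        _ ≤ b := by rw [hbdef]; gcongr
    have hyA : y' t = σ t • (B (y t) + (A - B) (y t) + A g) := by
      simp only [hy', hg, map_smul, _root_.sub_apply, map_sub]
      congr 1
      abel
    have h10 : ⟪H (y' t), y t⟫ = ⟪H (y t), y' t⟫ := by rw [hP.symm, real_inner_comm]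
    have hHy : ‖H (y t)‖ ≤ ‖H‖ * ‖y t‖ := H.le_opNorm _
    have h11 : ⟪H (y t), (A - B) (y t)⟫ ≤ ‖H‖ * ‖y t‖ * (k * ‖y t‖) := by
      refine (real_inner_le_norm _ _).trans (mul_le_mul hHy ?_ (norm_nonneg _) (by positivity))
      exact ((A - B).le_opNorm _).trans (by gcongr)
    have h12 : ⟪H (y t), A g⟫ ≤ ‖H‖ * ‖y t‖ * (b * (K * r t)) := by
      refine (real_inner_le_norm _ _).trans (mul_le_mul hHy ?_ (norm_nonneg _) (by positivity))
      exact (A.le_opNorm _).trans (by gcongr)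
    have h13 := hP.decr (y t)
    have h14 : ⟪H (y t), B (y t) + (A - B) (y t) + A g⟫ ≤ K₂ * r t ^ 2 := by
      refine slope_decay (h := ‖H‖) (C := C) (b := b) (k := k) (y := ‖y t‖) (p := ‖P (y t)‖) hc
        (norm_nonneg _) hC.le (by positivity) hkc (norm_nonneg _) h8.1.le hK h5 hk0.le ?_
        (norm_nonneg _)
      rw [inner_add_right, inner_add_right]
      linarith
    rw [h10, hyA, inner_smul_right]
    nlinarith
  have hylim : Tendsto y (initialEnd a) (𝓝 0) := by
    rw [← hs0]
    exact hsm.continuousAt.tendsto.comp ha.lim_u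
  have hlim : Tendsto (fun t => ⟪H (y t), y t⟫ - K₂ * r t ^ 2) (initialEnd a) (𝓝 0) := by
    have h5 := (((H.continuous.tendsto 0).comp hylim).inner hylim (𝕜 := ℝ)).sub
      ((ha.lim_r.pow 2).const_mul K₂)
    simpa using h5
  refine ⟨C * (√(K₂ / c) + 1), by positivity,
    (eventually_initialEnd_iff ha.lt_top).2 ⟨t₂, h3, fun t ht1 ht2 => ?_⟩⟩
  have h5 := le_of_tendsto_initialEnd hder hneg hlim ht1 ht2
  obtain ⟨⟨h6, -⟩, h7⟩ := h4 t ht1 ht2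
  have h8 := (ha.r_mem t ht1 h7.2).1
  have h9 := hP.le (y t)
  have h10 : ‖P (y t)‖ ≤ √(K₂ / c) * r t := by
    refine le_of_sq_le_sq ?_ (by positivity)
    rw [mul_pow, Real.sq_sqrt (by positivity), div_mul_eq_mul_div, le_div_iff₀ hc]
    linarith
  calc ‖slope V₀ (u t)‖ ≤ C * ‖P (y t)‖ := h6
    _ ≤ C * (√(K₂ / c) * r t) := by gcongr
    _ ≤ C * (√(K₂ / c) + 1) * r t := by nlinarith

/-- Along a solution that comes out of the origin in a direction of `Z₊`, the direction converges at
least as fast as the radius. -/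
theorem IsPolarArc.exists_norm_sub_le (hb : IsPolarBall D V₀ F R θ K ρ δ) {K' : ℝ} (hK' : 0 < K')
    (ha : IsPolarArc V₀ F a t₁ θ ρ δ r u σ)
    (hs : ∀ᶠ t in initialEnd a, ‖slope V₀ (u t)‖ ≤ K' * r t) :
    ∀ᶠ t in initialEnd a, ‖u t - θ‖ ≤ (K + K') * r t := by
  obtain ⟨t₂, h3, h4⟩ := (eventually_initialEnd_iff ha.lt_top).1 (hs.and ha.eventually)
  refine (eventually_initialEnd_iff ha.lt_top).2 ⟨t₂, h3, fun t ht1 ht2 => ?_⟩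
  set e := u t - θ with he
  -- Testing against the vector e, frozen at its value at time t, avoids differentiating the norm of
  -- u - θ.
  have hder : ∀ τ : ℝ, a < τ → τ < t₂ →
      HasDerivAt (fun τ => ⟪u τ - θ, e⟫ - (K + K') * ‖e‖ * r τ)
      (⟪σ τ • polarField V₀ F (r τ) (u τ), e⟫ - (K + K') * ‖e‖ * (σ τ * r τ)) τ :=
    fun τ hτ1 hτ2 => by
    have h5 := (h4 τ hτ1 hτ2).2.2
    have h6 := ((ha.deriv_u τ hτ1 h5).sub_const θ).inner ℝ (hasDerivAt_const τ e)
    rw [inner_zero_right, zero_add] at h6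
    exact h6.sub ((ha.deriv_r τ hτ1 h5).const_mul _)
  have hneg : ∀ τ : ℝ, a < τ → τ < t₂ →
      ⟪σ τ • polarField V₀ F (r τ) (u τ), e⟫ - (K + K') * ‖e‖ * (σ τ * r τ) ≤ 0 :=
    fun τ hτ1 hτ2 => by
    obtain ⟨h5, h6⟩ := h4 τ hτ1 hτ2
    have h7 := hb.norm_sub_slope_le _ (Ioc_subset_Icc_self (ha.r_mem τ hτ1 h6.2)) _
      (ha.u_mem τ hτ1 h6.2)
    have h8 : ‖polarField V₀ F (r τ) (u τ)‖ ≤ (K + K') * r τ := by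
      calc _ = ‖(polarField V₀ F (r τ) (u τ) - slope V₀ (u τ)) + slope V₀ (u τ)‖ := by
            congr 1; abel
        _ ≤ _ := (norm_add_le _ _).trans (by linarith)
    have h9 : ⟪polarField V₀ F (r τ) (u τ), e⟫ ≤ (K + K') * r τ * ‖e‖ :=
      (real_inner_le_norm _ _).trans (by gcongr)
    rw [inner_smul_left, conj_trivial]
    have := ha.σ_pos τ hτ1 h6.2
    nlinarith
  have hlim : Tendsto (fun τ => ⟪u τ - θ, e⟫ - (K + K') * ‖e‖ * r τ) (initialEnd a) (𝓝 0) := by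
    have h5 := ((ha.lim_u.sub_const θ).inner (tendsto_const_nhds (x := e)) (𝕜 := ℝ)).sub
      (ha.lim_r.const_mul ((K + K') * ‖e‖))
    simpa using h5
  have h5 := le_of_tendsto_initialEnd hder hneg hlim ht1 ht2
  rw [← he, real_inner_self_eq_norm_sq] at h5
  have hr := (ha.r_mem t ht1 (h4 t ht1 ht2).2.2).1
  have hK := hb.K_nonneg
  rcases (norm_nonneg e).eq_or_lt with h6 | h6
  · rw [← h6]; positivity
  · refine le_of_mul_le_mul_left ?_ h6
    linarith

/-- Two solutions that come out of the origin in the same direction, and whose directions converge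
at least as fast as the radius, agree initially. -/
theorem IsPolarArc.eventually_eq (h : IsHomogeneousField d D V₀)
    (hb : IsPolarBall D V₀ F R θ K ρ δ) {H : Euc n →L[ℝ] Euc n} {c : ℝ}
    (hH : IsAdaptedForm (fderiv ℝ (slope V₀) θ) H c)
    (ha : IsPolarArc V₀ F a t₁ θ ρ δ r u σ) {K₁ K₂ s₁ : ℝ}
    (hu : ∀ᶠ t in initialEnd a, ‖u t - θ‖ ≤ K₁ * r t) {Θ : ℝ → Euc n}
    (hΘ : ∀ s < s₁, HasDerivAt Θ (polarField V₀ F (Real.exp s) (Θ s)) s)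
    (hΘK : ∀ s < s₁, ‖Θ s - θ‖ ≤ K₂ * Real.exp s) :
    ∀ᶠ t in initialEnd a, u t = Θ (Real.log (r t)) := by
  have hc := hH.pos
  have := initialEnd_neBot ha.lt_top
  obtain ⟨ρ', hρ', δ', hδ', -, -, hst⟩ := hb.exists_strict h
    (show 0 < c / (4 * (‖H‖ + 1)) by positivity)
  set η := c / (4 * (‖H‖ + 1)) with hη
  have hlog : ∀ᶠ t in initialEnd a, Real.log (r t) < s₁ := ha.tendsto_log.eventually_lt_atBot s₁
  have hlog' : ∀ᶠ t in initialEnd a, ‖Θ (Real.log (r t)) - θ‖ ≤ K₂ * r t := by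
    filter_upwards [hlog, ha.eventually] with t h1 h2
    have := hΘK _ h1
    rwa [Real.exp_log (ha.r_mem t h2.1 h2.2).1] at this
  have hΘlim : ∀ᶠ t in initialEnd a, Θ (Real.log (r t)) ∈ Metric.ball θ δ' := by
    have h1 : ∀ᶠ t in initialEnd a, K₂ * r t < δ' :=
      (ha.lim_r.const_mul K₂).eventually_lt_const (by simpa using hδ')
    filter_upwards [hlog', h1] with t h2 h3
    rw [mem_ball_iff_norm]
    exact h2.trans_lt h3
  obtain ⟨t₂, h3, h4⟩ := (eventually_initialEnd_iff ha.lt_top).1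
    (((ha.lim_r.eventually_lt_const hρ').and
      (ha.lim_u.eventually (Metric.ball_mem_nhds θ hδ'))).and
      ((hlog.and hΘlim).and ((hu.and hlog').and ha.eventually)))
  set y : ℝ → Euc n := fun t => u t - Θ (Real.log (r t)) with hy
  set y' : ℝ → Euc n := fun t => σ t • (polarField V₀ F (r t) (u t) -
    polarField V₀ F (r t) (Θ (Real.log (r t)))) with hy'
  have hyd : ∀ t : ℝ, a < t → t < t₂ → HasDerivAt y (y' t) t := fun t ht1 ht2 => by
    obtain ⟨-, ⟨h5, -⟩, -, h6⟩ := h4 t ht1 ht2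
    have h7 := (hΘ _ h5).scomp t (ha.deriv_log ht1 h6.2)
    rw [Real.exp_log (ha.r_mem t ht1 h6.2).1] at h7
    refine HasDerivAt.congr_deriv ((ha.deriv_u t ht1 h6.2).sub h7) ?_
    simp only [hy', smul_sub]
  -- In the time log r the form grows at rate at most 2(1/4 + 1/4) = 1, which the factor 1/r
  -- cancels. As y = O(r), the quotient is O(r) and tends to 0 at the initial end.
  have hder : ∀ t : ℝ, a < t → t < t₂ → HasDerivAt (fun t => ⟪H (y t), y t⟫ * (r t)⁻¹)
      ((⟪H (y t), y' t⟫ + ⟪H (y' t), y t⟫) * (r t)⁻¹ +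
        ⟪H (y t), y t⟫ * (-(σ t * r t) / r t ^ 2)) t := fun t ht1 ht2 => by
    have h5 := (h4 t ht1 ht2).2.2.2.2
    have h6 := (H.hasFDerivAt.comp_hasDerivAt t (hyd t ht1 ht2)).inner ℝ (hyd t ht1 ht2)
    exact h6.mul ((ha.deriv_r t ht1 h5).inv (ha.r_mem t ht1 h5).1.ne')
  have hneg : ∀ t : ℝ, a < t → t < t₂ → (⟪H (y t), y' t⟫ + ⟪H (y' t), y t⟫) * (r t)⁻¹ +
        ⟪H (y t), y t⟫ * (-(σ t * r t) / r t ^ 2) ≤ 0 := fun t ht1 ht2 => by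
    obtain ⟨⟨h5, h6⟩, ⟨-, h7⟩, -, h8⟩ := h4 t ht1 ht2
    have hr := (ha.r_mem t ht1 h8.2).1
    have hσ := ha.σ_pos t ht1 h8.2
    have h9 := hst (r t) ⟨hr.le, h5.le⟩ _ h6 _ h7
    set g := polarField V₀ F (r t) (u t) - polarField V₀ F (r t) (Θ (Real.log (r t))) with hg
    set B := fderiv ℝ (slope V₀) θ with hB
    have hyg : y' t = σ t • g := rfl
    have h10 : ⟪H (y' t), y t⟫ = ⟪H (y t), y' t⟫ := by rw [hH.symm, real_inner_comm]
    have h11 : ⟪H (y t), g⟫ ≤ 1 / 2 * ⟪H (y t), y t⟫ := by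
      have e1 : g = B (y t) + (g - B (y t)) := by abel
      have e2 : ⟪H (y t), g - B (y t)⟫ ≤ 1 / 4 * ⟪H (y t), y t⟫ := by
        calc ⟪H (y t), g - B (y t)⟫ ≤ ‖H (y t)‖ * ‖g - B (y t)‖ := real_inner_le_norm _ _
          _ ≤ (‖H‖ * ‖y t‖) * (η * ‖y t‖) :=
            mul_le_mul (H.le_opNorm _) h9 (norm_nonneg _) (by positivity)
          _ ≤ ((‖H‖ + 1) * ‖y t‖) * (η * ‖y t‖) := by gcongr; linarith
          _ = 1 / 4 * (c * ‖y t‖ ^ 2) := by rw [hη]; field_simp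
          _ ≤ _ := by gcongr; exact hH.le _
      rw [e1, inner_add_right]
      linarith [hH.growth (y t)]
    have e3 : ⟪H (y t), y t⟫ * (-(σ t * r t) / r t ^ 2) =
        -(σ t * ⟪H (y t), y t⟫) * (r t)⁻¹ := by field_simp
    rw [h10, hyg, inner_smul_right, e3, ← add_mul]
    refine mul_nonpos_of_nonpos_of_nonneg ?_ (inv_pos.2 hr).le
    nlinarith
  have hlim : Tendsto (fun t => ⟪H (y t), y t⟫ * (r t)⁻¹) (initialEnd a) (𝓝 0) := by
    have hup : Tendsto (fun t => ‖H‖ * (K₁ + K₂) ^ 2 * r t) (initialEnd a) (𝓝 0) := by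
      simpa using ha.lim_r.const_mul (‖H‖ * (K₁ + K₂) ^ 2)
    refine squeeze_zero' ?_ ?_ hup
    · filter_upwards [ha.eventually] with t ht
      have := (ha.r_mem t ht.1 ht.2).1
      have h5 := hH.le (y t)
      have h6 : 0 ≤ ⟪H (y t), y t⟫ := le_trans (by positivity) h5
      positivity
    · filter_upwards [ha.eventually, hu, hlog'] with t ht h5 h6
      have hr := (ha.r_mem t ht.1 ht.2).1
      have h7 : ‖y t‖ ≤ (K₁ + K₂) * r t := by
        calc ‖y t‖ = ‖(u t - θ) - (Θ (Real.log (r t)) - θ)‖ := by simp only [hy]; congr 1; abel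
          _ ≤ _ := (norm_sub_le _ _).trans (by linarith)
      have h8 : ⟪H (y t), y t⟫ ≤ ‖H‖ * ((K₁ + K₂) * r t) ^ 2 := by
        calc ⟪H (y t), y t⟫ ≤ ‖H (y t)‖ * ‖y t‖ := real_inner_le_norm _ _
          _ ≤ (‖H‖ * ‖y t‖) * ‖y t‖ := by gcongr; exact H.le_opNorm _
          _ = ‖H‖ * ‖y t‖ ^ 2 := by ring
          _ ≤ _ := by gcongr
      rw [← div_eq_mul_inv, div_le_iff₀ hr]
      linarith
  refine (eventually_initialEnd_iff ha.lt_top).2 ⟨t₂, h3, fun t ht1 ht2 => ?_⟩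
  have h5 := le_of_tendsto_initialEnd hder hneg hlim ht1 ht2
  have hr := (ha.r_mem t ht1 (h4 t ht1 ht2).2.2.2.2).1
  have h6 : ⟪H (y t), y t⟫ ≤ 0 := by
    by_contra hcon
    push Not at hcon
    have : 0 < ⟪H (y t), y t⟫ * (r t)⁻¹ := by positivity
    linarith
  have h7 := hH.le (y t)
  have h8 : ‖y t‖ ^ 2 ≤ 0 := by nlinarith [sq_nonneg ‖y t‖]
  have h9 : y t = 0 := by
    have : ‖y t‖ = 0 := by nlinarith [norm_nonneg (y t)]
    exact norm_eq_zero.1 this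
  exact sub_eq_zero.1 h9

end InitialUniqueness

/-! ### Regular outgoing solutions: existence and comparison -/

section LogCurves

variable {n : ℕ} {d R : ℝ} {D : Set (Euc n)} {V₀ V₁ : Euc n → Euc n} {F : ℝ × Euc n → Euc n}

theorem initialEnd_bot : initialEnd ⊥ = atBot := by
  ext S
  have h1 := eventually_initialEnd_iff (a := ⊥) bot_lt_top (p := fun t => t ∈ S)
  change (∀ᶠ t in initialEnd ⊥, t ∈ S) ↔ ∀ᶠ t in atBot, t ∈ S
  rw [h1, eventually_atBot]
  constructor
  · rintro ⟨t₁, -, h⟩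
    exact ⟨t₁ - 1, fun b hb => h b (EReal.bot_lt_coe b) (by linarith)⟩
  · rintro ⟨t₁, h⟩
    exact ⟨t₁, EReal.bot_lt_coe t₁, fun t _ ht => h t ht.le⟩

/-- A solution curve of `V` in `D` that comes out of the origin in the direction `θ`, parametrized by
the logarithm of the distance to the origin. -/
structure IsLogCurve (V : Euc n → Euc n) (D : Set (Euc n)) (s₀ : ℝ) (θ : Euc n) (X : ℝ → Euc n) :
    Prop where
  mem : ∀ s < s₀, X s ∈ D
  norm : ∀ s < s₀, ‖X s‖ = Real.exp s
  rate_pos : ∀ s < s₀, 0 < rate V (X s)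
  deriv : ∀ s < s₀, HasDerivAt X ((rate V (X s))⁻¹ • V (X s)) s
  lim : Tendsto (fun s => Real.exp (-s) • X s) atBot (𝓝 θ)

theorem IsLogCurve.mono {V : Euc n → Euc n} {s₀ s₁ : ℝ} {θ : Euc n} {X : ℝ → Euc n}
    (h : IsLogCurve V D s₀ θ X) (hs : s₁ ≤ s₀) : IsLogCurve V D s₁ θ X :=
  ⟨fun s hs1 => h.mem s (hs1.trans_le hs), fun s hs1 => h.norm s (hs1.trans_le hs),
    fun s hs1 => h.rate_pos s (hs1.trans_le hs), fun s hs1 => h.deriv s (hs1.trans_le hs), h.lim⟩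

theorem inner_polarField {r : ℝ} {x : Euc n} (hx : ⟪profile V₀ F r x, x⟫ ≠ 0) :
    ⟪polarField V₀ F r x, x⟫ = 1 - ‖x‖ ^ 2 := by
  rw [polarField, inner_sub_left, inner_smul_left, real_inner_self_eq_norm_sq, conj_trivial,
    inv_mul_cancel₀ hx]

/-- The polar field is used off the sphere, so it has to be shown that Θ lies on it. Along solutions
the derivative of ‖Θ‖² is 2(1 - ‖Θ‖²), so e^{2s}(‖Θ‖² - 1) is constant, and its limit at -∞ is 0. -/
theorem IsPolarBall.norm_eq_one {θ : Euc n} {K ρ δ : ℝ} (hb : IsPolarBall D V₀ F R θ K ρ δ)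
    {Θ : ℝ → Euc n} {s₁ K₁ : ℝ} {z : Euc n}
    (hΘ : ∀ s < s₁, HasDerivAt Θ (polarField V₀ F (Real.exp s) (Θ s)) s)
    (hK : ∀ s < s₁, ‖Θ s - z‖ ≤ K₁ * Real.exp s) (hmem : ∀ s < s₁, Θ s ∈ Metric.ball θ δ)
    (hρ : ∀ s < s₁, Real.exp s ≤ ρ) {s : ℝ} (hs : s < s₁) : ‖Θ s‖ = 1 := by
  have hlimΘ : Tendsto Θ atBot (𝓝 z) := by
    rw [tendsto_iff_norm_sub_tendsto_zero]
    have h1 : Tendsto (fun s => K₁ * Real.exp s) atBot (𝓝 0) := by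
      simpa using Real.tendsto_exp_atBot.const_mul K₁
    exact squeeze_zero' (Eventually.of_forall fun _ => norm_nonneg _)
      ((eventually_lt_atBot s₁).mono hK) h1
  set f : ℝ → ℝ := fun s => Real.exp (2 * s) * (‖Θ s‖ ^ 2 - 1) with hf
  have hder : ∀ s < s₁, HasDerivAt f 0 s := fun s hs => by
    have h1 := (hΘ s hs).norm_sq.sub_const 1
    have h2 : HasDerivAt (fun s : ℝ => Real.exp (2 * s)) (Real.exp (2 * s) * 2) s := by
      simpa using ((hasDerivAt_id s).const_mul (2 : ℝ)).exp
    refine HasDerivAt.congr_deriv (h2.mul h1) ?_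
    rw [real_inner_comm, inner_polarField
      (hb.inner_pos _ ⟨(Real.exp_pos s).le, hρ s hs⟩ _ (hmem s hs)).ne']
    ring
  have hlim : Tendsto f (initialEnd ⊥) (𝓝 0) := by
    rw [initialEnd_bot]
    have h1 : Tendsto (fun s : ℝ => Real.exp (2 * s)) atBot (𝓝 0) :=
      Real.tendsto_exp_atBot.comp (tendsto_id.const_mul_atBot (by norm_num))
    simpa using h1.mul ((hlimΘ.norm.pow 2).sub_const 1)
  have h1 : f s ≤ 0 := le_of_tendsto_initialEnd (fun t _ ht => hder t ht) (fun _ _ _ => le_rfl) hlim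
    (EReal.bot_lt_coe s) hs
  have h2 : -f s ≤ 0 := le_of_tendsto_initialEnd (f := -f) (f' := fun _ => -0)
    (fun t _ ht => (hder t ht).neg) (fun _ _ _ => by simp) (by simpa [Pi.neg_def] using hlim.neg)
    (EReal.bot_lt_coe s) hs
  have h3 : f s = 0 := by linarith
  have h4 : ‖Θ s‖ ^ 2 - 1 = 0 := by
    rcases mul_eq_zero.1 h3 with h | h
    · exact absurd h (Real.exp_pos _).ne'
    · exact h
  have h5 : ‖Θ s‖ ^ 2 = 1 := by linarith
  exact (pow_eq_one_iff_of_nonneg (norm_nonneg _) two_ne_zero).1 h5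

theorem IsPolarBall.isLogCurve (h : IsHomogeneousField d D V₀) (hF : IsPolarTerm d R D V₁ F)
    {θ : Euc n} {K ρ δ : ℝ} (hb : IsPolarBall D V₀ F R θ K ρ δ)
    {Θ : ℝ → Euc n} {s₁ K₁ : ℝ} {z : Euc n}
    (hΘ : ∀ s < s₁, HasDerivAt Θ (polarField V₀ F (Real.exp s) (Θ s)) s)
    (hK : ∀ s < s₁, ‖Θ s - z‖ ≤ K₁ * Real.exp s) (hmem : ∀ s < s₁, Θ s ∈ Metric.ball θ δ)
    (hρ : ∀ s < s₁, Real.exp s ≤ ρ) :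
    IsLogCurve (V₀ + V₁) D s₁ z fun s => Real.exp s • Θ s := by
  have h1 : ∀ s < s₁, ‖Θ s‖ = 1 := fun s hs => hb.norm_eq_one hΘ hK hmem hρ hs
  have hnorm : ∀ s < s₁, ‖Real.exp s • Θ s‖ = Real.exp s := fun s hs => by
    rw [norm_smul, h1 s hs, mul_one, Real.norm_of_nonneg (Real.exp_pos s).le]
  have hdir : ∀ s < s₁, ‖Real.exp s • Θ s‖⁻¹ • Real.exp s • Θ s = Θ s := fun s hs => by
    rw [hnorm s hs, inv_smul_smul₀ (Real.exp_pos s).ne']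
  have hD : ∀ s < s₁, Real.exp s • Θ s ∈ D := fun s hs =>
    h.isOpenCone.smul_mem _ (Real.exp_pos s) _ (hb.subset (hmem s hs))
  have hR : ∀ s < s₁, ‖Real.exp s • Θ s‖ < R := fun s hs => by
    rw [hnorm s hs]; exact (hρ s hs).trans_lt hb.ρ_lt
  refine ⟨hD, hnorm, fun s hs => ?_, fun s hs => ?_, ?_⟩
  · refine ConeField.rate_pos h hF (hD s hs) (hR s hs) ?_
    rw [hdir s hs, hnorm s hs]
    exact hb.inner_pos _ ⟨(Real.exp_pos s).le, hρ s hs⟩ _ (hmem s hs)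
  · rw [inv_rate_smul h hF (hD s hs) (hR s hs), hdir s hs, hnorm s hs]
    refine HasDerivAt.congr_deriv ((Real.hasDerivAt_exp s).smul (hΘ s hs)) ?_
    rw [add_comm]
  · have h2 : Tendsto Θ atBot (𝓝 z) := by
      rw [tendsto_iff_norm_sub_tendsto_zero]
      have h1 : Tendsto (fun s => K₁ * Real.exp s) atBot (𝓝 0) := by
        simpa using Real.tendsto_exp_atBot.const_mul K₁
      exact squeeze_zero' (Eventually.of_forall fun _ => norm_nonneg _)
        ((eventually_lt_atBot s₁).mono hK) h1
    refine h2.congr fun s => ?_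
    rw [Real.exp_neg, inv_smul_smul₀ (Real.exp_pos s).ne']

theorem IsLogCurve.hasDerivAt_direction (h : IsHomogeneousField d D V₀)
    (hF : IsPolarTerm d R D V₁ F) {θ : Euc n} {s₀ : ℝ} {X : ℝ → Euc n}
    (hX : IsLogCurve (V₀ + V₁) D s₀ θ X) {s : ℝ} (hs : s < s₀) (hsR : Real.exp s < R) :
    HasDerivAt (fun s => Real.exp (-s) • X s)
      (polarField V₀ F (Real.exp s) (Real.exp (-s) • X s)) s := by
  have h1 : HasDerivAt (fun s => Real.exp (-s)) (-Real.exp (-s)) s := by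
    simpa using (hasDerivAt_neg s).exp
  have h2 := inv_rate_smul h hF (hX.mem s hs) (by rwa [hX.norm s hs])
  rw [hX.norm s hs, ← Real.exp_neg] at h2
  refine HasDerivAt.congr_deriv (h1.smul (hX.deriv s hs)) ?_
  rw [h2, smul_add, smul_smul, ← Real.exp_add]
  simp

/-- Solutions come out of the origin only in the directions of `Z₊`, as long as the radial component
is positive. -/
theorem mem_zeroSetPos_of_isSolution (h : IsHomogeneousField d D V₀)
    (hZ : ∀ θ ∈ zeroSet D V₀, θ ∈ D ∧ radial V₀ θ ≠ 0) (hF : IsPolarTerm d R D V₁ F) (hR : 0 < R)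
    {θ : Euc n} (hθ : θ ∈ D) (hr : 0 < radial V₀ θ) {O : Set (Euc n)} (hO : O ⊆ D)
    {x : ℝ → Euc n} {a b : EReal} (hx : IsSolution (V₀ + V₁) O x a b)
    (hlim : TendsToOrigin x (initialEnd a) θ) : θ ∈ zeroSetPos D V₀ := by
  obtain ⟨K, ρ, δ, hb⟩ := exists_isPolarBall h hF hR hθ hr
  obtain ⟨t₁, ht₁, ha⟩ := hb.exists_isPolarArc h hF hO hx hlim
  refine (mem_zeroSetPos_iff h hZ).2 ⟨?_, hθ, hr, ha.slope_eq_zero h hb⟩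
  have := initialEnd_neBot ha.lt_top
  refine tendsto_nhds_unique hlim.2.norm (tendsto_const_nhds.congr' ?_)
  filter_upwards [ha.eventually] with t ht
  exact (norm_direction (norm_pos_iff.1 (ha.r_mem t ht.1 ht.2).1)).symm

/-- A solution that comes out of the origin in a direction of `Z₊` initially agrees with any given
regular one. -/
theorem eventually_eq_isLogCurve (h : IsHomogeneousField d D V₀) (hgood : IsGood D V₀)
    (hZ : ∀ θ ∈ zeroSet D V₀, θ ∈ D ∧ radial V₀ θ ≠ 0) (hhyp : IsHyperbolic D V₀)
    (hF : IsPolarTerm d R D V₁ F) (hR : 0 < R) {θ : Euc n} (hθ : θ ∈ zeroSetPos D V₀)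
    {O : Set (Euc n)} (hO : O ⊆ D)
    {x : ℝ → Euc n} {a b : EReal} (hx : IsSolution (V₀ + V₁) O x a b)
    (hlim : TendsToOrigin x (initialEnd a) θ) {X : ℝ → Euc n} {s₀ K₀ : ℝ}
    (hX : IsLogCurve (V₀ + V₁) D s₀ θ X)
    (hXK : ∀ s < s₀, ‖Real.exp (-s) • X s - θ‖ ≤ K₀ * Real.exp s) :
    ∀ᶠ t in initialEnd a, x t = X (Real.log ‖x t‖) := by
  obtain ⟨-, hθD, hr, hs⟩ := (mem_zeroSetPos_iff h hZ).1 hθ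
  obtain ⟨K, ρ, δ, hb⟩ := exists_isPolarBall h hF hR hθD hr
  obtain ⟨t₁, ht₁, ha⟩ := hb.exists_isPolarArc h hF hO hx hlim
  obtain ⟨P, H, c, hP⟩ := exists_isTransverseForm_slope h hZ hhyp hθ
  obtain ⟨C, hC, hPC⟩ := hP.norm_le_mul_norm_proj hhyp.submanifold_pos
    (isCompact_zeroSetPos h hgood hZ) hθ (fun z hz => ((mem_zeroSetPos_iff h hZ).1 hz).2.2.2)
    ((h.contDiffAt_slope hθD hr.ne').hasStrictFDerivAt (by simp))
  obtain ⟨K', hK', hdec⟩ := ha.exists_slope_le h hb hP hC hPC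
  have hsub := ha.exists_norm_sub_le hb hK' hdec
  obtain ⟨H₁, c₁, hH₁⟩ := hP.exists_isAdaptedForm
  set s₁ := min s₀ (Real.log R) with hs₁
  have heq := ha.eventually_eq h hb hH₁ hsub (Θ := fun s => Real.exp (-s) • X s) (s₁ := s₁)
    (K₂ := K₀)
    (fun s hs => hX.hasDerivAt_direction h hF (hs.trans_le (min_le_left _ _))
      ((Real.lt_log_iff_exp_lt hR).1 (hs.trans_le (min_le_right _ _))))
    (fun s hs => hXK s (hs.trans_le (min_le_left _ _)))
  filter_upwards [heq, ha.eventually] with t h1 h2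
  have h3 := (ha.r_mem t h2.1 h2.2).1
  rw [Real.exp_neg, Real.exp_log h3] at h1
  exact smul_right_injective _ (inv_pos.2 h3).ne' h1

/-- Existence of the regular solutions that come out of the origin in the directions of `Z₊`, and
their continuous dependence on the direction. -/
theorem IsPolarBall.exists_family (h : IsHomogeneousField d D V₀)
    {θ : Euc n} {K ρ δ : ℝ} (hb : IsPolarBall D V₀ F R θ K ρ δ) {H : Euc n →L[ℝ] Euc n} {c : ℝ}
    (hH : IsAdaptedForm (fderiv ℝ (slope V₀) θ) H c) {Z : Set (Euc n)}
    (hZ0 : ∀ z ∈ Z, slope V₀ z = 0) :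
    ∃ δ₁ > 0, ∃ (s₁ K₁ : ℝ) (Θ : ℝ × ↥(Z ∩ Metric.ball θ δ₁) → Euc n), Continuous Θ ∧
      ∀ z, ∀ s < s₁, HasDerivAt (fun s => Θ (s, z)) (polarField V₀ F (Real.exp s) (Θ (s, z))) s ∧
        ‖Θ (s, z) - z‖ ≤ K₁ * Real.exp s ∧ Θ (s, z) ∈ Metric.ball θ δ ∧ Real.exp s ≤ ρ := by
  obtain ⟨M, hM, hexp⟩ := hH.exists_exp_bound
  set B := fderiv ℝ (slope V₀) θ with hB
  have hK := hb.K_nonneg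
  -- The conditions of `exists_bounded_solution` become equalities: 2Mη = 1/2, and ηb = K, so 2M(K +
  -- ηb) = b.
  set η := 1 / (4 * M) with hη
  set b := 4 * M * K with hbdef
  have hb0 : 0 ≤ b := by positivity
  obtain ⟨ρ', hρ', δ', hδ', hρρ, hδδ, hst⟩ := hb.exists_strict h (show 0 < η by positivity)
  set ε := min ρ' (δ' / (2 * (b + 1))) with hε
  have hε0 : 0 < ε := by positivity
  set s₁ := Real.log ε with hs₁
  have hmin : ∀ s : ℝ, Real.exp (min s s₁) ≤ ε := fun s => by
    rw [← Real.le_log_iff_exp_le hε0]; exact min_le_right _ _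
  have hεb : ε * b < δ' / 2 := by
    have h1 : ε ≤ δ' / (2 * (b + 1)) := min_le_right _ _
    rw [le_div_iff₀ (by positivity)] at h1
    nlinarith
  let S := ↥(Z ∩ Metric.ball θ (δ' / 2))
  -- The equation for v, where Θ = z + e^s v, has B - 1 as its linear part and m as its remainder.
  -- The cutoff min s s₁ freezes the remainder for s ≥ s₁, so that it is defined and small on the
  -- whole line; only s < s₁ is used.
  let m : ℝ × S → Euc n → Euc n := fun p v => Real.exp (-min p.1 s₁) •
    (polarField V₀ F (Real.exp (min p.1 s₁)) (p.2 + Real.exp (min p.1 s₁) • v) -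
      B (Real.exp (min p.1 s₁) • v))
  have hr : ∀ s : ℝ, Real.exp (min s s₁) ∈ Icc 0 ρ' := fun s =>
    ⟨(Real.exp_pos _).le, (hmin s).trans (min_le_left _ _)⟩
  have hball : ∀ (p : ℝ × S) (v : Euc n), ‖v‖ ≤ b →
      (p.2 : Euc n) + Real.exp (min p.1 s₁) • v ∈ Metric.ball θ δ' := fun p v hv => by
    rw [mem_ball_iff_norm]
    have h1 : ‖(p.2 : Euc n) - θ‖ < δ' / 2 := mem_ball_iff_norm.1 p.2.2.2
    have h2 : ‖Real.exp (min p.1 s₁) • v‖ ≤ ε * b := by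
      rw [norm_smul, Real.norm_of_nonneg (Real.exp_pos _).le]
      exact mul_le_mul (hmin _) hv (norm_nonneg _) hε0.le
    calc ‖(p.2 : Euc n) + Real.exp (min p.1 s₁) • v - θ‖
        = ‖((p.2 : Euc n) - θ) + Real.exp (min p.1 s₁) • v‖ := by congr 1; abel
      _ ≤ _ := norm_add_le _ _
      _ < δ' := by linarith
  have hcont : ContinuousOn (fun p : (ℝ × S) × Euc n => m p.1 p.2) {p | ‖p.2‖ ≤ b} := by
    have hexpc : Continuous fun p : (ℝ × S) × Euc n => Real.exp (min p.1.1 s₁) := by fun_prop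
    have hzc : Continuous fun p : (ℝ × S) × Euc n => (p.1.2 : Euc n) :=
      continuous_subtype_val.comp (continuous_snd.comp continuous_fst)
    have h1 : Continuous fun p : (ℝ × S) × Euc n => Real.exp (min p.1.1 s₁) • p.2 :=
      hexpc.smul continuous_snd
    have hnegc : Continuous fun p : (ℝ × S) × Euc n => Real.exp (-min p.1.1 s₁) := by fun_prop
    have h2 : ContinuousOn (fun p : (ℝ × S) × Euc n => polarField V₀ F (Real.exp (min p.1.1 s₁))
        (p.1.2 + Real.exp (min p.1.1 s₁) • p.2)) {p | ‖p.2‖ ≤ b} :=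
      ContinuousOn.comp (g := fun q : ℝ × Euc n => polarField V₀ F q.1 q.2)
        (f := fun p : (ℝ × S) × Euc n =>
          (Real.exp (min p.1.1 s₁), (p.1.2 : Euc n) + Real.exp (min p.1.1 s₁) • p.2))
        hb.continuousOn (hexpc.prodMk (hzc.add h1)).continuousOn fun p hp =>
          ⟨Icc_subset_Icc_right hρρ (hr _), Metric.ball_subset_ball hδδ (hball _ _ hp)⟩
    exact hnegc.continuousOn.smul (h2.sub (B.continuous.comp h1).continuousOn)
  have hinv : ∀ s : ℝ, Real.exp (-s) * Real.exp s = 1 := fun s => by rw [← Real.exp_add]; simp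
  have hlip : ∀ p v w, ‖v‖ ≤ b → ‖w‖ ≤ b → ‖m p v - m p w‖ ≤ η * ‖v - w‖ := fun p v w hv hw => by
    have h1 := hst _ (hr p.1) _ (hball p v hv) _ (hball p w hw)
    simp only [m]
    rw [← smul_sub, norm_smul, Real.norm_of_nonneg (Real.exp_pos _).le]
    set e := Real.exp (min p.1 s₁) with he
    have h2 : (p.2 : Euc n) + e • v - (p.2 + e • w) = e • (v - w) := by rw [smul_sub]; abel
    rw [h2, norm_smul, Real.norm_of_nonneg (Real.exp_pos _).le] at h1
    have h3 : polarField V₀ F e (p.2 + e • v) - B (e • v) -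
        (polarField V₀ F e (p.2 + e • w) - B (e • w)) =
        polarField V₀ F e (p.2 + e • v) - polarField V₀ F e (p.2 + e • w) - B (e • (v - w)) := by
      rw [smul_sub, map_sub]; abel
    rw [h3]
    calc _ ≤ Real.exp (-min p.1 s₁) * (η * (e * ‖v - w‖)) := by gcongr
      _ = (Real.exp (-min p.1 s₁) * e) * (η * ‖v - w‖) := by ring
      _ = _ := by rw [hinv, one_mul]
  have hm0 : ∀ p, ‖m p 0‖ ≤ K := fun p => by
    simp only [m, smul_zero, add_zero, map_zero, sub_zero]
    rw [norm_smul, Real.norm_of_nonneg (Real.exp_pos _).le]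
    have h1 := hball p 0 (by simpa using hb0)
    rw [smul_zero, add_zero] at h1
    have h2 := hb.norm_sub_slope_le _ (Icc_subset_Icc_right hρρ (hr p.1)) _
      (Metric.ball_subset_ball hδδ h1)
    rw [hZ0 _ p.2.2.1, sub_zero] at h2
    calc _ ≤ Real.exp (-min p.1 s₁) * (K * Real.exp (min p.1 s₁)) := by gcongr
      _ = (Real.exp (-min p.1 s₁) * Real.exp (min p.1 s₁)) * K := by ring
      _ = K := by rw [hinv, one_mul]
  obtain ⟨v, hvc, hvb, hvd⟩ := exists_bounded_solution hexp m hb0 (show 0 ≤ η by positivity)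
    hcont hlip hm0 (by rw [hη, hbdef]; field_simp; linarith) (by rw [hη]; field_simp; norm_num)
  refine ⟨δ' / 2, by positivity, s₁, b, fun p => p.2 + Real.exp p.1 • v p, ?_, fun z s hs => ?_⟩
  · exact (continuous_subtype_val.comp continuous_snd).add
      ((Real.continuous_exp.comp continuous_fst).smul hvc)
  have hs' : min s s₁ = s := min_eq_left hs.le
  refine ⟨?_, ?_, ?_, ?_⟩
  · have h1 := (((Real.hasDerivAt_exp s).smul (hvd s z)).const_add (z : Euc n))
    refine HasDerivAt.congr_deriv h1 ?_
    have h2 : m (s, z) (v (s, z)) = Real.exp (-s) •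
        (polarField V₀ F (Real.exp s) (z + Real.exp s • v (s, z)) - B (Real.exp s • v (s, z))) := by
      simp only [m, hs']
    rw [h2, _root_.sub_apply, one_apply_eq_self, smul_add, smul_smul, ← Real.exp_add, smul_sub,
      map_smul]
    simp
  · simp only [add_sub_cancel_left]
    rw [norm_smul, Real.norm_of_nonneg (Real.exp_pos _).le, mul_comm]
    gcongr
    exact hvb _
  · have h1 := hball (s, z) (v (s, z)) (hvb _)
    simp only [hs'] at h1
    exact Metric.ball_subset_ball hδδ h1
  · have h1 := (hr s).2.trans hρρ
    rwa [hs'] at h1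

end LogCurves

/-! ### Continuation along solution curves and change of time -/

section Continuation

variable {n : ℕ} {D O : Set (Euc n)} {V : Euc n → Euc n} {s₀ : ℝ} {θ : Euc n} {X : ℝ → Euc n}
  {x : ℝ → Euc n} {a b : EReal}

theorem isOpen_setOf_between (a b : EReal) : IsOpen {t : ℝ | a < t ∧ t < b} :=
  (isOpen_Ioi.preimage continuous_coe_real_ereal).inter
    (isOpen_Iio.preimage continuous_coe_real_ereal)

theorem isPreconnected_setOf_between (a b : EReal) : IsPreconnected {t : ℝ | a < t ∧ t < b} := by
  refine OrdConnected.isPreconnected ⟨fun s hs t ht u hu => ⟨?_, ?_⟩⟩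
  · exact hs.1.trans_le (EReal.coe_le_coe_iff.2 hu.1)
  · exact (EReal.coe_le_coe_iff.2 hu.2).trans_lt ht.2

/-- Both x(t) and X(log ‖x(t)‖) solve y' = rate(x(t)) · V(y)/rate(y), so local uniqueness applies.
The bound s₀ may depend on the point, which admits rays in an unbounded O. -/
theorem eventually_eq_of_isLogCurve
    (hX : ∀ y ∈ O, ∃ s₀, Real.log ‖y‖ < s₀ ∧ IsLogCurve V D s₀ θ X)
    (hV : ∀ y ∈ O, ContDiffAt ℝ 1 V y) (h0 : ∀ y ∈ O, y ≠ 0) (hx : IsSolution V O x a b)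
    {t₀ : ℝ} (h1 : a < t₀) (h2 : t₀ < b)
    (heq : x t₀ = X (Real.log ‖x t₀‖)) : ∀ᶠ t in 𝓝 t₀, x t = X (Real.log ‖x t‖) := by
  have hpos' : ∀ t : ℝ, a < t → t < b → 0 < rate V (X (Real.log ‖x t‖)) := fun t ht1 ht2 => by
    obtain ⟨s₀, hs, hX⟩ := hX _ (hx.2 t ht1 ht2).1
    exact hX.rate_pos _ hs
  have hderX : ∀ t : ℝ, a < t → t < b → HasDerivAt X
      ((rate V (X (Real.log ‖x t‖)))⁻¹ • V (X (Real.log ‖x t‖))) (Real.log ‖x t‖) :=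
    fun t ht1 ht2 => by
      obtain ⟨s₀, hs, hX⟩ := hX _ (hx.2 t ht1 ht2).1
      exact hX.deriv _ hs
  have hne : x t₀ ≠ 0 := h0 _ (hx.2 t₀ h1 h2).1
  have hVx := hV _ (hx.2 t₀ h1 h2).1
  have hnear : ∀ᶠ t : ℝ in 𝓝 t₀, a < t ∧ t < b := (isOpen_setOf_between a b).mem_nhds ⟨h1, h2⟩
  have hrate : ContDiffAt ℝ 1 (rate V) (x t₀) :=
    (hVx.inner ℝ contDiffAt_id).div (contDiffAt_id.norm_sq ℝ)
      (pow_ne_zero 2 (norm_ne_zero_iff.2 hne))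
  have hpos : 0 < rate V (x t₀) := by
    rw [heq]; exact hpos' t₀ h1 h2
  have hU : ContDiffAt ℝ 1 (fun y => (rate V y)⁻¹ • V y) (x t₀) := (hrate.inv hpos.ne').smul hVx
  obtain ⟨L, S, hS, hL⟩ := hU.exists_lipschitzOnWith
  have hxc : ContinuousAt x t₀ := (hx.2 t₀ h1 h2).2.continuousAt
  have hrc : ContinuousAt (fun t => rate V (x t)) t₀ := hrate.continuousAt.comp hxc
  have hder : ∀ t : ℝ, a < t → t < b →
      HasDerivAt (fun t => Real.log ‖x t‖) (rate V (x t)) t := fun t ht1 ht2 => by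
    have h3 := h0 _ (hx.2 t ht1 ht2).1
    have h4 := (hasDerivAt_norm (hx.2 t ht1 ht2).2 h3).log (norm_ne_zero_iff.2 h3)
    rwa [mul_div_cancel_right₀ _ (norm_ne_zero_iff.2 h3)] at h4
  have hg : ∀ t : ℝ, a < t → t < b → HasDerivAt (fun t => X (Real.log ‖x t‖))
      (rate V (x t) • (rate V (X (Real.log ‖x t‖)))⁻¹ • V (X (Real.log ‖x t‖))) t :=
    fun t ht1 ht2 => (hderX t ht1 ht2).scomp t (hder t ht1 ht2)
  refine ODE_solution_unique_of_eventually
    (v := fun t y => rate V (x t) • (rate V y)⁻¹ • V y) (s := fun _ => S)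
    (K := (rate V (x t₀) + 1).toNNReal * L) ?_ ?_ ?_ heq
  · filter_upwards [hrc.eventually_lt_const (lt_add_one _), hrc.eventually_const_lt hpos]
      with t ht ht'
    refine LipschitzOnWith.of_dist_le_mul fun y hy z hz => ?_
    rw [dist_smul₀, NNReal.coe_mul, Real.coe_toNNReal _ (by positivity), mul_assoc]
    refine mul_le_mul ?_ (hL.dist_le_mul y hy z hz) dist_nonneg (by positivity)
    rw [Real.norm_of_nonneg ht'.le]
    exact ht.le
  · filter_upwards [hnear, hrc.eventually_const_lt hpos, hxc.eventually hS] with t ht ht' htS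
    refine ⟨HasDerivAt.congr_deriv (hx.2 t ht.1 ht.2).2 ?_, htS⟩
    rw [smul_inv_smul₀ ht'.ne']
  · have hgS : ∀ᶠ t in 𝓝 t₀, X (Real.log ‖x t‖) ∈ S := (hg t₀ h1 h2).continuousAt.eventually (by
      change ∀ᶠ y in 𝓝 (X (Real.log ‖x t₀‖)), y ∈ S
      rw [← heq]; exact hS)
    filter_upwards [hnear, hgS] with t ht htS
    exact ⟨hg t ht.1 ht.2, htS⟩

/-- A solution that meets a given regular solution stays on it. -/
theorem eq_of_isLogCurve
    (hX : ∀ y ∈ O, ∃ s₀, Real.log ‖y‖ < s₀ ∧ IsLogCurve V D s₀ θ X)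
    (hV : ∀ y ∈ O, ContDiffAt ℝ 1 V y) (h0 : ∀ y ∈ O, y ≠ 0) (hx : IsSolution V O x a b)
    {t₀ : ℝ} (h1 : a < t₀) (h2 : t₀ < b)
    (heq : x t₀ = X (Real.log ‖x t₀‖)) {t : ℝ} (ht1 : a < t) (ht2 : t < b) :
    x t = X (Real.log ‖x t‖) := by
  set u := interior {t : ℝ | x t = X (Real.log ‖x t‖)} with hu
  have hloc : ∀ t : ℝ, a < t → t < b → x t = X (Real.log ‖x t‖) → t ∈ u := fun t h3 h4 h5 =>
    mem_interior_iff_mem_nhds.2 (eventually_eq_of_isLogCurve hX hV h0 hx h3 h4 h5)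
  -- The coincidence set is relatively closed by continuity and open by local uniqueness, and the
  -- interval is connected.
  have hsub : {t : ℝ | a < t ∧ t < b} ⊆ u := by
    refine (isPreconnected_setOf_between a b).subset_of_closure_inter_subset isOpen_interior
      ⟨t₀, ⟨h1, h2⟩, hloc t₀ h1 h2 heq⟩ ?_
    rintro s ⟨hs, hs1, hs2⟩
    refine hloc s hs1 hs2 ?_
    have hxc : ContinuousAt x s := (hx.2 s hs1 hs2).2.continuousAt
    have hc : ContinuousAt (fun t => X (Real.log ‖x t‖)) s := by
      obtain ⟨s₀, hs₀, hX⟩ := hX _ (hx.2 s hs1 hs2).1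
      refine ContinuousAt.comp (g := X) (hX.deriv _ hs₀).continuousAt ?_
      exact hxc.norm.log (norm_ne_zero_iff.2 (h0 _ (hx.2 s hs1 hs2).1))
    have : (𝓝[u] s).NeBot := mem_closure_iff_nhdsWithin_neBot.1 hs
    refine tendsto_nhds_unique (hxc.tendsto.mono_left (nhdsWithin_le_nhds (s := u))) ?_
    refine (hc.tendsto.mono_left (nhdsWithin_le_nhds (s := u))).congr' ?_
    filter_upwards [self_mem_nhdsWithin] with r hr
    have : r ∈ {t : ℝ | x t = X (Real.log ‖x t‖)} := interior_subset hr
    exact (this : x r = X (Real.log ‖x r‖)).symm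
  have : t ∈ {t : ℝ | x t = X (Real.log ‖x t‖)} := interior_subset (hsub ⟨ht1, ht2⟩)
  exact this

/-- A regular solution is, up to the choice of the time, a solution curve that comes out of the
origin. -/
theorem IsLogCurve.isOutgoing (hX : IsLogCurve V D s₀ θ X)
    (hV : ContinuousOn V (truncated D (Real.exp s₀))) :
    IsOutgoing V (truncated D (Real.exp s₀)) θ (X '' Iio s₀) := by
  set c : ℝ → ℝ := fun s => (rate V (X s))⁻¹ with hc
  have hXc : ContinuousOn X (Iio s₀) := fun s hs =>
    (hX.deriv s hs).continuousAt.continuousWithinAt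
  have hXt : MapsTo X (Iio s₀) (truncated D (Real.exp s₀)) := fun s hs => by
    refine ⟨hX.mem s hs, ?_⟩
    rw [mem_ball_zero_iff, hX.norm s hs]
    exact Real.exp_lt_exp.2 hs
  have hcc : ContinuousOn c (Iio s₀) := by
    have hVX : ContinuousOn (fun s => V (X s)) (Iio s₀) := hV.comp hXc hXt
    refine ContinuousOn.inv₀ ?_ fun s hs => (hX.rate_pos s hs).ne'
    refine (hVX.inner hXc).div (hXc.norm.pow 2) fun s hs => ?_
    rw [hX.norm s hs]
    exact pow_ne_zero 2 (Real.exp_pos s).ne'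
  have hcpos : ∀ s < s₀, 0 < c s := fun s hs => inv_pos.2 (hX.rate_pos s hs)
  -- The original time as a function of s, with dt/ds = 1/rate; the base point s₀ - 1 is arbitrary.
  -- Its inverse τ reparametrizes X, and its infimum and supremum, possibly infinite, are the end
  -- times.
  set f : ℝ → ℝ := fun s => ∫ u in (s₀ - 1)..s, c u with hf
  have hfd : ∀ s < s₀, HasDerivAt f (c s) s := fun s hs => by
    refine intervalIntegral.integral_hasDerivAt_right
      (ContinuousOn.intervalIntegrable (hcc.mono ?_))
      (hcc.stronglyMeasurableAtFilter isOpen_Iio s hs) (hcc.continuousAt (Iio_mem_nhds hs))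
    intro u hu
    have h1 : max (s₀ - 1) s < s₀ := max_lt (by linarith) hs
    exact lt_of_le_of_lt hu.2 h1
  have hfc : ContinuousOn f (Iio s₀) := fun s hs => (hfd s hs).continuousAt.continuousWithinAt
  have hmono : StrictMonoOn f (Iio s₀) := by
    refine strictMonoOn_of_deriv_pos (convex_Iio s₀) hfc fun s hs => ?_
    rw [interior_Iio] at hs
    rw [(hfd s hs).deriv]
    exact hcpos s hs
  set a : EReal := sInf ((fun s => (f s : EReal)) '' Iio s₀) with ha
  set b : EReal := sSup ((fun s => (f s : EReal)) '' Iio s₀) with hb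
  have hle : ∀ s < s₀, a ≤ f s ∧ f s ≤ b := fun s hs =>
    have hs' : (f s : EReal) ∈ (fun s => (f s : EReal)) '' Iio s₀ := mem_image_of_mem _ hs
    ⟨sInf_le hs', le_sSup hs'⟩
  have hab : ∀ s < s₀, a < f s ∧ f s < b := fun s hs => by
    constructor
    · have h1 : s - 1 < s₀ := by linarith
      exact (hle _ h1).1.trans_lt
        (EReal.coe_lt_coe_iff.2 (hmono h1 hs (by linarith)))
    · have h1 : (s + s₀) / 2 < s₀ := by linarith
      exact (EReal.coe_lt_coe_iff.2 (hmono hs h1 (by linarith))).trans_le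
        (hle _ h1).2
  have hsurj : ∀ t : ℝ, a < t → t < b → t ∈ f '' Iio s₀ := fun t h1 h2 => by
    obtain ⟨-, ⟨s₁, hs₁, rfl⟩, h3⟩ := sInf_lt_iff.1 h1
    obtain ⟨-, ⟨s₂, hs₂, rfl⟩, h4⟩ := lt_sSup_iff.1 h2
    exact isPreconnected_Iio.intermediate_value hs₁ hs₂ hfc
      ⟨(EReal.coe_lt_coe_iff.1 h3).le, (EReal.coe_lt_coe_iff.1 h4).le⟩
  set τ : ℝ → ℝ := Function.invFunOn f (Iio s₀) with hτ
  have hτmem : ∀ t : ℝ, a < t → t < b → τ t < s₀ := fun t h1 h2 =>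
    Function.invFunOn_mem (hsurj t h1 h2)
  have hfτ : ∀ t : ℝ, a < t → t < b → f (τ t) = t := fun t h1 h2 =>
    Function.invFunOn_eq (hsurj t h1 h2)
  have hτf : ∀ s < s₀, τ (f s) = s := fun s hs =>
    hmono.injOn (hτmem _ (hab s hs).1 (hab s hs).2) hs (hfτ _ (hab s hs).1 (hab s hs).2)
  have hlt : ∀ t : ℝ, a < t → t < b → ∀ s < s₀, t < f s → τ t < s := fun t h1 h2 s hs h3 => by
    rw [← hmono.lt_iff_lt (hτmem t h1 h2) hs, hfτ t h1 h2]; exact h3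
  have hgt : ∀ t : ℝ, a < t → t < b → ∀ s < s₀, f s < t → s < τ t := fun t h1 h2 s hs h3 => by
    rw [← hmono.lt_iff_lt hs (hτmem t h1 h2), hfτ t h1 h2]; exact h3
  have hnear : ∀ t : ℝ, a < t → t < b → ∀ᶠ t' : ℝ in 𝓝 t, a < t' ∧ t' < b := fun t h1 h2 =>
    (isOpen_setOf_between a b).mem_nhds ⟨h1, h2⟩
  have hτc : ∀ t : ℝ, a < t → t < b → ContinuousAt τ t := fun t h1 h2 => by
    have h3 := hτmem t h1 h2
    have h4 := hfτ t h1 h2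
    refine tendsto_order.2 ⟨fun l hl => ?_, fun u hu => ?_⟩
    · have h5 : f l < t := by
        have := hmono (hl.trans h3) h3 hl
        rwa [h4] at this
      filter_upwards [hnear t h1 h2, lt_mem_nhds h5] with t' ht' h6
      exact hgt t' ht'.1 ht'.2 l (hl.trans h3) h6
    · have h6 : min u ((τ t + s₀) / 2) < s₀ := (min_le_right _ _).trans_lt (by linarith)
      have h7 : τ t < min u ((τ t + s₀) / 2) := lt_min hu (by linarith)
      have h5 : t < f (min u ((τ t + s₀) / 2)) := by
        have := hmono h3 h6 h7
        rwa [h4] at this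
      filter_upwards [hnear t h1 h2, gt_mem_nhds h5] with t' ht' h8
      exact (hlt t' ht'.1 ht'.2 _ h6 h8).trans_le (min_le_left _ _)
  have hτd : ∀ t : ℝ, a < t → t < b → HasDerivAt τ (c (τ t))⁻¹ t := fun t h1 h2 =>
    HasDerivAt.of_local_left_inverse (hτc t h1 h2) (hfd _ (hτmem t h1 h2))
      (hcpos _ (hτmem t h1 h2)).ne' ((hnear t h1 h2).mono fun t' ht' => hfτ t' ht'.1 ht'.2)
  have hablt : a < b := by
    have := hab (s₀ - 1) (by linarith)
    exact this.1.trans this.2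
  have hτbot : Tendsto τ (initialEnd a) atBot := by
    refine tendsto_atBot.2 fun M => ?_
    have h1 : min M (s₀ - 1) < s₀ := (min_le_right _ _).trans_lt (by linarith)
    refine (eventually_initialEnd_iff (hablt.trans_le le_top)).2
      ⟨f (min M (s₀ - 1)), (hab _ h1).1, fun t ht1 ht2 => ?_⟩
    exact (hlt t ht1 ((EReal.coe_lt_coe_iff.2 ht2).trans (hab _ h1).2) _ h1 ht2).le.trans
      (min_le_left _ _)
  have hev : ∀ᶠ t : ℝ in initialEnd a, a < t ∧ t < b := by
    have h1 : s₀ - 1 < s₀ := by linarith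
    exact (eventually_initialEnd_iff (hablt.trans_le le_top)).2 ⟨f (s₀ - 1), (hab _ h1).1,
      fun t ht1 ht2 => ⟨ht1, (EReal.coe_lt_coe_iff.2 ht2).trans (hab _ h1).2⟩⟩
  refine ⟨X ∘ τ, a, b, ⟨hablt, fun t h1 h2 => ⟨hXt (hτmem t h1 h2), ?_⟩⟩,
    ⟨?_, ?_⟩, ?_⟩
  · have h3 := (hX.deriv _ (hτmem t h1 h2)).scomp t (hτd t h1 h2)
    refine HasDerivAt.congr_deriv h3 ?_
    simp only [hc, inv_inv, Function.comp_apply]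
    rw [smul_inv_smul₀ (hX.rate_pos _ (hτmem t h1 h2)).ne']
  · refine (Real.tendsto_exp_atBot.comp hτbot).congr' ?_
    filter_upwards [hev] with t ht
    exact (hX.norm _ (hτmem t ht.1 ht.2)).symm
  · refine (hX.lim.comp hτbot).congr' ?_
    filter_upwards [hev] with t ht
    rw [Function.comp_apply, Function.comp_apply, hX.norm _ (hτmem t ht.1 ht.2), Real.exp_neg]
  · ext y
    constructor
    · rintro ⟨s, hs, rfl⟩
      exact ⟨f s, hab s hs, by rw [Function.comp_apply, hτf s hs]⟩
    · rintro ⟨t, ht, rfl⟩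
      exact ⟨τ t, hτmem t ht.1 ht.2, rfl⟩

end Continuation

/-! ### Smoothness of the perturbed field off the origin -/

section Smoothness

variable {n : ℕ} {d R : ℝ} {D : Set (Euc n)} {V₀ V₁ : Euc n → Euc n} {F : ℝ × Euc n → Euc n}

/-- V₁ is given only through F, so smoothness is read off the polar formula for V₀ + V₁, which holds
in a whole neighbourhood. -/
theorem contDiffAt_add_of_isPolarTerm (h : IsHomogeneousField d D V₀)
    (hF : IsPolarTerm d R D V₁ F) {x : Euc n} (hx : x ∈ truncated D R) :
    ContDiffAt ℝ 1 (V₀ + V₁) x := by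
  have hxR : ‖x‖ < R := by simpa using hx.2
  have hx0 := h.isOpenCone.ne_zero hx.1
  have hr : 0 < ‖x‖ := norm_pos_iff.2 hx0
  have hn : ContDiffAt ℝ 1 (fun y : Euc n => ‖y‖) x := contDiffAt_norm ℝ hx0
  have hdir : ContDiffAt ℝ 1 (fun y : Euc n => ‖y‖⁻¹ • y) x := (hn.inv hr.ne').smul contDiffAt_id
  have hθ := h.isOpenCone.direction_mem hx.1
  have hFd : ContDiffAt ℝ 1 F (‖x‖, ‖x‖⁻¹ • x) :=
    (hF.contDiffOn.contDiffAt (prod_mem_nhds (Ico_mem_nhds hr hxR)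
      (h.isOpenCone.isOpen.mem_nhds hθ))).of_le (by simp)
  have h1 : ContDiffAt ℝ 1 (fun y : Euc n => F (‖y‖, ‖y‖⁻¹ • y)) x :=
    ContDiffAt.comp (g := F) (f := fun y : Euc n => (‖y‖, ‖y‖⁻¹ • y)) x hFd (hn.prodMk hdir)
  have h2 : ContDiffAt ℝ 1 (fun y : Euc n => V₀ (‖y‖⁻¹ • y)) x :=
    ContDiffAt.comp (g := V₀) (f := fun y : Euc n => ‖y‖⁻¹ • y) x
      ((h.contDiffAt hθ).of_le (by simp)) hdir
  have h3 : ContDiffAt ℝ 1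
      (fun y : Euc n => ‖y‖ ^ d • profile V₀ F ‖y‖ (‖y‖⁻¹ • y)) x :=
    (hn.rpow_const_of_ne hr.ne').smul (h2.add (hn.smul h1))
  refine h3.congr_of_eventuallyEq ?_
  filter_upwards [(h.isOpenCone.isOpen.inter Metric.isOpen_ball).mem_nhds hx] with y hy
  exact field_eq h hF hy.1 (by simpa using hy.2)

end Smoothness

/-! ### The family of regular solutions over all of Z₊ -/

section Family

variable {n : ℕ} {d R : ℝ} {D : Set (Euc n)} {V₀ V₁ : Euc n → Euc n} {F : ℝ × Euc n → Euc n}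

/-- Every solution curve that comes out of the origin in a direction of `Z₊` is contained in the
regular one. -/
theorem eq_of_mem_isOutgoing (h : IsHomogeneousField d D V₀) (hgood : IsGood D V₀)
    (hZ : ∀ θ ∈ zeroSet D V₀, θ ∈ D ∧ radial V₀ θ ≠ 0) (hhyp : IsHyperbolic D V₀)
    (hF : IsPolarTerm d R D V₁ F) (hR : 0 < R) {θ : Euc n} (hθ : θ ∈ zeroSetPos D V₀)
    {O : Set (Euc n)} (hO : O ⊆ D) (hV : ∀ y ∈ O, ContDiffAt ℝ 1 (V₀ + V₁) y)
    {X : ℝ → Euc n} {s₀ K₀ : ℝ}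
    (hX : ∀ y ∈ O, ∃ s₁, Real.log ‖y‖ < s₁ ∧ IsLogCurve (V₀ + V₁) D s₁ θ X)
    (hXK : ∀ s < s₀, ‖Real.exp (-s) • X s - θ‖ ≤ K₀ * Real.exp s) {γ : Set (Euc n)}
    (hγ : IsOutgoing (V₀ + V₁) O θ γ) {y : Euc n} (hy : y ∈ γ) : y = X (Real.log ‖y‖) := by
  obtain ⟨x, a, b, hx, hlim, rfl⟩ := hγ
  obtain ⟨t, ht, rfl⟩ := hy
  obtain ⟨s₁, -, hX₁⟩ := hX _ (hx.2 t ht.1 ht.2).1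
  have h1 := eventually_eq_isLogCurve h hgood hZ hhyp hF hR hθ hO hx hlim
    (hX₁.mono (min_le_right s₀ s₁)) (fun s hs => hXK s (hs.trans_le (min_le_left _ _)))
  have ha : a < ⊤ := ht.1.trans (EReal.coe_lt_top t)
  have := initialEnd_neBot ha
  have h2 : ∀ᶠ t : ℝ in initialEnd a, a < t ∧ t < b := by
    obtain ⟨u, hu1, hu2⟩ := EReal.lt_iff_exists_real_btwn.1 hx.1
    exact (eventually_initialEnd_iff ha).2 ⟨u, hu1, fun t ht1 ht2 =>
      ⟨ht1, (EReal.coe_lt_coe_iff.2 ht2).trans hu2⟩⟩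
  obtain ⟨t₀, h3, h4⟩ := (h1.and h2).exists
  exact eq_of_isLogCurve hX hV (fun y hy => h.isOpenCone.ne_zero (hO hy)) hx h4.1 h4.2 h3 ht.1 ht.2

theorem log_norm_lt {s₀ : ℝ} (h : IsOpenCone D) {y : Euc n} (hy : y ∈ truncated D (Real.exp s₀)) :
    Real.log ‖y‖ < s₀ := by
  rw [Real.log_lt_iff_lt_exp (norm_pos_iff.2 (h.ne_zero hy.1))]
  simpa using hy.2

/-- A regular solution that meets another one coincides with it. -/
theorem IsLogCurve.eq_of_meets (hD : IsOpenCone D) {V : Euc n → Euc n} {s₀ : ℝ} {θ θ' : Euc n}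
    {X Y : ℝ → Euc n} (hX : IsLogCurve V D s₀ θ X) (hY : IsLogCurve V D s₀ θ' Y)
    (hV : ∀ y ∈ truncated D (Real.exp s₀), ContDiffAt ℝ 1 V y) {s : ℝ} (hs : s < s₀)
    (heq : X s = Y s) {t : ℝ} (ht : t < s₀) : X t = Y t := by
  obtain ⟨x, a, b, hx, -, hγ⟩ :=
    hX.isOutgoing fun y hy => (hV y hy).continuousAt.continuousWithinAt
  obtain ⟨u, hu, hus⟩ : X s ∈ x '' {t : ℝ | a < t ∧ t < b} := hγ ▸ mem_image_of_mem X hs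
  obtain ⟨v, hv, hvs⟩ : X t ∈ x '' {t : ℝ | a < t ∧ t < b} := hγ ▸ mem_image_of_mem X ht
  have h1 := eq_of_isLogCurve (t := v) (t₀ := u)
    (fun y hy => ⟨s₀, log_norm_lt hD hy, hY⟩) hV
    (fun y hy => hD.ne_zero hy.1) hx hu.1 hu.2 (by rw [hus, hX.norm s hs, Real.log_exp, heq])
    hv.1 hv.2
  rwa [hvs, hX.norm t ht, Real.log_exp] at h1

/-- Curves that meet coincide back to the origin, so their limit directions agree. This yields
injectivity of the cone map. -/
theorem IsLogCurve.direction_eq (hD : IsOpenCone D) {V : Euc n → Euc n} {s₀ : ℝ} {θ θ' : Euc n}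
    {X Y : ℝ → Euc n} (hX : IsLogCurve V D s₀ θ X) (hY : IsLogCurve V D s₀ θ' Y)
    (hV : ∀ y ∈ truncated D (Real.exp s₀), ContDiffAt ℝ 1 V y) {s : ℝ} (hs : s < s₀)
    (heq : X s = Y s) : θ = θ' := by
  refine tendsto_nhds_unique hX.lim (hY.lim.congr' ?_)
  filter_upwards [eventually_lt_atBot s₀] with t ht
  rw [hX.eq_of_meets hD hY hV hs heq ht]

/-- Regular solutions with the same direction coincide. -/
theorem IsLogCurve.eq (h : IsHomogeneousField d D V₀) (hgood : IsGood D V₀)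
    (hZ : ∀ θ ∈ zeroSet D V₀, θ ∈ D ∧ radial V₀ θ ≠ 0) (hhyp : IsHyperbolic D V₀)
    (hF : IsPolarTerm d R D V₁ F) (hR : 0 < R) {θ : Euc n} (hθ : θ ∈ zeroSetPos D V₀)
    {X Y : ℝ → Euc n} {s₀ K₀ : ℝ} (hs₀ : Real.exp s₀ ≤ R)
    (hX : IsLogCurve (V₀ + V₁) D s₀ θ X) (hY : IsLogCurve (V₀ + V₁) D s₀ θ Y)
    (hXK : ∀ s < s₀, ‖Real.exp (-s) • X s - θ‖ ≤ K₀ * Real.exp s) {s : ℝ} (hs : s < s₀) :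
    Y s = X s := by
  have hV : ∀ y ∈ truncated D (Real.exp s₀), ContDiffAt ℝ 1 (V₀ + V₁) y := fun y hy =>
    contDiffAt_add_of_isPolarTerm h hF ⟨hy.1, Metric.ball_subset_ball hs₀ hy.2⟩
  have h1 := eq_of_mem_isOutgoing h hgood hZ hhyp hF hR hθ inter_subset_left hV
    (fun y hy => ⟨s₀, log_norm_lt h.isOpenCone hy, hX⟩) hXK
    (hY.isOutgoing fun y hy => (hV y hy).continuousAt.continuousWithinAt) (mem_image_of_mem Y hs)
  rwa [hY.norm s hs, Real.log_exp] at h1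

theorem exists_local_family (h : IsHomogeneousField d D V₀)
    (hZ : ∀ θ ∈ zeroSet D V₀, θ ∈ D ∧ radial V₀ θ ≠ 0) (hhyp : IsHyperbolic D V₀)
    (hF : IsPolarTerm d R D V₁ F) (hR : 0 < R) {θ : Euc n} (hθ : θ ∈ zeroSetPos D V₀) :
    ∃ δ > 0, ∃ (s₁ K₁ : ℝ) (X : Euc n → ℝ → Euc n),
      ContinuousOn (fun p : ℝ × Euc n => X p.2 p.1)
        (Iio s₁ ×ˢ (zeroSetPos D V₀ ∩ Metric.ball θ δ)) ∧
      ∀ z ∈ zeroSetPos D V₀ ∩ Metric.ball θ δ, IsLogCurve (V₀ + V₁) D s₁ z (X z) ∧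
        ∀ s < s₁, ‖Real.exp (-s) • X z s - z‖ ≤ K₁ * Real.exp s := by
  classical
  obtain ⟨-, hθD, hr, hs⟩ := (mem_zeroSetPos_iff h hZ).1 hθ
  obtain ⟨K, ρ, δ, hb⟩ := exists_isPolarBall h hF hR hθD hr
  obtain ⟨P, H, c, hP⟩ := exists_isTransverseForm_slope h hZ hhyp hθ
  obtain ⟨H₁, c₁, hH₁⟩ := hP.exists_isAdaptedForm
  obtain ⟨δ₁, hδ₁, s₁, K₁, Θ, hΘc, hΘ⟩ := hb.exists_family h hH₁ (Z := zeroSetPos D V₀)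
    (fun z hz => ((mem_zeroSetPos_iff h hZ).1 hz).2.2.2)
  let X : Euc n → ℝ → Euc n := fun z s =>
    if hz : z ∈ zeroSetPos D V₀ ∩ Metric.ball θ δ₁ then Real.exp s • Θ (s, ⟨z, hz⟩) else 0
  have hXeq : ∀ (z : ↥(zeroSetPos D V₀ ∩ Metric.ball θ δ₁)),
      X z = fun s => Real.exp s • Θ (s, z) := fun z => by
    funext s
    simp only [X]
    rw [dif_pos z.2]
  refine ⟨δ₁, hδ₁, s₁, K₁, X, ?_, fun z hz => ?_⟩
  · refine ContinuousOn.mono (s := univ ×ˢ (zeroSetPos D V₀ ∩ Metric.ball θ δ₁)) ?_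
      (prod_mono_left (subset_univ _))
    rintro ⟨s, z⟩ ⟨-, hz⟩
    have hc : Continuous fun p : ℝ × ↥(zeroSetPos D V₀ ∩ Metric.ball θ δ₁) =>
        Real.exp p.1 • Θ p := (Real.continuous_exp.comp continuous_fst).smul hΘc
    have h1 : Tendsto (fun p : ℝ × ↥(zeroSetPos D V₀ ∩ Metric.ball θ δ₁) => X p.2 p.1)
        (𝓝 (s, ⟨z, hz⟩)) (𝓝 (X z s)) := by
      have h2 := hc.tendsto (s, ⟨z, hz⟩)
      have h3 := congrFun (hXeq ⟨z, hz⟩) s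
      simp only at h2 h3
      rw [h3]
      exact h2.congr fun p => by rw [hXeq]
    change Tendsto _ (𝓝[_] _) _
    rw [nhdsWithin_prod_eq, nhdsWithin_univ, nhdsWithin_eq_map_subtype_coe hz]
    rw [nhds_prod_eq] at h1
    have h4 : 𝓝 s ×ˢ map (Subtype.val : ↥(zeroSetPos D V₀ ∩ Metric.ball θ δ₁) → Euc n)
        (𝓝 ⟨z, hz⟩) = map (Prod.map id Subtype.val) (𝓝 s ×ˢ 𝓝 ⟨z, hz⟩) := by
      rw [← prod_map_map_eq', map_id]
    rw [h4, tendsto_map'_iff]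
    exact h1
  · have h2 := hXeq ⟨z, hz⟩
    simp only at h2
    rw [h2]
    refine ⟨hb.isLogCurve h hF (fun s hs => (hΘ ⟨z, hz⟩ s hs).1)
      (fun s hs => (hΘ ⟨z, hz⟩ s hs).2.1) (fun s hs => (hΘ ⟨z, hz⟩ s hs).2.2.1)
      (fun s hs => (hΘ ⟨z, hz⟩ s hs).2.2.2), fun s hs => ?_⟩
    rw [Real.exp_neg, inv_smul_smul₀ (Real.exp_pos s).ne']
    exact (hΘ ⟨z, hz⟩ s hs).2.1

/-- The regular solutions that come out of the origin in the directions of `Z₊`. -/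
theorem exists_global_family (h : IsHomogeneousField d D V₀) (hgood : IsGood D V₀)
    (hZ : ∀ θ ∈ zeroSet D V₀, θ ∈ D ∧ radial V₀ θ ≠ 0) (hhyp : IsHyperbolic D V₀)
    (hF : IsPolarTerm d R D V₁ F) (hR : 0 < R) :
    ∃ (s₀ K₀ : ℝ) (X : Euc n → ℝ → Euc n), Real.exp s₀ ≤ R ∧
      ContinuousOn (fun p : ℝ × Euc n => X p.2 p.1) (Iio s₀ ×ˢ zeroSetPos D V₀) ∧
      ∀ z ∈ zeroSetPos D V₀, IsLogCurve (V₀ + V₁) D s₀ z (X z) ∧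
        ∀ s < s₀, ‖Real.exp (-s) • X z s - z‖ ≤ K₀ * Real.exp s := by
  set Z := zeroSetPos D V₀ with hZdef
  have key : ∃ s₀ K₀ : ℝ, ∀ z ∈ Z, ∃ δ > 0, ∃ X : Euc n → ℝ → Euc n,
      ContinuousOn (fun p : ℝ × Euc n => X p.2 p.1) (Iio s₀ ×ˢ (Z ∩ Metric.ball z δ)) ∧
      ∀ z' ∈ Z ∩ Metric.ball z δ, IsLogCurve (V₀ + V₁) D s₀ z' (X z') ∧
        ∀ s < s₀, ‖Real.exp (-s) • X z' s - z'‖ ≤ K₀ * Real.exp s := by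
    refine (isCompact_zeroSetPos h hgood hZ).induction_on
      (p := fun S => ∃ s₀ K₀ : ℝ, ∀ z ∈ S, ∃ δ > 0, ∃ X : Euc n → ℝ → Euc n,
        ContinuousOn (fun p : ℝ × Euc n => X p.2 p.1) (Iio s₀ ×ˢ (Z ∩ Metric.ball z δ)) ∧
        ∀ z' ∈ Z ∩ Metric.ball z δ, IsLogCurve (V₀ + V₁) D s₀ z' (X z') ∧
          ∀ s < s₀, ‖Real.exp (-s) • X z' s - z'‖ ≤ K₀ * Real.exp s)
      ⟨0, 0, fun z hz => hz.elim⟩ ?_ ?_ ?_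
    · rintro S T hST ⟨s₀, K₀, hT⟩
      exact ⟨s₀, K₀, fun z hz => hT z (hST hz)⟩
    · rintro S T ⟨s₁, K₁, hS⟩ ⟨s₂, K₂, hT⟩
      refine ⟨min s₁ s₂, max K₁ K₂, fun z hz => ?_⟩
      have aux : ∀ s K, min s₁ s₂ ≤ s → K ≤ max K₁ K₂ →
          (∃ δ > 0, ∃ X : Euc n → ℝ → Euc n,
            ContinuousOn (fun p : ℝ × Euc n => X p.2 p.1) (Iio s ×ˢ (Z ∩ Metric.ball z δ)) ∧
            ∀ z' ∈ Z ∩ Metric.ball z δ, IsLogCurve (V₀ + V₁) D s z' (X z') ∧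
              ∀ s' < s, ‖Real.exp (-s') • X z' s' - z'‖ ≤ K * Real.exp s') →
          ∃ δ > 0, ∃ X : Euc n → ℝ → Euc n,
            ContinuousOn (fun p : ℝ × Euc n => X p.2 p.1)
              (Iio (min s₁ s₂) ×ˢ (Z ∩ Metric.ball z δ)) ∧
            ∀ z' ∈ Z ∩ Metric.ball z δ, IsLogCurve (V₀ + V₁) D (min s₁ s₂) z' (X z') ∧
              ∀ s' < min s₁ s₂, ‖Real.exp (-s') • X z' s' - z'‖ ≤ max K₁ K₂ * Real.exp s' := by
        rintro s K hs hK ⟨δ, hδ, X, hXc, hX⟩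
        refine ⟨δ, hδ, X, hXc.mono (prod_mono_left (Iio_subset_Iio hs)), fun z' hz' =>
          ⟨(hX z' hz').1.mono hs, fun s' hs' => ((hX z' hz').2 s' (hs'.trans_le hs)).trans ?_⟩⟩
        gcongr
      rcases hz with hz | hz
      · exact aux s₁ K₁ (min_le_left _ _) (le_max_left _ _) (hS z hz)
      · exact aux s₂ K₂ (min_le_right _ _) (le_max_right _ _) (hT z hz)
    · intro θ hθ
      obtain ⟨δ₁, hδ₁, s₁, K₁, X, hXc, hX⟩ := exists_local_family h hZ hhyp hF hR hθ
      refine ⟨Z ∩ Metric.ball θ δ₁, inter_mem_nhdsWithin _ (Metric.ball_mem_nhds θ hδ₁), s₁, K₁,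
        fun z hz => ?_⟩
      obtain ⟨δ, hδ, hsub⟩ := Metric.isOpen_iff.1 Metric.isOpen_ball z hz.2
      have hsub' : Z ∩ Metric.ball z δ ⊆ Z ∩ Metric.ball θ δ₁ := inter_subset_inter_right _ hsub
      exact ⟨δ, hδ, X, hXc.mono (prod_mono_right hsub'), fun z' hz' => hX z' (hsub' hz')⟩
  obtain ⟨s, K₀, hfam⟩ := key
  choose! δ hδ Y hYc hY using hfam
  set s₀ := min s (Real.log R) with hs₀
  have hle : s₀ ≤ s := min_le_left _ _
  have hR₀ : Real.exp s₀ ≤ R := by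
    rw [← Real.le_log_iff_exp_le hR]; exact min_le_right _ _
  have hself : ∀ z ∈ Z, z ∈ Z ∩ Metric.ball z (δ z) := fun z hz =>
    ⟨hz, Metric.mem_ball_self (hδ z hz)⟩
  -- From each local family only the curve through its own centre is kept. By uniqueness the curves
  -- Y z' z' agree with Y z z' for z' near z, so continuity is inherited from the family centred at
  -- z.
  refine ⟨s₀, K₀, fun z => Y z z, hR₀, ?_, fun z hz => ⟨((hY z hz z (hself z hz)).1).mono hle,
    fun s hs => (hY z hz z (hself z hz)).2 s (hs.trans_le hle)⟩⟩
  rintro ⟨s', z⟩ ⟨hs', hz⟩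
  have h1 : ContinuousWithinAt (fun p : ℝ × Euc n => Y z p.2 p.1)
      (Iio s₀ ×ˢ (Z ∩ Metric.ball z (δ z))) (s', z) :=
    ((hYc z hz).mono (prod_mono_left (Iio_subset_Iio hle))) _ ⟨hs', hself z hz⟩
  have h2 : ContinuousWithinAt (fun p : ℝ × Euc n => Y p.2 p.2 p.1)
      (Iio s₀ ×ˢ (Z ∩ Metric.ball z (δ z))) (s', z) := by
    refine h1.congr ?_ rfl
    rintro ⟨t, z'⟩ ⟨ht, hz'⟩
    exact IsLogCurve.eq (K₀ := K₀) h hgood hZ hhyp hF hR hz'.1 hR₀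
      ((hY z hz z' hz').1.mono hle) ((hY z' hz'.1 z' (hself z' hz'.1)).1.mono hle)
      (fun s hs => (hY z hz z' hz').2 s (hs.trans_le hle)) ht
  refine h2.mono_of_mem_nhdsWithin ?_
  rw [nhdsWithin_prod_eq]
  exact prod_mem_prod self_mem_nhdsWithin
    (inter_mem_nhdsWithin _ (Metric.ball_mem_nhds z (hδ z hz)))

end Family

/-! ### The homeomorphism of cones -/

section ConeMap

variable {n : ℕ} {D Z U U₀ : Set (Euc n)} {V : Euc n → Euc n} {s₀ K₀ ρ : ℝ}
  {X : Euc n → ℝ → Euc n}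

theorem norm_exp_smul {z : Euc n} (hz : ‖z‖ = 1) (s : ℝ) : ‖Real.exp s • z‖ = Real.exp s := by
  rw [norm_smul, hz, mul_one, Real.norm_of_nonneg (Real.exp_pos s).le]

theorem exp_smul_ne_zero {z : Euc n} (hz : ‖z‖ = 1) (s : ℝ) : Real.exp s • z ≠ 0 :=
  norm_pos_iff.1 (by rw [norm_exp_smul hz]; exact Real.exp_pos s)

theorem direction_exp_smul {z : Euc n} (hz : ‖z‖ = 1) (s : ℝ) :
    ‖Real.exp s • z‖⁻¹ • Real.exp s • z = z := by
  rw [norm_exp_smul hz, inv_smul_smul₀ (Real.exp_pos s).ne']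

theorem direction_mem_of_mem_coneOver {y : Euc n} (hy : y ∈ coneOver Z) (h0 : y ≠ 0) :
    ‖y‖⁻¹ • y ∈ Z := by
  obtain ⟨z, hz, hz1, r, hr, rfl⟩ := hy
  have hr0 : r ≠ 0 := fun h => h0 (by rw [h, zero_smul])
  rwa [norm_smul, hz1, mul_one, Real.norm_of_nonneg hr, inv_smul_smul₀ hr0]

theorem mem_coneOver_of_direction {y : Euc n} (h0 : y ≠ 0) (hy : ‖y‖⁻¹ • y ∈ Z) :
    y ∈ coneOver Z :=
  ⟨_, hy, norm_direction h0, ‖y‖, norm_nonneg _, by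
    rw [smul_inv_smul₀ (norm_ne_zero_iff.2 h0)]⟩

/-- The map that takes the ray in the direction `z` to the curve `X z`. -/
def coneMap (X : Euc n → ℝ → Euc n) (y : Euc n) : Euc n :=
  ‖y‖ • ‖y‖⁻¹ • X (‖y‖⁻¹ • y) (Real.log ‖y‖)

/-- The factor ‖y‖ ‖y‖⁻¹ in `coneMap` is 1 off the origin and 0 at it, which fixes the vertex
without a case distinction. -/
theorem coneMap_zero : coneMap X 0 = 0 := by simp [coneMap]

theorem coneMap_of_ne {y : Euc n} (hy : y ≠ 0) :
    coneMap X y = X (‖y‖⁻¹ • y) (Real.log ‖y‖) :=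
  smul_inv_smul₀ (norm_ne_zero_iff.2 hy) _

theorem coneMap_exp_smul {z : Euc n} (hz : ‖z‖ = 1) (s : ℝ) :
    coneMap X (Real.exp s • z) = X z s := by
  rw [coneMap_of_ne (exp_smul_ne_zero hz s), direction_exp_smul hz, norm_exp_smul hz, Real.log_exp]

theorem norm_coneMap (hX : ∀ z ∈ Z, IsLogCurve V D s₀ z (X z)) {y : Euc n} (hy : y ∈ coneOver Z)
    (hys : ‖y‖ < Real.exp s₀) : ‖coneMap X y‖ = ‖y‖ := by
  rcases eq_or_ne y 0 with rfl | h0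
  · rw [coneMap_zero]
  · have hr : 0 < ‖y‖ := norm_pos_iff.2 h0
    rw [coneMap_of_ne h0, (hX _ (direction_mem_of_mem_coneOver hy h0)).norm _
      ((Real.log_lt_iff_lt_exp hr).2 hys), Real.exp_log hr]

/-- The directions differ by at most K₀‖y‖, so the points differ by at most K₀‖y‖²: this is the
tangency. -/
theorem norm_coneMap_sub_le
    (hXK : ∀ z ∈ Z, ∀ s < s₀, ‖Real.exp (-s) • X z s - z‖ ≤ K₀ * Real.exp s) {y : Euc n}
    (hy : y ∈ coneOver Z) (hys : ‖y‖ < Real.exp s₀) : ‖coneMap X y - y‖ ≤ K₀ * ‖y‖ * ‖y‖ := by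
  rcases eq_or_ne y 0 with rfl | h0
  · simp [coneMap_zero]
  · have hr : 0 < ‖y‖ := norm_pos_iff.2 h0
    have h1 := hXK _ (direction_mem_of_mem_coneOver hy h0) _ ((Real.log_lt_iff_lt_exp hr).2 hys)
    rw [Real.exp_neg, Real.exp_log hr, ← coneMap_of_ne (X := X) h0, ← smul_sub, norm_smul, norm_inv,
      norm_norm, inv_mul_le_iff₀ hr] at h1
    linarith

theorem continuousOn_coneMap (hX : ∀ z ∈ Z, IsLogCurve V D s₀ z (X z))
    (hXc : ContinuousOn (fun p : ℝ × Euc n => X p.2 p.1) (Iio s₀ ×ˢ Z)) :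
    ContinuousOn (coneMap X) (coneOver Z ∩ Metric.ball 0 (Real.exp s₀)) := by
  intro y hy
  rcases eq_or_ne y 0 with rfl | h0
  · rw [ContinuousWithinAt, coneMap_zero, tendsto_zero_iff_norm_tendsto_zero]
    have h1 : Tendsto (fun y : Euc n => ‖y‖)
        (𝓝[coneOver Z ∩ Metric.ball 0 (Real.exp s₀)] 0) (𝓝 0) := by
      simpa using (continuous_norm.tendsto (0 : Euc n)).mono_left nhdsWithin_le_nhds
    refine h1.congr' ?_
    filter_upwards [self_mem_nhdsWithin] with y hy
    exact (norm_coneMap hX hy.1 (by simpa using hy.2)).symm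
  · have hn : ContinuousAt (fun y : Euc n => ‖y‖) y := continuous_norm.continuousAt
    have hr : ‖y‖ ≠ 0 := norm_ne_zero_iff.2 h0
    have h1 : ContinuousWithinAt (fun y : Euc n => (Real.log ‖y‖, ‖y‖⁻¹ • y))
        ((coneOver Z ∩ Metric.ball 0 (Real.exp s₀)) ∩ {0}ᶜ) y :=
      ((hn.log hr).prodMk ((hn.inv₀ hr).smul continuousAt_id)).continuousWithinAt
    have hmaps : MapsTo (fun y : Euc n => (Real.log ‖y‖, ‖y‖⁻¹ • y))
        ((coneOver Z ∩ Metric.ball 0 (Real.exp s₀)) ∩ {0}ᶜ) (Iio s₀ ×ˢ Z) := fun w hw =>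
      ⟨(Real.log_lt_iff_lt_exp (norm_pos_iff.2 hw.2)).2 (by simpa using hw.1.2),
        direction_mem_of_mem_coneOver hw.1.1 hw.2⟩
    have h2 : ContinuousWithinAt (coneMap X)
        ((coneOver Z ∩ Metric.ball 0 (Real.exp s₀)) ∩ {0}ᶜ) y := by
      refine ContinuousWithinAt.congr
        (ContinuousWithinAt.comp (g := fun p : ℝ × Euc n => X p.2 p.1)
          (hXc _ (hmaps ⟨hy, h0⟩)) h1 hmaps) (fun w hw => coneMap_of_ne hw.2) (coneMap_of_ne h0)
    exact h2.mono_of_mem_nhdsWithin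
      (inter_mem_nhdsWithin _ (isOpen_compl_singleton.mem_nhds h0))

theorem injOn_coneMap (hX : ∀ z ∈ Z, IsLogCurve V D s₀ z (X z))
    (hXi : ∀ z ∈ Z, ∀ z' ∈ Z, ∀ s < s₀, X z s = X z' s → z = z') :
    InjOn (coneMap X) (coneOver Z ∩ Metric.ball 0 (Real.exp s₀)) := by
  rintro y ⟨hy, hys⟩ y' ⟨hy', hys'⟩ heq
  rw [mem_ball_zero_iff] at hys hys'
  have hn : ‖y‖ = ‖y'‖ := by rw [← norm_coneMap hX hy hys, heq, norm_coneMap hX hy' hys']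
  rcases eq_or_ne y 0 with rfl | h0
  · rw [norm_zero] at hn
    exact (norm_eq_zero.1 hn.symm).symm
  have hr : 0 < ‖y‖ := norm_pos_iff.2 h0
  have h0' : y' ≠ 0 := norm_pos_iff.1 (hn ▸ hr)
  rw [coneMap_of_ne h0, coneMap_of_ne h0', ← hn] at heq
  have h1 := direction_mem_of_mem_coneOver hy' h0'
  rw [← hn] at h1
  exact smul_right_injective _ (inv_ne_zero hr.ne')
    (hXi _ (direction_mem_of_mem_coneOver hy h0) _ h1 _ ((Real.log_lt_iff_lt_exp hr).2 hys) heq)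

theorem isCompact_coneOver_inter_closedBall (hZ : IsCompact Z) (hZ1 : ∀ z ∈ Z, ‖z‖ = 1) (ρ : ℝ) :
    IsCompact (coneOver Z ∩ Metric.closedBall 0 ρ) := by
  have h1 : coneOver Z ∩ Metric.closedBall 0 ρ = (fun p : ℝ × Euc n => p.1 • p.2) '' Icc 0 ρ ×ˢ Z := by
    ext y
    constructor
    · rintro ⟨⟨z, hz, hz1, r, hr, rfl⟩, hy⟩
      rw [mem_closedBall_zero_iff, norm_smul, hz1, mul_one, Real.norm_of_nonneg hr] at hy
      exact ⟨(r, z), ⟨⟨hr, hy⟩, hz⟩, rfl⟩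
    · rintro ⟨⟨r, z⟩, ⟨⟨hr, hrρ⟩, hz⟩, rfl⟩
      refine ⟨⟨z, hz, hZ1 z hz, r, hr, rfl⟩, ?_⟩
      rwa [mem_closedBall_zero_iff, norm_smul, hZ1 z hz, mul_one, Real.norm_of_nonneg hr]
  rw [h1]
  exact (isCompact_Icc.prod hZ).image continuous_smul

/-- On the closed truncated cone, which is compact, a continuous injection is a closed embedding; it
is then restricted to the open part. The closed ball must fit inside the domain, hence the strict
bound on ρ. -/
theorem isInducing_coneMap (hZ : IsCompact Z) (hZ1 : ∀ z ∈ Z, ‖z‖ = 1)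
    (hX : ∀ z ∈ Z, IsLogCurve V D s₀ z (X z))
    (hXc : ContinuousOn (fun p : ℝ × Euc n => X p.2 p.1) (Iio s₀ ×ˢ Z))
    (hXi : ∀ z ∈ Z, ∀ z' ∈ Z, ∀ s < s₀, X z s = X z' s → z = z') (hρ : ρ < Real.exp s₀) :
    IsInducing fun y : ↥(coneOver Z ∩ Metric.ball 0 ρ) => coneMap X y := by
  have hsub : coneOver Z ∩ Metric.closedBall 0 ρ ⊆ coneOver Z ∩ Metric.ball 0 (Real.exp s₀) :=
    inter_subset_inter_right _ (Metric.closedBall_subset_ball hρ)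
  have : CompactSpace ↥(coneOver Z ∩ Metric.closedBall 0 ρ) := isCompact_iff_compactSpace.1
    (isCompact_coneOver_inter_closedBall hZ hZ1 ρ)
  have hc := ((continuousOn_coneMap hX hXc).mono hsub).domRestrict
  have hi := ((injOn_coneMap hX hXi).mono hsub).injective
  have hsub' : coneOver Z ∩ Metric.ball 0 ρ ⊆ coneOver Z ∩ Metric.closedBall 0 ρ :=
    inter_subset_inter_right _ Metric.ball_subset_closedBall
  have h2 : IsInducing (Set.domRestrict (coneOver Z ∩ Metric.closedBall 0 ρ) (coneMap X) ∘
      Set.inclusion hsub') :=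
    (hc.isClosedEmbedding hi).isInducing.comp (IsEmbedding.inclusion hsub').isInducing
  exact h2

/-- The curves `X z` are the largest solution curves that come out of the origin in the directions
`U₀`. -/
def IsOutgoingFamily (V : Euc n → Euc n) (D U₀ Z : Set (Euc n)) (s₀ : ℝ)
    (X : Euc n → ℝ → Euc n) : Prop :=
  ∀ ρ, 0 < ρ → ρ ≤ Real.exp s₀ → ∀ θ ∈ U₀,
    (∀ γ, IsOutgoing V (truncated D ρ) θ γ → θ ∈ Z ∧ γ ⊆ X θ '' Iio (Real.log ρ)) ∧
    (θ ∈ Z → IsOutgoing V (truncated D ρ) θ (X θ '' Iio (Real.log ρ)))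

theorem IsOutgoingFamily.maximal_iff (hf : IsOutgoingFamily V D U₀ Z s₀ X) (hρ : 0 < ρ)
    (hρs : ρ ≤ Real.exp s₀) {θ : Euc n} (hθ : θ ∈ U₀) {γ : Set (Euc n)} :
    Maximal (IsOutgoing V (truncated D ρ) θ) γ ↔ θ ∈ Z ∧ γ = X θ '' Iio (Real.log ρ) := by
  obtain ⟨h1, h2⟩ := hf ρ hρ hρs θ hθ
  constructor
  · intro hm
    obtain ⟨h3, h4⟩ := h1 γ hm.prop
    exact ⟨h3, h4.antisymm (hm.le_of_ge (h2 h3) h4)⟩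
  · rintro ⟨h3, rfl⟩
    exact ⟨h2 h3, fun γ hγ _ => (h1 γ hγ).2⟩

theorem IsOutgoingFamily.variety_eq (hf : IsOutgoingFamily V D U₀ Z s₀ X) (hρ : 0 < ρ)
    (hρs : ρ ≤ Real.exp s₀) (hZU : Z ⊆ U) (hU : U ⊆ U₀) :
    variety IsOutgoing V (truncated D ρ) U =
      {y | ∃ z ∈ Z, y = 0 ∨ y ∈ X z '' Iio (Real.log ρ)} := by
  ext y
  constructor
  · rintro ⟨θ, hθ, γ, hγ, hy⟩
    obtain ⟨h1, h2⟩ := (hf ρ hρ hρs θ (hU hθ)).1 γ hγ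
    exact ⟨θ, h1, hy.imp_right fun h => h2 h⟩
  · rintro ⟨z, hz, hy⟩
    exact ⟨z, hZU hz, _, (hf ρ hρ hρs z (hU (hZU hz))).2 hz, hy⟩

/-- For empty Z both sides are empty: neither the cone nor the variety then contains the origin. -/
theorem image_coneMap (hZ1 : ∀ z ∈ Z, ‖z‖ = 1) (hρ : 0 < ρ) :
    coneMap X '' (coneOver Z ∩ Metric.ball 0 ρ) =
      {y | ∃ z ∈ Z, y = 0 ∨ y ∈ X z '' Iio (Real.log ρ)} := by
  ext w
  constructor
  · rintro ⟨y, ⟨hy, hyρ⟩, rfl⟩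
    rcases eq_or_ne y 0 with rfl | h0
    · obtain ⟨z, hz, -⟩ := hy
      exact ⟨z, hz, Or.inl coneMap_zero⟩
    · refine ⟨_, direction_mem_of_mem_coneOver hy h0, Or.inr ⟨Real.log ‖y‖, ?_,
        (coneMap_of_ne h0).symm⟩⟩
      exact Real.log_lt_log (norm_pos_iff.2 h0) (by simpa using hyρ)
  · rintro ⟨z, hz, rfl | ⟨s, hs, rfl⟩⟩
    · exact ⟨0, ⟨⟨z, hz, hZ1 z hz, 0, le_rfl, (zero_smul _ _).symm⟩, by simpa using hρ⟩,
        coneMap_zero⟩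
    · refine ⟨Real.exp s • z, ⟨⟨z, hz, hZ1 z hz, _, (Real.exp_pos s).le, rfl⟩, ?_⟩,
        coneMap_exp_smul (hZ1 z hz) s⟩
      rw [mem_ball_zero_iff, norm_exp_smul (hZ1 z hz)]
      exact (Real.lt_log_iff_exp_lt hρ).1 hs

theorem ray_subset (hZ1 : ∀ z ∈ Z, ‖z‖ = 1) (hρ : 0 < ρ) {z : Euc n} (hz : z ∈ Z) :
    (fun s => Real.exp s • z) '' Iio (Real.log ρ) ⊆ coneOver Z ∩ Metric.ball 0 ρ := by
  rintro _ ⟨s, hs, rfl⟩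
  refine ⟨⟨z, hz, hZ1 z hz, _, (Real.exp_pos s).le, rfl⟩, ?_⟩
  rw [mem_ball_zero_iff, norm_exp_smul (hZ1 z hz)]
  exact (Real.lt_log_iff_exp_lt hρ).1 hs

theorem image_coneMap_ray {z : Euc n} (hz : ‖z‖ = 1) (s : ℝ) :
    coneMap X '' ((fun s => Real.exp s • z) '' Iio s) = X z '' Iio s := by
  rw [image_image]
  exact image_congr fun s _ => coneMap_exp_smul hz s

/-- The homeomorphism between the cone over `Z` and the unstable variety. -/
theorem IsOutgoingFamily.exists_homeomorph {V₀ : Euc n → Euc n}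
    (hf₀ : IsOutgoingFamily V₀ D U₀ Z s₀ fun z s => Real.exp s • z)
    (hf : IsOutgoingFamily V D U₀ Z s₀ X) (hZ : IsCompact Z) (hZ1 : ∀ z ∈ Z, ‖z‖ = 1)
    (hX : ∀ z ∈ Z, IsLogCurve V D s₀ z (X z))
    (hXc : ContinuousOn (fun p : ℝ × Euc n => X p.2 p.1) (Iio s₀ ×ˢ Z))
    (hXi : ∀ z ∈ Z, ∀ z' ∈ Z, ∀ s < s₀, X z s = X z' s → z = z')
    (hXK : ∀ z ∈ Z, ∀ s < s₀, ‖Real.exp (-s) • X z s - z‖ ≤ K₀ * Real.exp s)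
    (hρ : 0 < ρ) (hρs : ρ < Real.exp s₀) (hZU : Z ⊆ U) (hU : U ⊆ U₀) :
    ∃ Φ : ↥(coneOver Z ∩ Metric.ball 0 ρ) ≃ₜ ↥(variety IsOutgoing V (truncated D ρ) U),
      (∀ y, ‖(Φ y : Euc n)‖ = ‖(y : Euc n)‖) ∧
      (fun y => (Φ y : Euc n) - (y : Euc n))
        =o[comap Subtype.val (𝓝 0)] (fun y => (y : Euc n)) ∧
      BijOn (fun γ : Set (Euc n) => Subtype.val '' (Φ '' (Subtype.val ⁻¹' γ)))
        {γ | ∃ θ₀ ∈ U, Maximal (IsOutgoing V₀ (truncated D ρ) θ₀) γ}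
        {γ | ∃ θ₀ ∈ U, Maximal (IsOutgoing V (truncated D ρ) θ₀) γ} ∧
      ∀ θ₀ ∈ U, ∀ γ : Set (Euc n), Maximal (IsOutgoing V₀ (truncated D ρ) θ₀) γ →
        Maximal (IsOutgoing V (truncated D ρ) θ₀)
          (Subtype.val '' (Φ '' (Subtype.val ⁻¹' γ))) := by
  have himg : coneMap X '' (coneOver Z ∩ Metric.ball 0 ρ) =
      variety IsOutgoing V (truncated D ρ) U := by
    rw [image_coneMap hZ1 hρ, hf.variety_eq hρ hρs.le hZU hU]
  have hsub : coneOver Z ∩ Metric.ball 0 ρ ⊆ coneOver Z ∩ Metric.ball 0 (Real.exp s₀) :=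
    inter_subset_inter_right _ (Metric.ball_subset_ball hρs.le)
  have hbij : BijOn (coneMap X) (coneOver Z ∩ Metric.ball 0 ρ)
      (variety IsOutgoing V (truncated D ρ) U) :=
    ⟨fun y hy => himg ▸ mem_image_of_mem _ hy, (injOn_coneMap hX hXi).mono hsub, himg.ge⟩
  let e := hbij.equiv
  have hind : IsInducing e := by
    refine (IsInducing.of_comp_iff (g := Subtype.val) IsInducing.subtypeVal).1 ?_
    exact isInducing_coneMap hZ hZ1 hX hXc hXi hρs
  let Φ := e.toHomeomorphOfIsInducing hind
  have hΦ : ∀ y, (Φ y : Euc n) = coneMap X y := fun y => rfl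
  have hmem : ∀ y : ↥(coneOver Z ∩ Metric.ball 0 ρ), ‖(y : Euc n)‖ < Real.exp s₀ := fun y => by
    simpa using (hsub y.2).2
  have himΦ : ∀ γ ⊆ coneOver Z ∩ Metric.ball 0 ρ,
      Subtype.val '' (Φ '' (Subtype.val ⁻¹' γ)) = coneMap X '' γ := fun γ hγ => by
    rw [image_image]
    ext w
    constructor
    · rintro ⟨y, hy, rfl⟩
      exact ⟨y, hy, (hΦ y).symm⟩
    · rintro ⟨y, hy, rfl⟩
      exact ⟨⟨y, hγ hy⟩, hy, hΦ _⟩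
  have himray : ∀ z ∈ Z, Subtype.val '' (Φ '' (Subtype.val ⁻¹'
      ((fun s => Real.exp s • z) '' Iio (Real.log ρ)))) = X z '' Iio (Real.log ρ) := fun z hz => by
    rw [himΦ _ (ray_subset hZ1 hρ hz), image_coneMap_ray (hZ1 z hz)]
  have hlast : ∀ θ₀ ∈ U, ∀ γ : Set (Euc n), Maximal (IsOutgoing V₀ (truncated D ρ) θ₀) γ →
      Maximal (IsOutgoing V (truncated D ρ) θ₀)
        (Subtype.val '' (Φ '' (Subtype.val ⁻¹' γ))) := fun θ hθ γ hγ => by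
    obtain ⟨h1, rfl⟩ := (hf₀.maximal_iff hρ hρs.le (hU hθ)).1 hγ
    exact (hf.maximal_iff hρ hρs.le (hU hθ)).2 ⟨h1, himray θ h1⟩
  refine ⟨Φ, fun y => ?_, ?_, ⟨?_, ?_, ?_⟩, hlast⟩
  · rw [hΦ, norm_coneMap hX y.2.1 (hmem y)]
  · refine Asymptotics.isLittleO_iff.2 fun c hc => ?_
    have h1 : Tendsto (fun y : Euc n => K₀ * ‖y‖) (𝓝 0) (𝓝 0) := by
      simpa using (continuous_norm.tendsto (0 : Euc n)).const_mul K₀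
    filter_upwards [(h1.eventually_lt_const hc).comap Subtype.val] with y hy
    rw [hΦ]
    refine (norm_coneMap_sub_le hXK y.2.1 (hmem y)).trans ?_
    gcongr
  · rintro γ ⟨θ, hθ, hγ⟩
    exact ⟨θ, hθ, hlast θ hθ γ hγ⟩
  · rintro γ ⟨θ, hθ, hγ⟩ γ' ⟨θ', hθ', hγ'⟩ heq
    obtain ⟨h1, rfl⟩ := (hf₀.maximal_iff hρ hρs.le (hU hθ)).1 hγ
    obtain ⟨h2, rfl⟩ := (hf₀.maximal_iff hρ hρs.le (hU hθ')).1 hγ'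
    simp only at heq
    rw [himΦ _ (ray_subset hZ1 hρ h1), himΦ _ (ray_subset hZ1 hρ h2)] at heq
    exact (((injOn_coneMap hX hXi).mono hsub).image_eq_image_iff (ray_subset hZ1 hρ h1)
      (ray_subset hZ1 hρ h2)).1 heq
  · rintro γ ⟨θ, hθ, hγ⟩
    obtain ⟨h1, rfl⟩ := (hf.maximal_iff hρ hρs.le (hU hθ)).1 hγ
    exact ⟨_, ⟨θ, hθ, (hf₀.maximal_iff hρ hρs.le (hU hθ)).2 ⟨h1, rfl⟩⟩, himray θ h1⟩

end ConeMap

/-! ### The unstable variety -/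

section Outgoing

variable {n : ℕ} {d R : ℝ} {D : Set (Euc n)} {V₀ V₁ : Euc n → Euc n} {F : ℝ × Euc n → Euc n}

theorem IsOutgoing.subset {V : Euc n → Euc n} {O : Set (Euc n)} {θ : Euc n} {γ : Set (Euc n)}
    (hγ : IsOutgoing V O θ γ) : γ ⊆ O := by
  obtain ⟨x, a, b, hx, -, rfl⟩ := hγ
  rintro _ ⟨t, ht, rfl⟩
  exact (hx.2 t ht.1 ht.2).1

theorem IsOutgoing.mono {V : Euc n → Euc n} {O O' : Set (Euc n)} {θ : Euc n} {γ : Set (Euc n)}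
    (hγ : IsOutgoing V O θ γ) (hO : O ⊆ O') : IsOutgoing V O' θ γ := by
  obtain ⟨x, a, b, hx, hlim, rfl⟩ := hγ
  exact ⟨x, a, b, ⟨hx.1, fun t h1 h2 => ⟨hO (hx.2 t h1 h2).1, (hx.2 t h1 h2).2⟩⟩, hlim, rfl⟩

theorem mem_zeroSetPos_of_isOutgoing (h : IsHomogeneousField d D V₀)
    (hZ : ∀ θ ∈ zeroSet D V₀, θ ∈ D ∧ radial V₀ θ ≠ 0) (hF : IsPolarTerm d R D V₁ F) (hR : 0 < R)
    {θ : Euc n} (hθ : θ ∈ D ∧ 0 < radial V₀ θ) {O γ : Set (Euc n)} (hO : O ⊆ D)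
    (hγ : IsOutgoing (V₀ + V₁) O θ γ) : θ ∈ zeroSetPos D V₀ := by
  obtain ⟨x, a, b, hx, hlim, -⟩ := hγ
  exact mem_zeroSetPos_of_isSolution h hZ hF hR hθ.1 hθ.2 hO hx hlim

theorem isOutgoingFamily_add (h : IsHomogeneousField d D V₀) (hgood : IsGood D V₀)
    (hZ : ∀ θ ∈ zeroSet D V₀, θ ∈ D ∧ radial V₀ θ ≠ 0) (hhyp : IsHyperbolic D V₀)
    (hF : IsPolarTerm d R D V₁ F) (hR : 0 < R) {s₀ K₀ : ℝ} {X : Euc n → ℝ → Euc n}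
    (hs₀ : Real.exp s₀ ≤ R)
    (hX : ∀ z ∈ zeroSetPos D V₀, IsLogCurve (V₀ + V₁) D s₀ z (X z) ∧
      ∀ s < s₀, ‖Real.exp (-s) • X z s - z‖ ≤ K₀ * Real.exp s) :
    IsOutgoingFamily (V₀ + V₁) D {x | x ∈ D ∧ 0 < radial V₀ x} (zeroSetPos D V₀) s₀ X := by
  intro ρ hρ hρs θ hθ
  have hV : ∀ y ∈ truncated D ρ, ContDiffAt ℝ 1 (V₀ + V₁) y := fun y hy =>
    contDiffAt_add_of_isPolarTerm h hF ⟨hy.1, Metric.ball_subset_ball (hρs.trans hs₀) hy.2⟩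
  constructor
  · intro γ hγ
    have hθZ := mem_zeroSetPos_of_isOutgoing h hZ hF hR hθ inter_subset_left hγ
    refine ⟨hθZ, fun y hy => ?_⟩
    have hyO := hγ.subset hy
    refine ⟨Real.log ‖y‖, Real.log_lt_log (norm_pos_iff.2 (h.isOpenCone.ne_zero hyO.1))
      (by simpa using hyO.2), ?_⟩
    exact (eq_of_mem_isOutgoing h hgood hZ hhyp hF hR hθZ inter_subset_left hV
      (fun w hw => ⟨s₀, log_norm_lt h.isOpenCone
        ⟨hw.1, Metric.ball_subset_ball hρs hw.2⟩, (hX θ hθZ).1⟩) (hX θ hθZ).2 hγ hy).symm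
  · intro hθZ
    have hlog : Real.log ρ ≤ s₀ := (Real.log_le_iff_le_exp hρ).2 hρs
    have h1 := ((hX θ hθZ).1.mono hlog).isOutgoing
    rw [Real.exp_log hρ] at h1
    exact h1 fun y hy => (hV y hy).continuousAt.continuousWithinAt

theorem isPolarTerm_zero : IsPolarTerm d R D (0 : Euc n → Euc n) 0 :=
  ⟨contDiffOn_const, fun _ _ _ _ _ _ => by simp⟩

theorem eq_radial_smul {V : Euc n → Euc n} {x : Euc n} (hr : radial V x ≠ 0)
    (hs : slope V x = 0) : V x = radial V x • x := by
  rw [slope_eq hr, sub_eq_zero] at hs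
  exact (inv_smul_eq_iff₀ hr).1 hs

theorem isLogCurve_ray (h : IsHomogeneousField d D V₀)
    (hZ : ∀ θ ∈ zeroSet D V₀, θ ∈ D ∧ radial V₀ θ ≠ 0) {z : Euc n} (hz : z ∈ zeroSetPos D V₀)
    (s₀ : ℝ) : IsLogCurve V₀ D s₀ z fun s => Real.exp s • z := by
  obtain ⟨hz1, hzD, hr, hs⟩ := (mem_zeroSetPos_iff h hZ).1 hz
  have hV : ∀ s : ℝ, V₀ (Real.exp s • z) =
      (Real.exp s ^ d * radial V₀ z / Real.exp s) • Real.exp s • z := fun s => by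
    rw [h.homogeneous _ (Real.exp_pos s) z hzD, eq_radial_smul hr.ne' hs, smul_smul, smul_smul,
      div_mul_cancel₀ _ (Real.exp_pos s).ne']
  have hrate : ∀ s : ℝ, rate V₀ (Real.exp s • z) =
      Real.exp s ^ d * radial V₀ z / Real.exp s := fun s => by
    rw [rate, hV, inner_smul_left, real_inner_self_eq_norm_sq, conj_trivial,
      mul_div_cancel_right₀]
    rw [norm_exp_smul hz1]
    exact pow_ne_zero 2 (Real.exp_pos s).ne'
  have hpos : ∀ s : ℝ, 0 < rate V₀ (Real.exp s • z) := fun s => by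
    rw [hrate]
    have := Real.rpow_pos_of_pos (Real.exp_pos s) d
    positivity
  refine ⟨fun s _ => h.isOpenCone.smul_mem _ (Real.exp_pos s) z hzD,
    fun s _ => norm_exp_smul hz1 s, fun s _ => hpos s, fun s _ => ?_, ?_⟩
  · have h1 := (hpos s).ne'
    rw [hV, ← hrate, inv_smul_smul₀ h1]
    exact (Real.hasDerivAt_exp s).smul_const z
  · refine tendsto_const_nhds.congr fun s => ?_
    rw [Real.exp_neg, inv_smul_smul₀ (Real.exp_pos s).ne']

/-- The unperturbed field is the case V₁ = 0, F = 0, in which the regular curves are rays and K₀ =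
0. -/
theorem isOutgoingFamily_ray (h : IsHomogeneousField d D V₀) (hgood : IsGood D V₀)
    (hZ : ∀ θ ∈ zeroSet D V₀, θ ∈ D ∧ radial V₀ θ ≠ 0) (hhyp : IsHyperbolic D V₀) (s₀ : ℝ) :
    IsOutgoingFamily V₀ D {x | x ∈ D ∧ 0 < radial V₀ x} (zeroSetPos D V₀) s₀
      fun z s => Real.exp s • z := by
  have h1 := isOutgoingFamily_add (V₁ := 0) (F := 0) (K₀ := 0) (s₀ := s₀)
    (X := fun z s => Real.exp s • z) h hgood hZ hhyp isPolarTerm_zero (Real.exp_pos s₀) le_rfl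
    fun z hz => ⟨by rw [add_zero]; exact isLogCurve_ray h hZ hz s₀, fun s _ => by
      rw [Real.exp_neg, inv_smul_smul₀ (Real.exp_pos s).ne']; simp⟩
  rwa [add_zero] at h1

/-- The unstable cone of a hyperbolic homogeneous field. -/
theorem variety_isOutgoing_eq_coneOver (h : IsHomogeneousField d D V₀) (hgood : IsGood D V₀)
    (hZ : ∀ θ ∈ zeroSet D V₀, θ ∈ D ∧ radial V₀ θ ≠ 0) (hhyp : IsHyperbolic D V₀)
    {U : Set (Euc n)} (hZU : zeroSetPos D V₀ ⊆ U) (hU : U ⊆ {x | x ∈ D ∧ 0 < radial V₀ x}) :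
    variety IsOutgoing V₀ D U = coneOver (zeroSetPos D V₀) := by
  have hZ1 : ∀ z ∈ zeroSetPos D V₀, ‖z‖ = 1 := fun z hz => ((mem_zeroSetPos_iff h hZ).1 hz).1
  ext y
  constructor
  · rintro ⟨θ, hθ, γ, hγ, hy⟩
    have hγ' : IsOutgoing (V₀ + 0) D θ γ := by rwa [add_zero]
    have hθZ := mem_zeroSetPos_of_isOutgoing h hZ (isPolarTerm_zero (R := 1)) one_pos (hU hθ)
      subset_rfl hγ'
    rcases hy with rfl | hy
    · exact ⟨θ, hθZ, hZ1 θ hθZ, 0, le_rfl, (zero_smul _ _).symm⟩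
    · have h1 := eq_of_mem_isOutgoing (s₀ := 0) (K₀ := 0) (X := fun s => Real.exp s • θ) h hgood hZ
        hhyp (isPolarTerm_zero (R := 1)) one_pos hθZ subset_rfl
        (fun w hw => by rw [add_zero]; exact (h.contDiffAt hw).of_le (by simp))
        (fun w _ => ⟨Real.log ‖w‖ + 1, lt_add_one _, by
          rw [add_zero]; exact isLogCurve_ray h hZ hθZ _⟩)
        (fun s _ => by rw [Real.exp_neg, inv_smul_smul₀ (Real.exp_pos s).ne']; simp) hγ' hy
      exact ⟨θ, hθZ, hZ1 θ hθZ, _, (Real.exp_pos _).le, h1⟩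
  · rintro ⟨z, hz, hz1, r, hr, rfl⟩
    -- The ray cut off at radius r + 1 already contains the given point, and it is also a solution
    -- curve in D.
    have h1 := (isOutgoingFamily_ray h hgood hZ hhyp (Real.log (r + 1)) (r + 1) (by linarith)
      (by rw [Real.exp_log (by linarith)]) z (hU (hZU hz))).2 hz
    refine ⟨z, hZU hz, _, h1.mono inter_subset_left, ?_⟩
    rcases hr.eq_or_lt with rfl | hr
    · exact Or.inl (zero_smul _ _)
    · exact Or.inr ⟨Real.log r, Real.log_lt_log hr (lt_add_one r), by simp [Real.exp_log hr]⟩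

theorem coneStable_isOutgoing (hR : 0 < R) (h : IsHomogeneousField d D V₀) (hgood : IsGood D V₀)
    (hZ : ∀ θ ∈ zeroSet D V₀, θ ∈ D ∧ radial V₀ θ ≠ 0) (hhyp : IsHyperbolic D V₀)
    (hV₁ : IsHigherOrder d R D V₁) :
    ConeStable IsOutgoing D V₀ (V₀ + V₁) (zeroSetPos D V₀) := by
  obtain ⟨F, hF₁, hF₂⟩ := hV₁
  have hF : IsPolarTerm d R D V₁ F := ⟨hF₁, hF₂⟩
  have hZ1 : ∀ z ∈ zeroSetPos D V₀, ‖z‖ = 1 := fun z hz => ((mem_zeroSetPos_iff h hZ).1 hz).1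
  have hcomp := isCompact_zeroSetPos h hgood hZ
  obtain ⟨s₀, K₀, X, hs₀, hXc, hX⟩ := exists_global_family h hgood hZ hhyp hF hR
  have hfam := isOutgoingFamily_add h hgood hZ hhyp hF hR hs₀ hX
  have hfam₀ := isOutgoingFamily_ray h hgood hZ hhyp s₀
  have hXi : ∀ z ∈ zeroSetPos D V₀, ∀ z' ∈ zeroSetPos D V₀, ∀ s < s₀, X z s = X z' s → z = z' :=
    fun z hz z' hz' s hs heq => (hX z hz).1.direction_eq h.isOpenCone (hX z' hz').1
      (fun y hy => contDiffAt_add_of_isPolarTerm h hF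
        ⟨hy.1, Metric.ball_subset_ball hs₀ hy.2⟩) hs heq
  -- Positivity of p₀ is all that the neighbourhood has to ensure: any outgoing limit direction in
  -- it lies in Z₊.
  refine ⟨{x | x ∈ D ∧ 0 < radial V₀ x}, ?_, fun z hz => ?_, fun U hUo hZU hU =>
    ⟨variety_isOutgoing_eq_coneOver h hgood hZ hhyp hZU hU, ?_⟩⟩
  · refine isOpen_iff_mem_nhds.2 fun x hx => ?_
    filter_upwards [h.isOpenCone.isOpen.mem_nhds hx.1,
      (h.contDiffAt_radial hx.1).continuousAt.eventually_const_lt hx.2] with y h1 h2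
    exact ⟨h1, h2⟩
  · have h1 := (mem_zeroSetPos_iff h hZ).1 hz
    exact ⟨h1.2.1, h1.2.2.1⟩
  obtain ⟨ε, hε, hεU⟩ := hcomp.exists_thickening_subset_open hUo hZU
  -- Half of e^{s₀} makes ρ < e^{s₀} strict, as the homeomorphism requires; the other bound keeps
  -- the directions on the curves within ε of Z₊, hence in U.
  refine ⟨min (Real.exp s₀ / 2) (ε / (|K₀| + 1)), by positivity, fun ρ hρ hρ₀ => ⟨?_, ?_⟩⟩
  · have hρs : ρ ≤ Real.exp s₀ := by
      have := hρ₀.trans (min_le_left _ _)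
      have := Real.exp_pos s₀
      linarith
    rw [hfam.variety_eq hρ hρs hZU hU]
    rintro y ⟨z, hz, rfl | ⟨s, hs, rfl⟩⟩
    · exact ⟨z, hZU hz, hZ1 z hz, 0, le_rfl, (zero_smul _ _).symm⟩
    · have hss : Real.exp s < ρ := (Real.lt_log_iff_exp_lt hρ).1 hs
      have hs' : s < s₀ := Real.exp_lt_exp.1 (hss.trans_le hρs)
      have hn := (hX z hz).1.norm s hs'
      have h0 : X z s ≠ 0 := h.isOpenCone.ne_zero ((hX z hz).1.mem s hs')
      refine mem_coneOver_of_direction h0 (hεU (Metric.mem_thickening_iff.2 ⟨z, hz, ?_⟩))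
      rw [dist_eq_norm, hn, ← Real.exp_neg]
      have h1 : ρ * (|K₀| + 1) ≤ ε :=
        (le_div_iff₀ (by positivity)).1 (hρ₀.trans (min_le_right _ _))
      have h2 := Real.exp_pos s
      calc _ ≤ K₀ * Real.exp s := (hX z hz).2 s hs'
        _ ≤ |K₀| * Real.exp s := by gcongr; exact le_abs_self _
        _ < ρ * (|K₀| + 1) := by nlinarith [abs_nonneg K₀]
        _ ≤ ε := h1
  · have hρs : ρ < Real.exp s₀ := by
      have := hρ₀.trans (min_le_left _ _)
      have := Real.exp_pos s₀
      linarith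
    exact hfam₀.exists_homeomorph hfam hcomp hZ1 (fun z hz => (hX z hz).1) hXc hXi
      (fun z hz => (hX z hz).2) hρ hρs hZU hU

end Outgoing

/-! ### Reversal of time and the stable variety -/

section TimeReversal

variable {n : ℕ} {d R : ℝ} {D : Set (Euc n)} {V₀ V₁ : Euc n → Euc n}

theorem comap_neg_initialEnd (b : EReal) :
    comap Neg.neg (initialEnd (-b)) = comap Real.toEReal (𝓝[<] b) := by
  have h1 : comap (Neg.neg : EReal → EReal) (𝓝[>] (-b)) = 𝓝[<] b := by
    rw [nhdsWithin, nhdsWithin, comap_inf, comap_principal,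
      (Homeomorph.neg EReal).isInducing.nhds_eq_comap b]
    congr 2
    ext y
    simp [EReal.neg_lt_neg_iff]
  rw [initialEnd, comap_comap, ← h1, comap_comap]
  rfl

theorem comap_neg_terminalEnd (a : EReal) :
    comap Neg.neg (comap Real.toEReal (𝓝[<] (-a))) = initialEnd a := by
  rw [← comap_neg_initialEnd, comap_comap, neg_neg]
  convert comap_id using 2
  funext t
  simp

theorem TendsToOrigin.comp_neg {x : ℝ → Euc n} {l : Filter ℝ} {θ : Euc n}
    (h : TendsToOrigin x l θ) : TendsToOrigin (fun t => x (-t)) (comap Neg.neg l) θ :=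
  ⟨h.1.comp tendsto_comap, h.2.comp tendsto_comap⟩

theorem neg_lt_iff_between {a b : EReal} (t : ℝ) :
    (-b < (t : EReal) ∧ (t : EReal) < -a) ↔ a < ((-t : ℝ) : EReal) ∧ ((-t : ℝ) : EReal) < b := by
  rw [EReal.coe_neg, EReal.neg_lt_comm, EReal.lt_neg_comm, and_comm]

theorem IsSolution.comp_neg {V : Euc n → Euc n} {O : Set (Euc n)} {x : ℝ → Euc n} {a b : EReal}
    (hx : IsSolution V O x a b) : IsSolution (-V) O (fun t => x (-t)) (-b) (-a) := by
  refine ⟨EReal.neg_lt_neg_iff.2 hx.1, fun t h1 h2 => ?_⟩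
  obtain ⟨h3, h4⟩ := (neg_lt_iff_between t).1 ⟨h1, h2⟩
  obtain ⟨h5, h6⟩ := hx.2 (-t) h3 h4
  refine ⟨h5, ?_⟩
  refine HasDerivAt.congr_deriv (h6.scomp t (hasDerivAt_neg t)) ?_
  rw [neg_one_smul, Pi.neg_apply]

theorem image_comp_neg {x : ℝ → Euc n} {a b : EReal} :
    x '' {t : ℝ | a < t ∧ t < b} = (fun t => x (-t)) '' {t : ℝ | -b < t ∧ t < -a} := by
  ext y
  constructor
  · rintro ⟨t, ht, rfl⟩
    exact ⟨-t, (neg_lt_iff_between _).2 (by rwa [neg_neg]), by simp⟩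
  · rintro ⟨t, ht, rfl⟩
    exact ⟨-t, (neg_lt_iff_between _).1 ht, rfl⟩

/-- The substitution t ↦ -t turns solutions of V into solutions of -V and exchanges the two ends of
the interval. -/
theorem isIncoming_eq :
    (IsIncoming : (Euc n → Euc n) → Set (Euc n) → Euc n → Set (Euc n) → Prop) =
      fun V => IsOutgoing (-V) := by
  funext V O θ γ
  refine propext ⟨?_, ?_⟩
  · rintro ⟨x, a, b, hx, hlim, rfl⟩
    refine ⟨_, _, _, hx.comp_neg, ?_, image_comp_neg⟩
    have h1 := hlim.comp_neg
    rwa [← neg_neg b, comap_neg_terminalEnd] at h1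
  · rintro ⟨x, a, b, hx, hlim, rfl⟩
    refine ⟨_, _, _, by simpa using hx.comp_neg, ?_, image_comp_neg⟩
    have h1 := hlim.comp_neg
    rw [← neg_neg a] at h1
    rwa [comap_neg_initialEnd] at h1

theorem radial_neg : radial (-V₀) = -radial V₀ := by
  funext x; simp [radial]

theorem spherical_neg : spherical (-V₀) = -spherical V₀ := by
  funext x
  simp only [spherical, radial_neg, Pi.neg_apply, neg_smul]
  abel

/-- Numerator and denominator both change sign, so the hyperbolicity condition has the same sign at
Z₊ and at Z₋. -/
theorem slope_neg : slope (-V₀) = slope V₀ := by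
  funext x
  simp only [slope, radial_neg, spherical_neg, Pi.neg_apply, inv_neg, neg_smul, smul_neg, neg_neg]

theorem slopeDomain_neg : slopeDomain D (-V₀) = slopeDomain D V₀ := by
  simp only [slopeDomain, radial_neg, Pi.neg_apply, neg_ne_zero]

theorem zeroSet_neg : zeroSet D (-V₀) = zeroSet D V₀ := by
  simp only [zeroSet, slopeDomain_neg, slope_neg]

theorem zeroSetPos_neg : zeroSetPos D (-V₀) = zeroSetNeg D V₀ := by
  simp only [zeroSetPos, zeroSetNeg, zeroSet_neg, radial_neg, Pi.neg_apply, neg_ne_zero,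
    Left.nonneg_neg_iff]

theorem zeroSetNeg_neg : zeroSetNeg D (-V₀) = zeroSetPos D V₀ := by
  simp only [zeroSetPos, zeroSetNeg, zeroSet_neg, radial_neg, Pi.neg_apply, neg_ne_zero,
    Left.neg_nonpos_iff]

theorem IsHomogeneousField.neg (h : IsHomogeneousField d D V₀) :
    IsHomogeneousField d D (-V₀) :=
  ⟨h.isOpenCone, h.contDiffOn.neg, fun r hr x hx => by
    rw [Pi.neg_apply, Pi.neg_apply, h.homogeneous r hr x hx, smul_neg]⟩

theorem IsGood.neg (h : IsGood D V₀) : IsGood D (-V₀) := by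
  simpa only [IsGood, slopeDomain_neg, slope_neg] using h

theorem IsHyperbolic.neg (h : IsHyperbolic D V₀) : IsHyperbolic D (-V₀) := by
  have hop : ∀ Z θ, slopeOperator (-V₀) Z θ = slopeOperator V₀ Z θ := fun Z θ => by
    simp only [slopeOperator, slope_neg]
  refine ⟨⟨?_, ?_, ?_, ?_, ?_⟩, ?_⟩
  · rw [zeroSet_neg, zeroSetPos_neg, zeroSetNeg_neg, union_comm]
    exact h.zero_eq_empty
  · rw [zeroSetPos_neg, zeroSetNeg_neg]
    exact h.disjoint.symm
  · rw [zeroSetPos_neg]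
    exact h.submanifold_neg
  · rw [zeroSetNeg_neg]
    exact h.submanifold_pos
  · rw [zeroSetPos_neg, zeroSetNeg_neg]
    intro Z hZ
    have := h.nondegenerate Z hZ.symm
    simpa only [slopeForm, slope_neg] using this
  · rw [zeroSetPos_neg, zeroSetNeg_neg]
    intro Z hZ θ hθ
    rw [hop]
    exact h.re_neg Z hZ.symm θ hθ

theorem IsHigherOrder.neg (h : IsHigherOrder d R D V₁) : IsHigherOrder d R D (-V₁) := by
  obtain ⟨F, hF, hF'⟩ := h
  exact ⟨-F, hF.neg, fun θ hθ hθ1 r hr hrR => by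
    rw [Pi.neg_apply, Pi.neg_apply, hF' θ hθ hθ1 r hr hrR, smul_neg]⟩

theorem coneStable_isIncoming (hR : 0 < R) (h : IsHomogeneousField d D V₀) (hgood : IsGood D V₀)
    (hZ : ∀ θ ∈ zeroSet D V₀, θ ∈ D ∧ radial V₀ θ ≠ 0) (hhyp : IsHyperbolic D V₀)
    (hV₁ : IsHigherOrder d R D V₁) :
    ConeStable IsIncoming D V₀ (V₀ + V₁) (zeroSetNeg D V₀) := by
  have h1 := coneStable_isOutgoing hR h.neg hgood.neg
    (by simpa only [zeroSet_neg, radial_neg, Pi.neg_apply, neg_ne_zero] using hZ) hhyp.neg hV₁.neg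
  rw [zeroSetPos_neg, ← neg_add] at h1
  rw [isIncoming_eq]
  exact h1

end TimeReversal

end ConeField

end

/-- Let `V₀` be a (good) hyperbolic homogeneous vector field of degree `d`, smooth and with nonzero
radial component at the directions of `Z`, and let `V = V₀ + V₁`, where `V₁` is of higher order and
`|V₁| ≤ C r |V₀|`.  Then the unstable (stable) variety of `V` near the cone over `Z₊` (`Z₋`) is
homeomorphic and tangent to that cone, with a natural bijection of the solution curves. -/
theorem theorem4p2 {n : ℕ} (d R C : ℝ) (hR : 0 < R) (D : Set (Euc n)) (V₀ V₁ : Euc n → Euc n)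
    (hV₀ : ConeField.IsHomogeneousField d D V₀)
    (hgood : ConeField.IsGood D V₀)
    (hZ : ∀ θ ∈ ConeField.zeroSet D V₀, θ ∈ D ∧ ConeField.radial V₀ θ ≠ 0)
    (hhyp : ConeField.IsHyperbolic D V₀)
    (hV₁ : ConeField.IsHigherOrder d R D V₁)
    (hbound : ∀ x ∈ D, ‖x‖ < R → ‖V₁ x‖ ≤ C * ‖x‖ * ‖V₀ x‖) :
    ConeField.ConeStable ConeField.IsOutgoing D V₀ (V₀ + V₁) (ConeField.zeroSetPos D V₀) ∧
    ConeField.ConeStable ConeField.IsIncoming D V₀ (V₀ + V₁) (ConeField.zeroSetNeg D V₀) :=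
  ⟨ConeField.coneStable_isOutgoing hR hV₀ hgood hZ hhyp hV₁,
    ConeField.coneStable_isIncoming hR hV₀ hgood hZ hhyp hV₁⟩
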